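/- \textbf{Notation.} For a real matrix $A$, $\|A\|_\infty$ is the operator norm, $\|A\|_F$ the Frobenius norm, $\|A\|_1$ the nuclear norm. For a positive definite $G\in\mathbb R^{p\times p}$ and $\nu>p-1$, the Inverse Wishart distribution $\mathcal W_p^{-1}(G,\nu)$ is the probability measure on positive definite matrices whose density with respect to Lebesgue measure on symmetric matrices is proportional to $\det(\Sigma)^{-(\nu+p+1)/2}\exp(-\tfrac12\operatorname{Tr}(G\Sigma^{-1}))$. \textbf{Setting.} Let $n\ge 1$, let $X_1,\dots,X_n$ be i.i.d. $N(0,\Sigma^*)$ in $\mathbb R^p$ with $\Sigma^*$ positive definite, and $\widehat\Sigma=\frac1n\sum_i X_iX_i^\top$. Let $b>0$ be real, $G$ positive definite, let $\Sigma$ have the prior $\mathcal W_p^{-1}(G,p+b-1)$, and let $\Pi(\cdot\mid X^n)$ be the posterior given by Bayes' formula with the Gaussian likelihood. \textbf{Conjugacy.} For all data, the posterior is $\mathcal W_p^{-1}(n\widehat\Sigma+G,\;n+p+b-1)$. \textbf{Bernstein--von Mises.} For every $\kappa>0$ there is a constant $C>0$, depending only on $\kappa$, such that the following holds for all $n,p,b,G,\Sigma^*$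 as above. Let $\delta^{\mathcal W},\hat\delta\ge0$ be contraction rates of the posterior and of the sample covariance: with probability at least $1-\frac{\kappa}{4n}$ over the data, $$\Pi\big(\|\Sigma-\Sigma^*\|_\infty>\delta^{\mathcal W}\|\Sigma^*\|_\infty\mid X^n\big)\le \tfrac1n ,$$ and with probability at least $1-\frac{\kappa}{4n}$, $\|\widehat\Sigma-\Sigma^*\|_\infty\le\hat\delta\,\|\Sigma^*\|_\infty$. Let $\phi$ be a measurable real function of the matrix, $\Phi\ne0$ a symmetric matrix and $C_\phi\ge0$ such that $$\big|\phi(S)-\phi(\Sigma^*)-\operatorname{Tr}[\Phi(S-\Sigma^*)]\big|\le C_\phi\|S-\Sigma^*\|_\infty^2$$ for all positive semidefinite $S$ with $\|S-\Sigma^*\|_\infty\le\max(\delta^{\mathcal W},\hat\delta)\|\Sigma^*\|_\infty$. Let $r$ be the rank of $\Sigma^{*1/2}\Phi\Sigma^{*1/2}=VDV^\top$, where $V\in\mathbb R^{p\times r}$, $V^\top V=I_r$ and $D$ is diagonal, and put $\widetilde G=V^\top\Sigma^{*-1/2}G\,\Sigma^{*-1/2}V$, $n_{r,b}=n+r+b-1$,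 $$\Delta_1=\sqrt n\,(\delta^{\mathcal W})^2C_\phi\|\Sigma^*\|_\infty^2,\qquad \Delta_2=\sqrt n\,\hat\delta^{\,2}C_\phi\|\Sigma^*\|_\infty^2,\qquad \Delta_3=C\,\|D\|_1\,\frac{\|\widetilde G\|_\infty+r+b}{\sqrt{n_{r,b}}},$$ $$\Delta_4=C\,\|D\|_1\sqrt{r+\log n}\,\Big(\sqrt{\tfrac{r+\log n}{n}}+\sqrt{\tfrac{r+\log n}{n_{r,b}}}+\tfrac{\|\widetilde G\|_\infty}{n_{r,b}}\Big).$$ Then, with probability at least $1-\frac{\kappa}{n}$ over the data (in particular $1-\frac1n$ for $\kappa=1$), $$\sup_{x\in\mathbb R}\Big|\Pi\big(\sqrt n(\phi(\Sigma)-\phi(\widehat\Sigma))\le x\mid X^n\big)-\mathbb P(\zeta\le x)\Big|\le\frac{\Delta_1+\Delta_2+\Delta_3+\Delta_4}{\|D\|_F}+\frac{C}{\sqrt n},\qquad \zeta\sim N\big(0,\,2\|\Sigma^{*1/2}\Phi\Sigma^{*1/2}\|_F^2\big).$$ -/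

import Mathlib

open MeasureTheory ProbabilityTheory Matrix
open scoped MatrixOrder

noncomputable section

namespace InvWishartBvM

/-- Matrices carry the product (equivalently, Borel) sigma-algebra of their entries. -/
instance instMeasurableSpaceMatrix {p : ℕ} : MeasurableSpace (Matrix (Fin p) (Fin p) ℝ) :=
  inferInstanceAs (MeasurableSpace (Fin p → Fin p → ℝ))

/-- The operator (spectral) norm of a real square matrix, i.e. its norm as an operator on
Euclidean space. -/
def specNorm {p : ℕ} (A : Matrix (Fin p) (Fin p) ℝ) : ℝ :=
  ‖Matrix.toEuclideanCLM (n := Fin p) (𝕜 := ℝ) A‖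

/-- The Frobenius norm of a real square matrix. -/
def frobNorm {p : ℕ} (A : Matrix (Fin p) (Fin p) ℝ) : ℝ :=
  Real.sqrt (∑ i, ∑ j, A i j ^ 2)

/-- The positive semidefinite square root of a positive semidefinite matrix. -/
def matSqrt {p : ℕ} (S : Matrix (Fin p) (Fin p) ℝ) : Matrix (Fin p) (Fin p) ℝ :=
  CFC.sqrt S

/-- The symmetric matrix with prescribed entries on and above the diagonal. -/
def symmOfUpper {p : ℕ} (u : {ij : Fin p × Fin p // ij.1 ≤ ij.2} → ℝ) :
    Matrix (Fin p) (Fin p) ℝ :=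
  Matrix.of fun i j => u ⟨(min i j, max i j), min_le_max⟩

theorem measurable_symmOfUpper (p : ℕ) : Measurable (symmOfUpper (p := p)) :=
  measurable_pi_lambda _ fun _ => measurable_pi_lambda _ fun _ => measurable_pi_apply _

/-- Lebesgue measure on the symmetric `p × p` matrices, in the coordinates given by the entries
on and above the diagonal, as a measure on all matrices. -/
def symmVolume (p : ℕ) : Measure (Matrix (Fin p) (Fin p) ℝ) :=
  Measure.map symmOfUpper volume

/-- The measure `m` divided by its total mass. -/
def normalize {E : Type*} [MeasurableSpace E] (m : Measure E) : Measure E :=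
  (m Set.univ)⁻¹ • m

open Classical in
/-- The unnormalized density of the Inverse Wishart distribution with scale matrix `G` and `ν`
degrees of freedom. -/
def invWishartKernel {p : ℕ} (G : Matrix (Fin p) (Fin p) ℝ) (ν : ℝ)
    (S : Matrix (Fin p) (Fin p) ℝ) : ℝ :=
  if S.PosDef then
    S.det ^ (-(ν + p + 1) / 2) * Real.exp (-(1 / 2) * (G * S⁻¹).trace)
  else 0

/-- The Inverse Wishart distribution `W_p⁻¹(G, ν)` (for positive definite `G` and
`ν > p - 1`): the probability measure on positive definite matrices whose density with respect
to Lebesgue measure on symmetric matrices is proportional to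
`det(S)^(-(ν + p + 1)/2) exp(- Tr(G S⁻¹)/2)`. -/
def invWishart {p : ℕ} (G : Matrix (Fin p) (Fin p) ℝ) (ν : ℝ) :
    Measure (Matrix (Fin p) (Fin p) ℝ) :=
  normalize ((symmVolume p).withDensity fun S => ENNReal.ofReal (invWishartKernel G ν S))

/-- The likelihood of the covariance matrix `S` in the model where the observations
`x 0, …, x (n - 1)` are independent with law `N(0, S)`: the product of the Gaussian densities. -/
def gaussianLikelihood {n p : ℕ} (x : Fin n → EuclideanSpace ℝ (Fin p))
    (S : Matrix (Fin p) (Fin p) ℝ) : ℝ :=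
  ∏ i, ((2 * Real.pi) ^ (-(p : ℝ) / 2) * S.det ^ (-(1 : ℝ) / 2) *
    Real.exp (-(1 / 2) * ((x i).ofLp ⬝ᵥ (S⁻¹ *ᵥ (x i).ofLp))))

/-- The posterior distribution of the covariance matrix given the data `x`, by Bayes' formula,
for the prior `prior` and the centered Gaussian likelihood. -/
def posterior {n p : ℕ} (prior : Measure (Matrix (Fin p) (Fin p) ℝ))
    (x : Fin n → EuclideanSpace ℝ (Fin p)) : Measure (Matrix (Fin p) (Fin p) ℝ) :=
  normalize (prior.withDensity fun S => ENNReal.ofReal (gaussianLikelihood x S))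

/-- The sample covariance matrix `n⁻¹ ∑ xᵢ xᵢᵀ` of centered data. -/
def sampleCov {n p : ℕ} (x : Fin n → EuclideanSpace ℝ (Fin p)) : Matrix (Fin p) (Fin p) ℝ :=
  (n : ℝ)⁻¹ • ∑ i, Matrix.vecMulVec (x i).ofLp (x i).ofLp

/-- The Kolmogorov distance between two probability measures on the real line. -/
def kolmogorovDist (m₁ m₂ : Measure ℝ) : ℝ :=
  ⨆ t : ℝ, |m₁.real (Set.Iic t) - m₂.real (Set.Iic t)|

/-- The number `n + r + b - 1`. -/
def effSize (n r : ℕ) (b : ℝ) : ℝ := n + r + b - 1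

/-- The quantity `√n δ² Cφ ‖Σ*‖²` that bounds the non-linear remainder at a matrix whose relative
distance from `Σ*` is at most `δ`; here `s = ‖Σ*‖`. -/
def deltaRemainder (n : ℕ) (δ Cφ s : ℝ) : ℝ := Real.sqrt n * δ ^ 2 * Cφ * s ^ 2

/-- The term `Δ₃` without its numerical constant. Here `d` lists the diagonal of `D`, so that
`∑ |dᵢ|` is the nuclear norm of `D`, and `g` is the operator norm of `G̃`. -/
def deltaThree (n r : ℕ) (b : ℝ) (d : Fin r → ℝ) (g : ℝ) : ℝ :=
  (∑ i, |d i|) *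
    (g / Real.sqrt (effSize n r b) + (r + b) / Real.sqrt (effSize n r b))

/-- The term `Δ₄` without its numerical constant; its first summand in the parentheses is the
rate `√((r + log n) / n)` of the sample covariance in dimension `r`. -/
def deltaFour (n r : ℕ) (b : ℝ) (d : Fin r → ℝ) (g : ℝ) : ℝ :=
  (∑ i, |d i|) * Real.sqrt (r + Real.log n) *
    (Real.sqrt ((r + Real.log n) / n) + Real.sqrt ((r + Real.log n) / effSize n r b)
      + g / effSize n r b)

end InvWishartBvM

end

/-! By conjugacy the posterior is `W⁻¹(A, ν)` with `A = nΣ̂ + G` and `ν = n + p + b - 1`, so for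
each data set the claim concerns one explicit law. Conjugacy is a product of densities, provided the
prior has finite mass. In the variable `Ω = Σ⁻¹` the density is `det(Ω)^k exp(-Tr(AΩ)/2)` with `k =
(ν - p - 1)/2`, and for small `b` the power is negative; `lintegral_det_rpow_lt_top` shows that `k >
-1` suffices.

The normal approximation is Stein's method. Integrating the density of `Ω` by parts in a symmetric
direction `B` gives, with `m = ν - p - 1`, `E[(m Tr(BΣ) - Tr(AB)) g(Tr(BΣ))] = 2 E[Tr(BΣBΣ)
g'(Tr(BΣ))]` (`integral_invWishart_stein`). So `Tr(BΣ)`, centered at `Tr(AB)/m`, is nearly normal as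
soon as `Tr(BΣBΣ)` is nearly constant; the distance after scaling by `s` is at most `2 E|1 - 2s²
Tr(BΣBΣ)/m|` (`abs_measureReal_linear_sub_gaussian_le`). For `B = Φ = W D Wᵀ` with `W = Σ*^{-1/2}
V`, the trace is `∑ dᵢ dⱼ (WᵀΣW)ᵢⱼ²`, which equals `‖D‖_F²` at `Σ*`. Its deviation is bounded by
moments of quadratic forms `vᵀΣv`, and the same identity with `g = 1` and `g = x` computes these
exactly.

The data enter these moments only through the numbers `vᵀΣ̂v`, and only averages of their deviations
with weights `dᵢ²`, `|dᵢ|` or `|dᵢ dⱼ|` matter. Convexity and Markov's inequality control such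
averages with probability `1 - O(1/n)`, whatever the number of directions
(`measure_fluct_family_le`).

What remains is deterministic: the expansion of `φ` at `Σ` and at `Σ̂` costs `Δ₁` and `Δ₂`, and the
shift from `Tr(AΦ)/m` to `Tr(ΦΣ̂)` and the Stein error are of order `(‖D‖₁/‖D‖_F) H` with `H = (‖G̃‖
+ r + b + log n)/√n` (`kolmogorovDist_posterior_le`). By `one_le_or_rate_le`, either the claimed
bound is at least `1`, hence trivial, or `Δ₃` and `Δ₄` dominate this rate. -/

noncomputable section

namespace InvWishartBvM

/-! ### Coordinates on symmetric matrices and positive definite matrices -/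

/-- The positions on and above the diagonal. -/
abbrev UpperIdx (p : ℕ) : Type := {ij : Fin p × Fin p // ij.1 ≤ ij.2}

/-- The entries of a matrix on and above the diagonal. -/
def upperOf {p : ℕ} (M : Matrix (Fin p) (Fin p) ℝ) : UpperIdx p → ℝ := fun ij => M ij.1.1 ij.1.2

theorem symmOfUpper_apply {p : ℕ} (u : UpperIdx p → ℝ) (i j : Fin p) :
    symmOfUpper u i j = u ⟨(min i j, max i j), min_le_max⟩ := rfl

theorem symmOfUpper_isSymm {p : ℕ} (u : UpperIdx p → ℝ) : (symmOfUpper u).IsSymm := by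
  ext i j
  simp [symmOfUpper_apply, min_comm, max_comm]

theorem symmOfUpper_add {p : ℕ} (u v : UpperIdx p → ℝ) :
    symmOfUpper (u + v) = symmOfUpper u + symmOfUpper v := rfl

theorem symmOfUpper_smul {p : ℕ} (c : ℝ) (u : UpperIdx p → ℝ) :
    symmOfUpper (c • u) = c • symmOfUpper u := rfl

theorem upperOf_symmOfUpper {p : ℕ} (u : UpperIdx p → ℝ) : upperOf (symmOfUpper u) = u := by
  funext ⟨⟨i, j⟩, hij⟩
  simp only at hij
  simp [upperOf, symmOfUpper_apply, min_eq_left hij, max_eq_right hij]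

theorem symmOfUpper_upperOf {p : ℕ} {M : Matrix (Fin p) (Fin p) ℝ} (hM : M.IsSymm) :
    symmOfUpper (upperOf M) = M := by
  ext i j
  rcases le_total i j with h | h
  · simp [upperOf, symmOfUpper_apply, min_eq_left h, max_eq_right h]
  · simp [upperOf, symmOfUpper_apply, min_eq_right h, max_eq_left h, hM.apply i j]

theorem continuous_symmOfUpper (p : ℕ) : Continuous (symmOfUpper (p := p)) := by
  refine continuous_pi fun i => continuous_pi fun j => ?_
  exact continuous_apply _

theorem continuous_upperOf (p : ℕ) : Continuous (upperOf (p := p)) := by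
  refine continuous_pi fun ij => ?_
  exact (continuous_apply _).comp (continuous_apply _)

theorem isSymm_of_posDef {p : ℕ} {S : Matrix (Fin p) (Fin p) ℝ} (hS : S.PosDef) : S.IsSymm := by
  simpa [IsHermitian, IsSymm, conjTranspose_eq_transpose_of_trivial] using hS.1

theorem isSymm_of_posSemidef {p : ℕ} {S : Matrix (Fin p) (Fin p) ℝ} (hS : S.PosSemidef) :
    S.IsSymm := by
  simpa [IsHermitian, IsSymm, conjTranspose_eq_transpose_of_trivial] using hS.1

theorem posSemidef_iff_real {p : ℕ} {S : Matrix (Fin p) (Fin p) ℝ} :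
    S.PosSemidef ↔ S.IsSymm ∧ ∀ x, 0 ≤ x ⬝ᵥ (S *ᵥ x) := by
  rw [posSemidef_iff_dotProduct_mulVec]
  simp [IsHermitian, IsSymm, conjTranspose_eq_transpose_of_trivial]

theorem posDef_iff_real {p : ℕ} {S : Matrix (Fin p) (Fin p) ℝ} :
    S.PosDef ↔ S.IsSymm ∧ ∀ x, x ≠ 0 → 0 < x ⬝ᵥ (S *ᵥ x) := by
  rw [posDef_iff_dotProduct_mulVec]
  simp [IsHermitian, IsSymm, conjTranspose_eq_transpose_of_trivial]

/-- The quadratic form at `eᵢ ± eⱼ` gives `2|S i j| ≤ S i i + S j j`. The trace thereby serves as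
the norm on the positive cone in all later growth bounds. -/
theorem abs_apply_le_trace {p : ℕ} {S : Matrix (Fin p) (Fin p) ℝ} (hS : S.PosSemidef)
    (i j : Fin p) : |S i j| ≤ S.trace := by
  have hd : ∀ k, 0 ≤ S k k := fun k => hS.diag_nonneg
  have hle : ∀ k, S k k ≤ S.trace := fun k =>
    Finset.single_le_sum (f := fun k => S k k) (fun k _ => hd k) (Finset.mem_univ k)
  rcases eq_or_ne i j with rfl | hij
  · rw [abs_of_nonneg (hd i)]; exact hle i
  have key : ∀ s : ℝ, s ^ 2 = 1 → 0 ≤ S i i + S j j + 2 * s * S i j := by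
    intro s hs
    have h := (posSemidef_iff_real.1 hS).2 (Pi.single i 1 + s • Pi.single j 1)
    have hsym : S j i = S i j := (isSymm_of_posSemidef hS).apply i j
    simp [mulVec_add, mulVec_smul, add_dotProduct, dotProduct_add, hsym] at h
    have h2 : S i i + S j j + 2 * s * S i j = S i i + s * S i j + s * (S i j + s * S j j) := by
      linear_combination (-S j j) * hs
    rwa [h2]
  have hsum : S i i + S j j ≤ S.trace := by
    have := Finset.sum_le_sum_of_subset_of_nonneg (f := fun k => S k k)
      (Finset.subset_univ {i, j}) (fun k _ _ => hd k)
    rwa [Finset.sum_pair hij] at this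
  have h1 := key 1 (by norm_num)
  have h2 := key (-1) (by norm_num)
  have := hd i; have := hd j
  rw [abs_le]; constructor <;> linarith

theorem trace_mul_le {p : ℕ} {S T : Matrix (Fin p) (Fin p) ℝ} (hS : S.PosSemidef)
    (hT : T.PosSemidef) : |(S * T).trace| ≤ (p : ℝ) ^ 2 * (S.trace * T.trace) := by
  simp only [trace, diag_apply, mul_apply]
  calc |∑ i, ∑ j, S i j * T j i| ≤ ∑ i, ∑ j, |S i j * T j i| :=
        (Finset.abs_sum_le_sum_abs _ _).trans
          (Finset.sum_le_sum fun i _ => Finset.abs_sum_le_sum_abs _ _)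
    _ ≤ ∑ i : Fin p, ∑ j : Fin p, S.trace * T.trace := by
        refine Finset.sum_le_sum fun i _ => Finset.sum_le_sum fun j _ => ?_
        rw [abs_mul]
        exact mul_le_mul (abs_apply_le_trace hS i j) (abs_apply_le_trace hT j i) (abs_nonneg _)
          hS.trace_nonneg
    _ = _ := by simp [trace]; ring

theorem exists_sqrt_posDef {p : ℕ} {A : Matrix (Fin p) (Fin p) ℝ} (hA : A.PosDef) :
    (matSqrt A).PosDef ∧ matSqrt A * matSqrt A = A := by
  have h0 : (0 : Matrix (Fin p) (Fin p) ℝ) ≤ A := nonneg_iff_posSemidef.2 hA.posSemidef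
  have hps : (matSqrt A).PosSemidef := nonneg_iff_posSemidef.1 (CFC.sqrt_nonneg A)
  have hm : matSqrt A * matSqrt A = A := CFC.sqrt_mul_sqrt_self A h0
  refine ⟨hps.posDef_iff_det_ne_zero.2 fun h => ?_, hm⟩
  have := hA.det_pos
  rw [← hm, det_mul, h] at this
  simp at this

/-- With `A = Q²` and `R = A⁻¹`, `Tr S = Tr((QSQ)R)` is at most a multiple of `Tr(QSQ) = Tr(AS)`.
This coercivity yields both the openness of the cone and the exponential decay of Wishart densities.
-/
theorem exists_trace_mul_ge {p : ℕ} {A : Matrix (Fin p) (Fin p) ℝ} (hA : A.PosDef) :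
    ∃ c > 0, ∀ S : Matrix (Fin p) (Fin p) ℝ, S.PosSemidef → c * S.trace ≤ (A * S).trace := by
  obtain ⟨hQ, hQA⟩ := exists_sqrt_posDef hA
  set Q := matSqrt A
  have hQs : Qᴴ = Q := hQ.1
  have hQu : IsUnit Q.det := hQ.det_pos.ne'.isUnit
  set R := Q⁻¹ * Q⁻¹
  have hR : R.PosSemidef := by
    have h := posSemidef_conjTranspose_mul_self Q⁻¹
    rwa [conjTranspose_nonsing_inv, hQs] at h
  have ht : 0 ≤ R.trace := hR.trace_nonneg
  -- The `+ 1` keeps the constant positive when `p = 0`.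
  refine ⟨((p : ℝ) ^ 2 * R.trace + 1)⁻¹, by positivity, fun S hS => ?_⟩
  have hT : (Q * S * Q).PosSemidef := by
    have h := hS.mul_mul_conjTranspose_same Q
    rwa [hQs] at h
  have h1 : (Q * S * Q * R).trace = S.trace := by
    have : Q * S * Q * R = Q * S * Q⁻¹ := by
      simp only [R, Matrix.mul_assoc]
      rw [← Matrix.mul_assoc Q Q⁻¹, mul_nonsing_inv _ hQu, Matrix.one_mul]
    rw [this, Matrix.trace_mul_comm, ← Matrix.mul_assoc, nonsing_inv_mul _ hQu, Matrix.one_mul]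
  have h2 : (Q * S * Q).trace = (A * S).trace := by
    rw [Matrix.trace_mul_comm, ← Matrix.mul_assoc, hQA]
  have h3 := trace_mul_le hT hR
  rw [h1, h2] at h3
  have h4 : 0 ≤ (A * S).trace := h2 ▸ hT.trace_nonneg
  have h5 := (le_abs_self _).trans h3
  rw [inv_mul_le_iff₀ (by positivity)]
  nlinarith

theorem trace_mul_vecMulVec {p : ℕ} (A : Matrix (Fin p) (Fin p) ℝ) (x : Fin p → ℝ) :
    (A * vecMulVec x x).trace = x ⬝ᵥ (A *ᵥ x) := by
  rw [mul_vecMulVec, trace_vecMulVec, dotProduct_comm]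

theorem posSemidef_vecMulVec {p : ℕ} (x : Fin p → ℝ) : (vecMulVec x x).PosSemidef := by
  simpa using posSemidef_vecMulVec_self_star x

theorem abs_quadForm_le {p : ℕ} (H : Matrix (Fin p) (Fin p) ℝ) (x : Fin p → ℝ) :
    |x ⬝ᵥ (H *ᵥ x)| ≤ (∑ i, ∑ j, |H i j|) * (x ⬝ᵥ x) := by
  have hx : ∀ i, x i ^ 2 ≤ x ⬝ᵥ x := fun i => by
    have := Finset.single_le_sum (f := fun k => x k * x k) (fun k _ => mul_self_nonneg _)
      (Finset.mem_univ i)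
    rw [sq]; exact this
  have e : x ⬝ᵥ (H *ᵥ x) = ∑ i, ∑ j, x i * (H i j * x j) := by
    simp only [dotProduct, mulVec, Finset.mul_sum]
  rw [e, Finset.sum_mul]
  simp only [Finset.sum_mul]
  refine (Finset.abs_sum_le_sum_abs _ _).trans (Finset.sum_le_sum fun i _ =>
    (Finset.abs_sum_le_sum_abs _ _).trans (Finset.sum_le_sum fun j _ => ?_))
  have h : |x i| * |x j| ≤ x ⬝ᵥ x := by
    nlinarith [hx i, hx j, sq_nonneg (|x i| - |x j|), sq_abs (x i), sq_abs (x j)]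
  rw [abs_mul, abs_mul]
  calc |x i| * (|H i j| * |x j|) = |H i j| * (|x i| * |x j|) := by ring
    _ ≤ |H i j| * (x ⬝ᵥ x) := mul_le_mul_of_nonneg_left h (abs_nonneg _)

/-- The coordinates of the positive definite matrices. -/
def posDefCoords (p : ℕ) : Set (UpperIdx p → ℝ) := {y | (symmOfUpper y).PosDef}

/-- Coercivity at `S = x xᵀ` reads `xᵀAx ≥ c|x|²`, so a symmetric perturbation whose entries sum in
absolute value to less than `c` keeps the form positive. -/
theorem isOpen_posDefCoords (p : ℕ) : IsOpen (posDefCoords p) := by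
  rw [isOpen_iff_mem_nhds]
  intro y hy
  obtain ⟨c, hc, hA⟩ := exists_trace_mul_ge (p := p) hy
  have hcont : Continuous fun z : UpperIdx p → ℝ =>
      ∑ i, ∑ j, |symmOfUpper z i j - symmOfUpper y i j| := by
    have h := continuous_symmOfUpper p
    refine continuous_finsetSum _ fun i _ => continuous_finsetSum _ fun j _ => ?_
    exact ((h.matrix_elem i j).sub continuous_const).abs
  have h0 : {z : UpperIdx p → ℝ | ∑ i, ∑ j, |symmOfUpper z i j - symmOfUpper y i j| < c} ∈
      nhds y := (isOpen_lt hcont continuous_const).mem_nhds (by simpa using hc)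
  filter_upwards [h0] with z hz
  refine posDef_iff_real.2 ⟨symmOfUpper_isSymm z, fun x hx => ?_⟩
  have h1 := hA _ (posSemidef_vecMulVec x)
  rw [trace_mul_vecMulVec, trace_vecMulVec] at h1
  have h2 := abs_quadForm_le (symmOfUpper z - symmOfUpper y) x
  rw [sub_mulVec, dotProduct_sub] at h2
  simp only [Matrix.sub_apply] at h2
  have h3 : 0 < x ⬝ᵥ x := by
    have := dotProduct_star_self_pos_iff.2 hx
    simpa using this
  have h4 := neg_abs_le (x ⬝ᵥ symmOfUpper z *ᵥ x - x ⬝ᵥ symmOfUpper y *ᵥ x)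
  have h5 := mul_lt_mul_of_pos_right (show _ < c from hz) h3
  linarith

theorem measurableSet_posDefCoords (p : ℕ) : MeasurableSet (posDefCoords p) :=
  (isOpen_posDefCoords p).measurableSet

theorem nonempty_posDefCoords (p : ℕ) : (posDefCoords p).Nonempty :=
  ⟨upperOf 1, by
    rw [posDefCoords, Set.mem_ofPred_eq, symmOfUpper_upperOf isSymm_one]; exact PosDef.one⟩

instance borelSpaceMatrix {p : ℕ} : BorelSpace (Matrix (Fin p) (Fin p) ℝ) :=
  inferInstanceAs (BorelSpace (Fin p → Fin p → ℝ))

theorem isClosed_isSymm (p : ℕ) : IsClosed {S : Matrix (Fin p) (Fin p) ℝ | S.IsSymm} :=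
  isClosed_eq (continuous_id.matrix_transpose) continuous_id

/-- Openness holds relative to the symmetric matrices, so the cone is a closed set intersected with
an open preimage. -/
theorem measurableSet_posDef (p : ℕ) :
    MeasurableSet {S : Matrix (Fin p) (Fin p) ℝ | S.PosDef} := by
  have h : {S : Matrix (Fin p) (Fin p) ℝ | S.PosDef} =
      {S | S.IsSymm} ∩ upperOf ⁻¹' posDefCoords p := by
    ext S
    constructor
    · intro hS
      refine ⟨isSymm_of_posDef hS, ?_⟩
      simpa [posDefCoords, symmOfUpper_upperOf (isSymm_of_posDef hS)] using hS
    · rintro ⟨h1, h2⟩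
      simpa [posDefCoords, symmOfUpper_upperOf h1] using h2
  rw [h]
  exact (isClosed_isSymm p).measurableSet.inter
    ((isOpen_posDefCoords p).preimage (continuous_upperOf p)).measurableSet

end InvWishartBvM
end

noncomputable section

namespace InvWishartBvM

/-! ### The inversion of symmetric matrices and its Jacobian -/

/-- The linear map `S ↦ Q S Qᵀ` on symmetric matrices, in coordinates. -/
def congrLin {p : ℕ} (Q : Matrix (Fin p) (Fin p) ℝ) :
    (UpperIdx p → ℝ) →ₗ[ℝ] (UpperIdx p → ℝ) where
  toFun y := upperOf (Q * symmOfUpper y * Qᵀ)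
  map_add' u v := by
    rw [symmOfUpper_add, Matrix.mul_add, Matrix.add_mul]; rfl
  map_smul' c u := by
    rw [symmOfUpper_smul, Matrix.mul_smul, Matrix.smul_mul]; rfl

theorem congrLin_apply {p : ℕ} (Q : Matrix (Fin p) (Fin p) ℝ) (y : UpperIdx p → ℝ) :
    congrLin Q y = upperOf (Q * symmOfUpper y * Qᵀ) := rfl

theorem congrLin_mul {p : ℕ} (Q R : Matrix (Fin p) (Fin p) ℝ) :
    congrLin (Q * R) = congrLin Q ∘ₗ congrLin R := by
  refine LinearMap.ext fun y => ?_
  have h : (R * symmOfUpper y * Rᵀ).IsSymm := by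
    simp [IsSymm, transpose_mul, (symmOfUpper_isSymm y).eq, Matrix.mul_assoc]
  rw [LinearMap.comp_apply, congrLin_apply, congrLin_apply, congrLin_apply, symmOfUpper_upperOf h]
  simp [transpose_mul, Matrix.mul_assoc]

theorem congrLin_one {p : ℕ} : congrLin (1 : Matrix (Fin p) (Fin p) ℝ) = LinearMap.id := by
  refine LinearMap.ext fun y => ?_
  simp [congrLin_apply, upperOf_symmOfUpper]

/-- With indices from `0`, `l i` occurs `p - i` times as a row factor and `i + 1` times as a column
factor, the diagonal entry counting twice. -/
theorem prod_upperIdx {p : ℕ} (l : Fin p → ℝ) :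
    ∏ e : UpperIdx p, (l e.1.1 * l e.1.2) = (∏ i, l i) ^ (p + 1) := by
  have h1 : ∏ e : UpperIdx p, (l e.1.1 * l e.1.2) =
      ∏ ij : Fin p × Fin p, if ij.1 ≤ ij.2 then l ij.1 * l ij.2 else 1 := by
    rw [← Finset.prod_filter]
    exact (Finset.prod_subtype (Finset.univ.filter fun ij : Fin p × Fin p => ij.1 ≤ ij.2)
      (by simp) fun ij : Fin p × Fin p => l ij.1 * l ij.2).symm
  have h2 : ∀ i j : Fin p, (if i ≤ j then l i * l j else 1) =
      (if i ≤ j then l i else 1) * (if i ≤ j then l j else 1) := by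
    intro i j; split_ifs <;> simp
  rw [h1, Fintype.prod_prod_type]
  simp only [h2, Finset.prod_mul_distrib]
  rw [Finset.prod_comm (f := fun i j : Fin p => if i ≤ j then l j else 1),
    ← Finset.prod_mul_distrib, ← Finset.prod_pow]
  refine Finset.prod_congr rfl fun i _ => ?_
  rw [← Finset.prod_filter, ← Finset.prod_filter, Finset.prod_const, Finset.prod_const, ← pow_add]
  congr 1
  rw [Finset.filter_le_eq_Ici, Finset.filter_ge_eq_Iic, Fin.card_Ici, Fin.card_Iic]
  omega

theorem det_congrLin_diagonal {p : ℕ} (l : Fin p → ℝ) :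
    LinearMap.det (congrLin (diagonal l)) = (∏ i, l i) ^ (p + 1) := by
  have h : congrLin (diagonal l) =
      Matrix.toLin' (diagonal fun e : UpperIdx p => l e.1.1 * l e.1.2) := by
    refine LinearMap.ext fun y => funext fun e => ?_
    rw [toLin'_apply, mulVec_diagonal, congrLin_apply, upperOf, diagonal_transpose,
      mul_diagonal, diagonal_mul]
    have := congrFun (upperOf_symmOfUpper y) e
    rw [upperOf] at this
    rw [this]; ring
  rw [h, LinearMap.det_toLin', det_diagonal, prod_upperIdx]

/-- Diagonalize `Q`: the orthogonal factors contribute mutually inverse determinants on both sides,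
which leaves the diagonal case. -/
theorem det_congrLin_of_isSymm {p : ℕ} {Q : Matrix (Fin p) (Fin p) ℝ} (hQ : Q.IsSymm) :
    LinearMap.det (congrLin Q) = Q.det ^ (p + 1) := by
  have hH : Q.IsHermitian := by
    simpa [IsHermitian, conjTranspose_eq_transpose_of_trivial] using hQ.eq
  have hspec := hH.spectral_theorem
  rw [Unitary.conjStarAlgAut_apply] at hspec
  set U : Matrix (Fin p) (Fin p) ℝ := hH.eigenvectorUnitary.1
  have hU : U * star U = 1 := Unitary.coe_mul_star_self _
  have hc : LinearMap.det (congrLin U) * LinearMap.det (congrLin (star U)) = 1 := by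
    rw [← LinearMap.det_comp, ← congrLin_mul, hU, congrLin_one, LinearMap.det_id]
  have hd : U.det * (star U).det = 1 := by rw [← det_mul, hU, det_one]
  have h2 : LinearMap.det (congrLin Q) = LinearMap.det (congrLin U) *
      (∏ i, hH.eigenvalues i) ^ (p + 1) * LinearMap.det (congrLin (star U)) := by
    conv_lhs => rw [hspec]
    rw [congrLin_mul, congrLin_mul, LinearMap.det_comp, LinearMap.det_comp,
      ← det_congrLin_diagonal]
    rfl
  have h3 : Q.det = U.det * (∏ i, hH.eigenvalues i) * (star U).det := by
    conv_lhs => rw [hspec]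
    rw [det_mul, det_mul, det_diagonal]
    rfl
  rw [h2, h3, mul_right_comm, hc, one_mul, mul_right_comm, hd, one_mul]

/-- The inversion of symmetric matrices, in coordinates. -/
def invCoords {p : ℕ} (y : UpperIdx p → ℝ) : UpperIdx p → ℝ := upperOf (symmOfUpper y)⁻¹

theorem symmOfUpper_invCoords {p : ℕ} (y : UpperIdx p → ℝ) :
    symmOfUpper (invCoords y) = (symmOfUpper y)⁻¹ :=
  symmOfUpper_upperOf (by
    rw [IsSymm, transpose_nonsing_inv, (symmOfUpper_isSymm y).eq])

theorem invCoords_mem {p : ℕ} {y : UpperIdx p → ℝ} (hy : y ∈ posDefCoords p) :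
    invCoords y ∈ posDefCoords p := by
  rw [posDefCoords, Set.mem_ofPred_eq, symmOfUpper_invCoords]
  exact PosDef.inv hy

theorem invCoords_invCoords {p : ℕ} {y : UpperIdx p → ℝ} (hy : y ∈ posDefCoords p) :
    invCoords (invCoords y) = y := by
  rw [invCoords, symmOfUpper_invCoords, nonsing_inv_nonsing_inv, upperOf_symmOfUpper]
  exact (PosDef.det_pos hy).ne'.isUnit

section
attribute [local instance] Matrix.linftyOpNormedRing Matrix.linftyOpNormedAlgebra

/-- The differential of inversion, `Z ↦ -Y⁻¹ZY⁻¹`, is minus a congruence, so the Jacobian becomes a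
power of the determinant. -/
theorem hasFDerivAt_invCoords {p : ℕ} {y : UpperIdx p → ℝ} (hy : y ∈ posDefCoords p) :
    HasFDerivAt invCoords (-(congrLin (symmOfUpper y)⁻¹).toContinuousLinearMap) y := by
  let L : (UpperIdx p → ℝ) →ₗ[ℝ] Matrix (Fin p) (Fin p) ℝ :=
    { toFun := symmOfUpper, map_add' := symmOfUpper_add, map_smul' := symmOfUpper_smul }
  let K : Matrix (Fin p) (Fin p) ℝ →ₗ[ℝ] (UpperIdx p → ℝ) :=
    { toFun := upperOf, map_add' := fun _ _ => rfl, map_smul' := fun _ _ => rfl }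
  have hu : IsUnit (symmOfUpper y) := PosDef.isUnit hy
  obtain ⟨u, hu⟩ := hu
  have h1 : HasFDerivAt symmOfUpper L.toContinuousLinearMap y :=
    L.toContinuousLinearMap.hasFDerivAt
  have h2 := hasFDerivAt_ringInverse (𝕜 := ℝ) u
  rw [hu] at h2
  have h3 : HasFDerivAt upperOf K.toContinuousLinearMap (Ring.inverse (symmOfUpper y)) :=
    K.toContinuousLinearMap.hasFDerivAt
  have h4 := h3.comp y (h2.comp y h1)
  have h5 : upperOf ∘ Ring.inverse ∘ symmOfUpper = invCoords (p := p) := by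
    funext z
    simp [invCoords, nonsing_inv_eq_ringInverse]
  rw [h5] at h4
  refine h4.congr_fderiv ?_
  ext z e
  have hinv : (↑u⁻¹ : Matrix (Fin p) (Fin p) ℝ) = (symmOfUpper y)⁻¹ := by
    rw [coe_units_inv, hu]
  rw [hinv]
  change (-((symmOfUpper y)⁻¹ * symmOfUpper z * (symmOfUpper y)⁻¹)) e.1.1 e.1.2 =
    -(upperOf ((symmOfUpper y)⁻¹ * symmOfUpper z * ((symmOfUpper y)⁻¹)ᵀ) e)
  rw [transpose_nonsing_inv, (symmOfUpper_isSymm y).eq]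
  rfl

end

/-- Inversion is an involution of the cone, and its Jacobian at `Y` is `det(Y⁻¹)^(p+1)`. -/
theorem lintegral_posDefCoords_eq_inv {p : ℕ} (F : (UpperIdx p → ℝ) → ENNReal) :
    ∫⁻ y in posDefCoords p, F y =
      ∫⁻ y in posDefCoords p,
        ENNReal.ofReal ((symmOfUpper y).det ^ (-((p : ℝ) + 1))) * F (invCoords y) := by
  have himg : invCoords '' posDefCoords p = posDefCoords p := by
    ext z
    constructor
    · rintro ⟨y, hy, rfl⟩; exact invCoords_mem hy
    · intro hz; exact ⟨_, invCoords_mem hz, invCoords_invCoords hz⟩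
  have hinj : Set.InjOn (invCoords (p := p)) (posDefCoords p) := fun a ha b hb h => by
    rw [← invCoords_invCoords ha, h, invCoords_invCoords hb]
  have := lintegral_image_eq_lintegral_abs_det_fderiv_mul volume (measurableSet_posDefCoords p)
    (fun y hy => (hasFDerivAt_invCoords hy).hasFDerivWithinAt) hinj F
  rw [himg] at this
  rw [this]
  refine setLIntegral_congr_fun (measurableSet_posDefCoords p) fun y hy => ?_
  have hdet : 0 < (symmOfUpper y).det := PosDef.det_pos hy
  have hs : (symmOfUpper y)⁻¹.IsSymm := by
    rw [IsSymm, transpose_nonsing_inv, (symmOfUpper_isSymm y).eq]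
  have hd : |(-(congrLin (symmOfUpper y)⁻¹).toContinuousLinearMap).det| =
      (symmOfUpper y).det ^ (-((p : ℝ) + 1)) := by
    have h1 : (-(congrLin (symmOfUpper y)⁻¹).toContinuousLinearMap).det =
        LinearMap.det (-(congrLin (symmOfUpper y)⁻¹)) := rfl
    have h2 : -(congrLin (symmOfUpper y)⁻¹) = (-1 : ℝ) • congrLin (symmOfUpper y)⁻¹ :=
      (neg_one_smul ℝ _).symm
    rw [h1, h2, LinearMap.det_smul, abs_mul, abs_pow, abs_neg, abs_one, one_pow, one_mul,
      det_congrLin_of_isSymm hs, det_nonsing_inv, Ring.inverse_eq_inv', abs_of_pos (by positivity),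
      Real.rpow_neg hdet.le, inv_pow]
    congr 1
    exact_mod_cast (Real.rpow_natCast _ (p + 1)).symm
  simp only [hd]

end InvWishartBvM
end

noncomputable section

namespace InvWishartBvM

/-! ### Finiteness of Wishart integrals -/

theorem integrable_exp_neg_sum_abs {ι : Type*} [Fintype ι] {c : ℝ} (hc : 0 < c) :
    Integrable fun w : ι → ℝ => Real.exp (-c * ∑ i, |w i|) := by
  have h1 : Integrable (fun x : ℝ => Real.exp (-c * |x|)) := by
    rw [← integrableOn_univ, ← Set.Iic_union_Ioi (a := (0 : ℝ))]
    refine IntegrableOn.union ?_ ?_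
    · exact (integrableOn_exp_mul_Iic hc 0).congr_fun
        (fun x hx => by simp [abs_of_nonpos (Set.mem_Iic.1 hx)]) measurableSet_Iic
    · exact (exp_neg_integrableOn_Ioi 0 hc).congr_fun
        (fun x hx => by simp only [abs_of_pos (Set.mem_Ioi.1 hx)]) measurableSet_Ioi
  have h2 := Integrable.fintype_prod (ι := ι) (μ := fun _ => volume) (fun _ => h1)
  refine h2.congr (Filter.Eventually.of_forall fun w => ?_)
  simp only [Finset.mul_sum, Real.exp_sum]

theorem sum_abs_upper_le {p : ℕ} {y : UpperIdx p → ℝ} (hy : y ∈ posDefCoords p) :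
    ∑ e, |y e| ≤ Fintype.card (UpperIdx p) * (symmOfUpper y).trace := by
  have h : ∀ e, |y e| ≤ (symmOfUpper y).trace := fun e => by
    have h2 := congrFun (upperOf_symmOfUpper y) e
    rw [← h2]
    exact abs_apply_le_trace (PosDef.posSemidef hy) _ _
  refine (Finset.sum_le_sum fun e _ => h e).trans ?_
  simp

theorem measurable_det_symmOfUpper {p : ℕ} :
    Measurable fun y : UpperIdx p → ℝ => (symmOfUpper y).det :=
  (continuous_symmOfUpper p).matrix_det.measurable

theorem continuous_trace_symmOfUpper {p : ℕ} :
    Continuous fun y : UpperIdx p → ℝ => (symmOfUpper y).trace :=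
  (continuous_symmOfUpper p).matrix_trace

theorem integrableOn_exp_neg_trace {p : ℕ} {c : ℝ} (hc : 0 < c) :
    IntegrableOn (fun y : UpperIdx p → ℝ => Real.exp (-c * (symmOfUpper y).trace))
      (posDefCoords p) := by
  set N : ℝ := (Fintype.card (UpperIdx p) : ℝ) with hN
  have hN0 : 0 ≤ N := Nat.cast_nonneg _
  have h := (integrable_exp_neg_sum_abs (ι := UpperIdx p) (c := c / (N + 1)) (by positivity))
  refine (h.integrableOn (s := posDefCoords p)).mono'
    ((continuous_trace_symmOfUpper.const_smul (-c)).rexp.aestronglyMeasurable)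
    ((ae_restrict_iff' (measurableSet_posDefCoords p)).2 (Filter.Eventually.of_forall fun y hy => ?_))
  rw [Real.norm_eq_abs, abs_of_pos (Real.exp_pos _), Real.exp_le_exp, neg_mul, neg_mul,
    neg_le_neg_iff, div_mul_eq_mul_div, div_le_iff₀ (by positivity)]
  have h1 := sum_abs_upper_le hy
  have h2 : 0 ≤ (symmOfUpper y).trace := (PosDef.posSemidef hy).trace_nonneg
  have : ∑ e, |y e| ≤ (symmOfUpper y).trace * (N + 1) := by nlinarith
  calc c * ∑ e, |y e| ≤ c * ((symmOfUpper y).trace * (N + 1)) :=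
        mul_le_mul_of_nonneg_left this hc.le
    _ = _ := by ring

/-- Half of the exponential decay pays for the polynomial factor. -/
theorem exists_one_add_pow_mul_exp_le (J : ℕ) {c : ℝ} (hc : 0 < c) :
    ∃ C > 0, ∀ t : ℝ, 0 ≤ t → (1 + t) ^ J * Real.exp (-c * t) ≤ C * Real.exp (-(c / 2) * t) := by
  refine ⟨J.factorial * (2 / c) ^ J * Real.exp (c / 2), by positivity, fun t ht => ?_⟩
  have h := Real.pow_div_factorial_le_exp (c / 2 * (1 + t)) (by positivity) J
  rw [div_le_iff₀ (by positivity), mul_pow] at h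
  have h2 : (1 + t) ^ J ≤ J.factorial * (2 / c) ^ J * Real.exp (c / 2 * (1 + t)) := by
    have h3 : (1 + t) ^ J = (2 / c) ^ J * ((c / 2) ^ J * (1 + t) ^ J) := by
      rw [← mul_assoc, ← mul_pow, div_mul_div_comm, mul_comm 2 c, div_self (by positivity),
        one_pow, one_mul]
    rw [h3]
    calc _ ≤ (2 / c) ^ J * (Real.exp (c / 2 * (1 + t)) * J.factorial) :=
          mul_le_mul_of_nonneg_left h (by positivity)
      _ = _ := by ring
  calc (1 + t) ^ J * Real.exp (-c * t)
      ≤ J.factorial * (2 / c) ^ J * Real.exp (c / 2 * (1 + t)) * Real.exp (-c * t) :=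
        mul_le_mul_of_nonneg_right h2 (Real.exp_pos _).le
    _ = _ := by
        rw [mul_assoc, ← Real.exp_add, mul_assoc _ (Real.exp (c / 2)), ← Real.exp_add]
        congr 2; ring

/-- A function on the positive definite cone that is at most polynomial in the trace times a
decaying exponential of the trace is integrable. -/
theorem integrableOn_of_le_pow_mul_exp {p : ℕ} {f : (UpperIdx p → ℝ) → ℝ} {c K : ℝ} (J : ℕ)
    (hc : 0 < c) (hf : AEStronglyMeasurable f (volume.restrict (posDefCoords p)))
    (hle : ∀ y ∈ posDefCoords p, |f y| ≤ K * (1 + (symmOfUpper y).trace) ^ J *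
      Real.exp (-c * (symmOfUpper y).trace)) :
    IntegrableOn f (posDefCoords p) := by
  obtain ⟨C, hC, hJ⟩ := exists_one_add_pow_mul_exp_le J hc
  refine (((integrableOn_exp_neg_trace (p := p) (half_pos hc)).const_mul C).const_mul |K|).mono' hf
    ((ae_restrict_iff' (measurableSet_posDefCoords p)).2 (Filter.Eventually.of_forall fun y hy => ?_))
  have ht : 0 ≤ (symmOfUpper y).trace := (PosDef.posSemidef hy).trace_nonneg
  rw [Real.norm_eq_abs]
  calc |f y| ≤ K * (1 + (symmOfUpper y).trace) ^ J * Real.exp (-c * (symmOfUpper y).trace) :=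
        hle y hy
    _ = K * ((1 + (symmOfUpper y).trace) ^ J * Real.exp (-c * (symmOfUpper y).trace)) := by ring
    _ ≤ |K| * ((1 + (symmOfUpper y).trace) ^ J * Real.exp (-c * (symmOfUpper y).trace)) :=
        mul_le_mul_of_nonneg_right (le_abs_self K) (by positivity)
    _ ≤ _ := mul_le_mul_of_nonneg_left (hJ _ ht) (abs_nonneg _)

theorem det_le_of_posDef {p : ℕ} {S : Matrix (Fin p) (Fin p) ℝ} (hS : S.PosSemidef) :
    S.det ≤ p.factorial * S.trace ^ p := by
  have h := Matrix.det_le (A := S) (abv := AbsoluteValue.abs) (x := S.trace)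
    (fun i j => abs_apply_le_trace hS i j)
  have h2 : |S.det| ≤ p.factorial * S.trace ^ p := by simpa using h
  exact (le_abs_self _).trans h2

/-- The index of the entries on and above the diagonal, split along the first row. -/
def upperIdxSucc (p : ℕ) : (Fin p ⊕ UpperIdx p) ⊕ Unit ≃ UpperIdx (p + 1) where
  toFun
    | Sum.inl (Sum.inl j) => ⟨(0, j.succ), Fin.zero_le _⟩
    | Sum.inl (Sum.inr e) => ⟨(e.1.1.succ, e.1.2.succ), Fin.succ_le_succ_iff.2 e.2⟩
    | Sum.inr _ => ⟨(0, 0), le_refl _⟩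
  invFun e := Fin.cases (motive := fun i => ∀ j, i ≤ j → (Fin p ⊕ UpperIdx p) ⊕ Unit)
    (fun j => Fin.cases (motive := fun j => 0 ≤ j → (Fin p ⊕ UpperIdx p) ⊕ Unit)
      (fun _ => Sum.inr ()) (fun j _ => Sum.inl (Sum.inl j)) j)
    (fun i j => Fin.cases (motive := fun j => i.succ ≤ j → (Fin p ⊕ UpperIdx p) ⊕ Unit)
      (fun _ => Sum.inr ())
      (fun j h => Sum.inl (Sum.inr ⟨(i, j), Fin.succ_le_succ_iff.1 h⟩)) j) e.1.1 e.1.2 e.2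
  left_inv := by
    rintro ((j | e) | u) <;> rfl
  right_inv := by
    rintro ⟨⟨i, j⟩, h⟩
    induction i using Fin.cases with
    | zero =>
      induction j using Fin.cases with
      | zero => rfl
      | succ j => rfl
    | succ i =>
      induction j using Fin.cases with
      | zero => exact absurd h (by simp)
      | succ j => rfl

/-- Assembling the coordinates of a symmetric matrix from its first diagonal entry, the rest of
its first row, and the remaining block. -/
def joinUpper {p : ℕ} (z : Fin p ⊕ UpperIdx p → ℝ) (a : ℝ) : UpperIdx (p + 1) → ℝ :=
  fun e => Sum.elim z (fun _ => a) ((upperIdxSucc p).symm e)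

theorem symmOfUpper_joinUpper_zero_zero {p : ℕ} (z : Fin p ⊕ UpperIdx p → ℝ) (a : ℝ) :
    symmOfUpper (joinUpper z a) 0 0 = a := rfl

theorem symmOfUpper_joinUpper_zero_succ {p : ℕ} (z : Fin p ⊕ UpperIdx p → ℝ) (a : ℝ) (j : Fin p) :
    symmOfUpper (joinUpper z a) 0 j.succ = z (Sum.inl j) := by
  have h : (⟨(min 0 j.succ, max 0 j.succ), min_le_max⟩ : UpperIdx (p + 1)) =
      upperIdxSucc p (Sum.inl (Sum.inl j)) := by
    apply Subtype.ext
    simp [upperIdxSucc]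
  rw [symmOfUpper_apply, h, joinUpper, Equiv.symm_apply_apply]
  rfl

theorem symmOfUpper_joinUpper_succ_zero {p : ℕ} (z : Fin p ⊕ UpperIdx p → ℝ) (a : ℝ) (j : Fin p) :
    symmOfUpper (joinUpper z a) j.succ 0 = z (Sum.inl j) := by
  rw [← (symmOfUpper_isSymm _).apply, symmOfUpper_joinUpper_zero_succ]

theorem symmOfUpper_joinUpper_succ_succ {p : ℕ} (z : Fin p ⊕ UpperIdx p → ℝ) (a : ℝ)
    (i j : Fin p) :
    symmOfUpper (joinUpper z a) i.succ j.succ = symmOfUpper (fun e => z (Sum.inr e)) i j := by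
  have h : (⟨(min i.succ j.succ, max i.succ j.succ), min_le_max⟩ : UpperIdx (p + 1)) =
      upperIdxSucc p (Sum.inl (Sum.inr ⟨(min i j, max i j), min_le_max⟩)) := by
    apply Subtype.ext
    rcases le_total i j with h | h <;> simp [upperIdxSucc, h]
  rw [symmOfUpper_apply, h, joinUpper, Equiv.symm_apply_apply]
  rfl

theorem submatrix_joinUpper {p : ℕ} (z : Fin p ⊕ UpperIdx p → ℝ) (a : ℝ) :
    (symmOfUpper (joinUpper z a)).submatrix Fin.succ Fin.succ =
      symmOfUpper (fun e => z (Sum.inr e)) := by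
  ext i j
  exact symmOfUpper_joinUpper_succ_succ z a i j

/-- Expansion along the first row: the determinant is affine in the corner entry, with slope the
determinant of the remaining block. The induction on `p` for negative powers rests on this. -/
theorem det_joinUpper {p : ℕ} (z : Fin p ⊕ UpperIdx p → ℝ) (a : ℝ) :
    (symmOfUpper (joinUpper z a)).det =
      a * (symmOfUpper (fun e => z (Sum.inr e))).det + (symmOfUpper (joinUpper z 0)).det := by
  rw [det_succ_row_zero, det_succ_row_zero (symmOfUpper (joinUpper z 0)), Fin.sum_univ_succ,
    Fin.sum_univ_succ]
  have h0 : ∀ b, (symmOfUpper (joinUpper z b)).submatrix Fin.succ (Fin.succAbove 0) =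
      symmOfUpper (fun e => z (Sum.inr e)) := by
    intro b
    rw [← submatrix_joinUpper z b]; rfl
  have hs : ∀ j : Fin p, (symmOfUpper (joinUpper z a)).submatrix Fin.succ j.succ.succAbove =
      (symmOfUpper (joinUpper z 0)).submatrix Fin.succ j.succ.succAbove := by
    intro j
    ext i k
    simp only [submatrix_apply]
    induction j.succ.succAbove k using Fin.cases with
    | zero => simp only [symmOfUpper_joinUpper_succ_zero]
    | succ l => simp only [symmOfUpper_joinUpper_succ_succ]
  simp only [symmOfUpper_joinUpper_zero_zero, symmOfUpper_joinUpper_zero_succ, h0, hs]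
  simp

theorem trace_joinUpper {p : ℕ} (z : Fin p ⊕ UpperIdx p → ℝ) (a : ℝ) :
    (symmOfUpper (joinUpper z a)).trace = a + (symmOfUpper (fun e => z (Sum.inr e))).trace := by
  simp only [trace, diag_apply, Fin.sum_univ_succ, symmOfUpper_joinUpper_zero_zero,
    symmOfUpper_joinUpper_succ_succ]

theorem lintegral_joinUpper {p : ℕ} {f : (UpperIdx (p + 1) → ℝ) → ENNReal} (hf : Measurable f) :
    ∫⁻ y, f y = ∫⁻ z : Fin p ⊕ UpperIdx p → ℝ, ∫⁻ a : ℝ, f (joinUpper z a) := by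
  have h1 := volume_measurePreserving_piCongrLeft (fun _ : UpperIdx (p + 1) => ℝ) (upperIdxSucc p)
  have h2 := volume_measurePreserving_sumPiEquivProdPi_symm
    (fun _ : (Fin p ⊕ UpperIdx p) ⊕ Unit => ℝ)
  have h3 := (MeasurePreserving.id (volume : Measure (Fin p ⊕ UpperIdx p → ℝ))).prod
    (volume_preserving_funUnique Unit ℝ).symm
  have h4 := (h1.comp h2).comp h3
  rw [← h4.lintegral_comp hf, lintegral_prod]
  swap
  · exact (hf.comp h4.measurable).aemeasurable
  refine lintegral_congr fun z => lintegral_congr fun a => ?_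
  congr 1
  funext e
  obtain ⟨e, rfl⟩ := (upperIdxSucc p).surjective e
  simp only [Function.comp_apply, MeasurableEquiv.coe_piCongrLeft]
  rw [Equiv.piCongrLeft_apply_apply, joinUpper, Equiv.symm_apply_apply]
  rcases e with e | e <;> rfl

end InvWishartBvM
end

/-! ### Integrability of negative powers of the determinant -/

noncomputable section

namespace InvWishartBvM

/-- With `a₀ = -e / D` one has `(aD + e)^β = D^β (a - a₀)^β`. Within distance one of `a₀` the power
is kept, which is integrable for `β > -1`; further away the power is at most one and the exponential
is kept. The bound integrates over `a` to `D^β` times a constant free of `e`. -/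
theorem affine_rpow_mul_exp_le {β c D e a : ℝ} (hβ : β ≤ 0) (hc : 0 ≤ c) (hD : 0 < D) (ha : 0 < a)
    (hpos : 0 < a * D + e) :
    ENNReal.ofReal ((a * D + e) ^ β * Real.exp (-c * a)) ≤ ENNReal.ofReal (D ^ β) *
      ((Set.Ioc (0 : ℝ) 1).indicator (fun x => ENNReal.ofReal (x ^ β)) (a - -e / D) +
        (Set.Ioi (0 : ℝ)).indicator (fun x => ENNReal.ofReal (Real.exp (-c * x))) a) := by
  have hx : 0 < a - -e / D := by
    have : a - -e / D = (a * D + e) / D := by field_simp; ring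
    rw [this]; positivity
  have hprod : a * D + e = D * (a - -e / D) := by field_simp; ring
  rw [hprod, Real.mul_rpow hD.le hx.le, mul_assoc, ENNReal.ofReal_mul (by positivity)]
  refine mul_le_mul_right ?_ _
  rw [Set.indicator_of_mem (Set.mem_Ioi.2 ha)]
  by_cases h1 : a - -e / D ≤ 1
  · rw [Set.indicator_of_mem (Set.mem_Ioc.2 ⟨hx, h1⟩)]
    refine le_add_right (ENNReal.ofReal_le_ofReal ?_)
    refine mul_le_of_le_one_right (by positivity) (Real.exp_le_one_iff.2 ?_)
    nlinarith
  · refine le_add_left (ENNReal.ofReal_le_ofReal ?_)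
    refine mul_le_of_le_one_left (by positivity) ?_
    exact Real.rpow_le_one_of_one_le_of_nonpos (not_le.1 h1).le hβ

theorem lintegral_rpow_add_exp (β c a₀ : ℝ) :
    ∫⁻ a : ℝ, ((Set.Ioc (0 : ℝ) 1).indicator (fun x => ENNReal.ofReal (x ^ β)) (a - a₀) +
        (Set.Ioi (0 : ℝ)).indicator (fun x => ENNReal.ofReal (Real.exp (-c * x))) a) =
      (∫⁻ x in Set.Ioc (0 : ℝ) 1, ENNReal.ofReal (x ^ β)) +
        ∫⁻ x in Set.Ioi (0 : ℝ), ENNReal.ofReal (Real.exp (-c * x)) := by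
  rw [lintegral_add_right _ (Measurable.indicator (by fun_prop) measurableSet_Ioi),
    lintegral_sub_right_eq_self (fun a => (Set.Ioc (0 : ℝ) 1).indicator
      (fun x => ENNReal.ofReal (x ^ β)) a) a₀, lintegral_indicator measurableSet_Ioc,
    lintegral_indicator measurableSet_Ioi]

/-- Induction on the size, integrating out the corner entry first. Since the determinant is affine
in it, this returns the same power `β` of the determinant of the block, with a constant independent
of the rest of the first row; hence `β > -1` suffices in every dimension. -/
theorem lintegral_det_rpow_lt_top {β : ℝ} (hβ : -1 < β) (hβ0 : β ≤ 0) (p : ℕ) :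
    ∀ c : ℝ, 0 < c → ∫⁻ y in posDefCoords p, ENNReal.ofReal
      ((symmOfUpper y).det ^ β * Real.exp (-c * (symmOfUpper y).trace)) < ⊤ := by
  induction p with
  | zero =>
    intro c _
    have h : ∀ y : UpperIdx 0 → ℝ, ENNReal.ofReal
        ((symmOfUpper y).det ^ β * Real.exp (-c * (symmOfUpper y).trace)) = 1 := by
      intro y; simp [trace]
    simp only [h, lintegral_const, one_mul]
    refine (measure_mono (Set.subset_univ _)).trans_lt ?_
    rw [Measure.restrict_apply_univ, volume_pi, Measure.pi_of_empty]
    exact measure_lt_top _ _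
  | succ p ih =>
    intro c hc
    set g : (UpperIdx p → ℝ) → ENNReal := (posDefCoords p).indicator fun x => ENNReal.ofReal
      ((symmOfUpper x).det ^ β * Real.exp (-(c / 2) * (symmOfUpper x).trace)) with hg
    -- Half of the decay is spent on the first row, whose `p` off-diagonal entries are each at most
    -- the trace; `p + 1` also covers `p = 0`.
    set c₁ : ℝ := c / 2 / (p + 1) with hc₁
    have hc₁0 : 0 < c₁ := by positivity
    set K : ENNReal := (∫⁻ x in Set.Ioc (0 : ℝ) 1, ENNReal.ofReal (x ^ β)) +
        ∫⁻ x in Set.Ioi (0 : ℝ), ENNReal.ofReal (Real.exp (-(c / 2) * x)) with hK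
    have hKtop : K < ⊤ := by
      refine ENNReal.add_lt_top.2 ⟨?_, ?_⟩
      · exact ((intervalIntegrable_iff_integrableOn_Ioc_of_le zero_le_one).1
          (intervalIntegral.intervalIntegrable_rpow' hβ)).lintegral_lt_top
      · exact (exp_neg_integrableOn_Ioi 0 (half_pos hc)).lintegral_lt_top
    have hdetm : ∀ q, Measurable fun y : UpperIdx q → ℝ => (symmOfUpper y).det :=
      fun q => measurable_det_symmOfUpper
    have htrm : ∀ q, Measurable fun y : UpperIdx q → ℝ => (symmOfUpper y).trace :=
      fun q => continuous_trace_symmOfUpper.measurable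
    have hfm : ∀ (q : ℕ) (b : ℝ), Measurable ((posDefCoords q).indicator fun y => ENNReal.ofReal
        ((symmOfUpper y).det ^ β * Real.exp (-b * (symmOfUpper y).trace))) := by
      intro q b
      have h1 := hdetm q
      have h2 := htrm q
      exact Measurable.indicator (by fun_prop) (measurableSet_posDefCoords q)
    rw [← lintegral_indicator (measurableSet_posDefCoords _), lintegral_joinUpper (hfm _ _)]
    have hb : ∀ z : Fin p ⊕ UpperIdx p → ℝ, ∫⁻ a : ℝ,
        ((posDefCoords (p + 1)).indicator (fun y => ENNReal.ofReal
        ((symmOfUpper y).det ^ β * Real.exp (-c * (symmOfUpper y).trace))) (joinUpper z a)) ≤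
        ENNReal.ofReal (Real.exp (-c₁ * ∑ j, |z (Sum.inl j)|)) * g (fun e => z (Sum.inr e)) * K := by
      intro z
      set x : UpperIdx p → ℝ := fun e => z (Sum.inr e) with hx
      set D := (symmOfUpper x).det with hD
      set e := (symmOfUpper (joinUpper z 0)).det with he
      rw [hK, ← lintegral_rpow_add_exp β (c / 2) (-e / D), ← lintegral_const_mul']
      swap
      · refine ENNReal.mul_ne_top ENNReal.ofReal_ne_top ?_
        by_cases h : x ∈ posDefCoords p
        · rw [hg, Set.indicator_of_mem h]; exact ENNReal.ofReal_ne_top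
        · rw [hg, Set.indicator_of_notMem h]; exact ENNReal.zero_ne_top
      refine lintegral_mono fun a => ?_
      by_cases hy : joinUpper z a ∈ posDefCoords (p + 1)
      swap
      · rw [Set.indicator_of_notMem hy]; exact zero_le
      rw [Set.indicator_of_mem hy]
      have hpd : (symmOfUpper (joinUpper z a)).PosDef := hy
      have hxpd : x ∈ posDefCoords p := by
        have h := hpd.submatrix (Fin.succ_injective p)
        rwa [submatrix_joinUpper] at h
      have ha : 0 < a := by
        have h := hpd.diag_pos (i := 0)
        rwa [symmOfUpper_joinUpper_zero_zero] at h
      have hD0 : 0 < D := PosDef.det_pos hxpd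
      have hpos : 0 < a * D + e := by
        have h := hpd.det_pos
        rwa [det_joinUpper] at h
      have hw : c₁ * ∑ j, |z (Sum.inl j)| ≤ c / 2 * (symmOfUpper (joinUpper z a)).trace := by
        have h1 : ∀ j, |z (Sum.inl j)| ≤ (symmOfUpper (joinUpper z a)).trace := fun j => by
          have h := abs_apply_le_trace hpd.posSemidef 0 j.succ
          rwa [symmOfUpper_joinUpper_zero_succ] at h
        have h2 := Finset.sum_le_sum fun j (_ : j ∈ Finset.univ) => h1 j
        have h3 := hpd.posSemidef.trace_nonneg
        simp only [Finset.sum_const, Finset.card_univ, Fintype.card_fin, nsmul_eq_mul] at h2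
        rw [hc₁, div_mul_eq_mul_div, div_le_iff₀ (by positivity), mul_assoc]
        refine mul_le_mul_of_nonneg_left ?_ (by positivity)
        nlinarith
      rw [hg, Set.indicator_of_mem hxpd, det_joinUpper, ← hx, ← hD, ← he]
      have key := affine_rpow_mul_exp_le hβ0 (half_pos hc).le hD0 ha hpos
      calc ENNReal.ofReal ((a * D + e) ^ β *
            Real.exp (-c * (symmOfUpper (joinUpper z a)).trace))
          ≤ ENNReal.ofReal (Real.exp (-c₁ * ∑ j, |z (Sum.inl j)|) *
              Real.exp (-(c / 2) * (symmOfUpper x).trace) *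
              ((a * D + e) ^ β * Real.exp (-(c / 2) * a))) := by
            refine ENNReal.ofReal_le_ofReal ?_
            rw [mul_left_comm, ← Real.exp_add, ← Real.exp_add]
            refine mul_le_mul_of_nonneg_left (Real.exp_le_exp.2 ?_) (by positivity)
            have htr := trace_joinUpper z a
            rw [← hx] at htr
            rw [htr] at hw ⊢
            linarith
        _ = ENNReal.ofReal (Real.exp (-c₁ * ∑ j, |z (Sum.inl j)|)) *
              ENNReal.ofReal (Real.exp (-(c / 2) * (symmOfUpper x).trace)) *
              ENNReal.ofReal ((a * D + e) ^ β * Real.exp (-(c / 2) * a)) := by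
            rw [ENNReal.ofReal_mul (by positivity), ENNReal.ofReal_mul (by positivity)]
        _ ≤ _ := by
            rw [ENNReal.ofReal_mul (p := D ^ β) (by positivity), mul_comm (ENNReal.ofReal (D ^ β)),
              ← mul_assoc (ENNReal.ofReal (Real.exp (-c₁ * ∑ j, |z (Sum.inl j)|))),
              mul_assoc (_ * _) (ENNReal.ofReal (D ^ β))]
            exact mul_le_mul_right key _
    refine (lintegral_mono hb).trans_lt ?_
    have hgm : Measurable g := hfm p (c / 2)
    have hsum : ∫⁻ z : Fin p ⊕ UpperIdx p → ℝ,
        ENNReal.ofReal (Real.exp (-c₁ * ∑ j, |z (Sum.inl j)|)) * g (fun e => z (Sum.inr e)) =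
        (∫⁻ w : Fin p → ℝ, ENNReal.ofReal (Real.exp (-c₁ * ∑ j, |w j|))) * ∫⁻ x, g x := by
      have h2 := volume_measurePreserving_sumPiEquivProdPi (fun _ : Fin p ⊕ UpperIdx p => ℝ)
      rw [← lintegral_prod_mul (by fun_prop : Measurable _).aemeasurable hgm.aemeasurable]
      exact h2.lintegral_comp (f := fun q : (Fin p → ℝ) × (UpperIdx p → ℝ) =>
        ENNReal.ofReal (Real.exp (-c₁ * ∑ j, |q.1 j|)) * g q.2) (by fun_prop)
    rw [lintegral_mul_const' _ _ hKtop.ne, hsum, hg,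
      lintegral_indicator (measurableSet_posDefCoords _)]
    exact ENNReal.mul_lt_top (ENNReal.mul_lt_top
      (integrable_exp_neg_sum_abs hc₁0).lintegral_lt_top (ih _ (half_pos hc))) hKtop

/-- The unnormalized Wishart density in coordinates: the density of the inverse of an Inverse
Wishart matrix. -/
def wishartKernel {p : ℕ} (A : Matrix (Fin p) (Fin p) ℝ) (k : ℝ) (y : UpperIdx p → ℝ) : ℝ :=
  (symmOfUpper y).det ^ k * Real.exp (-(1 / 2) * (A * symmOfUpper y).trace)

theorem wishartKernel_pos {p : ℕ} (A : Matrix (Fin p) (Fin p) ℝ) (k : ℝ) {y : UpperIdx p → ℝ}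
    (hy : y ∈ posDefCoords p) : 0 < wishartKernel A k y :=
  mul_pos (Real.rpow_pos_of_pos (PosDef.det_pos hy) _) (Real.exp_pos _)

theorem continuous_trace_mul_symmOfUpper {p : ℕ} (A : Matrix (Fin p) (Fin p) ℝ) :
    Continuous fun y : UpperIdx p → ℝ => (A * symmOfUpper y).trace :=
  (continuous_const.matrix_mul (continuous_symmOfUpper p)).matrix_trace

theorem measurable_wishartKernel {p : ℕ} (A : Matrix (Fin p) (Fin p) ℝ) (k : ℝ) :
    Measurable (wishartKernel A k) := by
  have h1 := measurable_det_symmOfUpper (p := p)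
  have h2 := (continuous_trace_mul_symmOfUpper A).measurable
  unfold wishartKernel
  fun_prop

theorem exists_exp_trace_le {p : ℕ} {A : Matrix (Fin p) (Fin p) ℝ} (hA : A.PosDef) :
    ∃ c > 0, ∀ y ∈ posDefCoords p, Real.exp (-(1 / 2) * (A * symmOfUpper y).trace) ≤
      Real.exp (-c * (symmOfUpper y).trace) := by
  obtain ⟨c, hc, h⟩ := exists_trace_mul_ge hA
  refine ⟨c / 2, by positivity, fun y hy => Real.exp_le_exp.2 ?_⟩
  have := h _ (PosDef.posSemidef hy)
  linarith

theorem one_add_trace_pow_bound {p : ℕ} {y : UpperIdx p → ℝ} (hy : y ∈ posDefCoords p) {k : ℝ}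
    (hk : 0 ≤ k) : (symmOfUpper y).det ^ k ≤
      (p.factorial : ℝ) ^ k * (1 + (symmOfUpper y).trace) ^ (p * ⌈k⌉₊) := by
  have ht : 0 ≤ (symmOfUpper y).trace := (PosDef.posSemidef hy).trace_nonneg
  have hd := det_le_of_posDef (PosDef.posSemidef hy)
  have h1 : (symmOfUpper y).det ≤ p.factorial * (1 + (symmOfUpper y).trace) ^ p :=
    hd.trans (mul_le_mul_of_nonneg_left (pow_le_pow_left₀ ht (by linarith) _) (by positivity))
  calc (symmOfUpper y).det ^ k ≤ (p.factorial * (1 + (symmOfUpper y).trace) ^ p) ^ k :=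
        Real.rpow_le_rpow (PosDef.det_pos hy).le h1 hk
    _ = (p.factorial : ℝ) ^ k * ((1 + (symmOfUpper y).trace) ^ p) ^ k :=
        Real.mul_rpow (by positivity) (by positivity)
    _ ≤ (p.factorial : ℝ) ^ k * ((1 + (symmOfUpper y).trace) ^ p) ^ (⌈k⌉₊ : ℝ) := by
        refine mul_le_mul_of_nonneg_left ?_ (by positivity)
        exact Real.rpow_le_rpow_of_exponent_le (one_le_pow₀ (by linarith)) (Nat.le_ceil k)
    _ = _ := by rw [Real.rpow_natCast, ← pow_mul]

/-- Negative powers come from the induction on the size; nonnegative ones grow at most polynomially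
in the trace. -/
theorem integrableOn_wishartKernel {p : ℕ} {A : Matrix (Fin p) (Fin p) ℝ} (hA : A.PosDef) {k : ℝ}
    (hk : -1 < k) : IntegrableOn (wishartKernel A k) (posDefCoords p) := by
  obtain ⟨c, hc, hle⟩ := exists_exp_trace_le hA
  have hm := (measurable_wishartKernel A k).aestronglyMeasurable
    (μ := volume.restrict (posDefCoords p))
  rcases le_total k 0 with hk0 | hk0
  · have hfin : IntegrableOn (fun y : UpperIdx p → ℝ => (symmOfUpper y).det ^ k *
        Real.exp (-c * (symmOfUpper y).trace)) (posDefCoords p) := by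
      have h1 := measurable_det_symmOfUpper (p := p)
      have h2 := (continuous_trace_symmOfUpper (p := p)).measurable
      refine ⟨(by fun_prop : Measurable _).aestronglyMeasurable, ?_⟩
      rw [hasFiniteIntegral_iff_ofReal]
      · exact lintegral_det_rpow_lt_top hk hk0 p c hc
      · refine (ae_restrict_iff' (measurableSet_posDefCoords p)).2
          (Filter.Eventually.of_forall fun y hy => ?_)
        have := PosDef.det_pos (A := symmOfUpper y) hy
        change 0 ≤ _
        positivity
    refine hfin.mono' hm ((ae_restrict_iff' (measurableSet_posDefCoords p)).2
      (Filter.Eventually.of_forall fun y hy => ?_))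
    rw [Real.norm_eq_abs, abs_of_pos (wishartKernel_pos A k hy)]
    exact mul_le_mul_of_nonneg_left (hle y hy)
      (Real.rpow_nonneg (PosDef.det_pos (A := symmOfUpper y) hy).le _)
  · refine integrableOn_of_le_pow_mul_exp (p * ⌈k⌉₊) hc hm (K := (p.factorial : ℝ) ^ k)
      fun y hy => ?_
    rw [abs_of_pos (wishartKernel_pos A k hy)]
    have ht : 0 ≤ (symmOfUpper y).trace := (PosDef.posSemidef hy).trace_nonneg
    exact mul_le_mul (one_add_trace_pow_bound hy hk0) (hle y hy) (Real.exp_pos _).le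
      (by positivity)


end InvWishartBvM
end

noncomputable section

namespace InvWishartBvM

/-! ### The Inverse Wishart distribution and conjugacy -/

theorem measurable_inv_matrix {p : ℕ} :
    Measurable fun S : Matrix (Fin p) (Fin p) ℝ => S⁻¹ := by
  have h : (fun S : Matrix (Fin p) (Fin p) ℝ => S⁻¹) = fun S => (S.det)⁻¹ • S.adjugate := by
    funext S; rw [inv_def, Ring.inverse_eq_inv']
  have h1 : Measurable fun S : Matrix (Fin p) (Fin p) ℝ => S.det :=
    (continuous_id.matrix_det).measurable
  have h2 : Measurable fun S : Matrix (Fin p) (Fin p) ℝ => S.adjugate :=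
    (continuous_id.matrix_adjugate).measurable
  rw [h]
  refine measurable_pi_lambda _ fun i => measurable_pi_lambda _ fun j => ?_
  have h3 : Measurable fun S : Matrix (Fin p) (Fin p) ℝ => S.adjugate i j :=
    (measurable_pi_apply j).comp ((measurable_pi_apply i).comp h2)
  exact h1.inv.mul h3

theorem measurable_det_matrix {p : ℕ} : Measurable fun S : Matrix (Fin p) (Fin p) ℝ => S.det :=
  (continuous_id.matrix_det).measurable

theorem measurable_trace_mul_matrix {p : ℕ} (G : Matrix (Fin p) (Fin p) ℝ) :
    Measurable fun S : Matrix (Fin p) (Fin p) ℝ => (G * S).trace :=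
  ((continuous_const.matrix_mul continuous_id).matrix_trace).measurable

theorem measurable_invWishartKernel {p : ℕ} (G : Matrix (Fin p) (Fin p) ℝ) (ν : ℝ) :
    Measurable (invWishartKernel G ν) := by
  have h1 := measurable_det_matrix (p := p)
  have h2 := (measurable_trace_mul_matrix G).comp measurable_inv_matrix
  refine Measurable.ite (measurableSet_posDef p) ?_ measurable_const
  exact (h1.pow_const _).mul ((h2.const_mul _).exp)

theorem measurable_gaussianLikelihood {n p : ℕ} (x : Fin n → EuclideanSpace ℝ (Fin p)) :
    Measurable (gaussianLikelihood x) := by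
  refine Finset.measurable_prod _ fun i _ => ?_
  have h1 := measurable_det_matrix (p := p)
  have h2 : Measurable fun S : Matrix (Fin p) (Fin p) ℝ =>
      (x i).ofLp ⬝ᵥ (S⁻¹ *ᵥ (x i).ofLp) := by
    have h3 : Continuous fun S : Matrix (Fin p) (Fin p) ℝ => (x i).ofLp ⬝ᵥ (S *ᵥ (x i).ofLp) :=
      continuous_const.dotProduct (continuous_id.matrix_mulVec continuous_const)
    exact h3.measurable.comp measurable_inv_matrix
  exact ((h1.pow_const _).const_mul _).mul ((h2.const_mul _).exp)

/-- Passing to `Ω = S⁻¹` turns `det(S)^(-(ν+p+1)/2)` into `det(Ω)^((ν+p+1)/2)`, and the Jacobian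
`det(Ω)^(-(p+1))` lowers the exponent to `(ν-p-1)/2`. All later integrals are computed in `Ω`, where
the exponential is linear. -/
theorem lintegral_invWishartKernel {p : ℕ} (A : Matrix (Fin p) (Fin p) ℝ) (ν : ℝ)
    {F : Matrix (Fin p) (Fin p) ℝ → ENNReal} (hF : Measurable F) :
    ∫⁻ S, ENNReal.ofReal (invWishartKernel A ν S) * F S ∂symmVolume p =
      ∫⁻ y in posDefCoords p, ENNReal.ofReal (wishartKernel A ((ν - p - 1) / 2) y) *
        F (symmOfUpper y)⁻¹ := by
  have h0 : Measurable fun S => ENNReal.ofReal (invWishartKernel A ν S) * F S :=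
    (measurable_invWishartKernel A ν).ennreal_ofReal.mul hF
  rw [symmVolume, lintegral_map h0 (measurable_symmOfUpper p)]
  have h1 : ∫⁻ y, ENNReal.ofReal (invWishartKernel A ν (symmOfUpper y)) * F (symmOfUpper y) =
      ∫⁻ y in posDefCoords p,
        ENNReal.ofReal (invWishartKernel A ν (symmOfUpper y)) * F (symmOfUpper y) := by
    rw [← lintegral_indicator (measurableSet_posDefCoords p)]
    refine lintegral_congr fun y => ?_
    by_cases hy : y ∈ posDefCoords p
    · rw [Set.indicator_of_mem hy]
    · have hy' : ¬ (symmOfUpper y).PosDef := hy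
      rw [Set.indicator_of_notMem hy, invWishartKernel, if_neg hy']; simp
  rw [h1, lintegral_posDefCoords_eq_inv]
  refine setLIntegral_congr_fun (measurableSet_posDefCoords p) fun y hy => ?_
  simp only [symmOfUpper_invCoords]
  have hd : 0 < (symmOfUpper y).det := PosDef.det_pos hy
  rw [← mul_assoc, ← ENNReal.ofReal_mul (by positivity), invWishartKernel,
    if_pos (PosDef.inv hy), nonsing_inv_nonsing_inv _ hd.ne'.isUnit, wishartKernel, ← mul_assoc,
    det_nonsing_inv, Ring.inverse_eq_inv', Real.inv_rpow hd.le, ← Real.rpow_neg hd.le,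
    ← Real.rpow_add hd]
  congr 5
  ring

theorem withDensity_invWishartKernel {p : ℕ} (A : Matrix (Fin p) (Fin p) ℝ) (ν : ℝ) :
    (symmVolume p).withDensity (fun S => ENNReal.ofReal (invWishartKernel A ν S)) =
      ((volume.restrict (posDefCoords p)).withDensity
        fun y => ENNReal.ofReal (wishartKernel A ((ν - p - 1) / 2) y)).map
          fun y => (symmOfUpper y)⁻¹ := by
  have hm : Measurable fun y : UpperIdx p → ℝ => (symmOfUpper y)⁻¹ :=
    measurable_inv_matrix.comp (measurable_symmOfUpper p)
  ext s hs
  rw [Measure.map_apply hm hs, withDensity_apply _ hs, withDensity_apply _ (hm hs),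
    ← lintegral_indicator hs, ← lintegral_indicator (hm hs)]
  have h := lintegral_invWishartKernel A ν (F := s.indicator 1)
    (measurable_one.indicator hs)
  refine Eq.trans (lintegral_congr fun S => ?_) (h.trans (lintegral_congr fun y => ?_))
  · by_cases hS : S ∈ s <;> simp [hS]
  · by_cases hS : (symmOfUpper y)⁻¹ ∈ s <;> simp [hS]

/-- The total mass of the unnormalized Wishart density. -/
def wishartMass {p : ℕ} (A : Matrix (Fin p) (Fin p) ℝ) (k : ℝ) : ENNReal :=
  ∫⁻ y in posDefCoords p, ENNReal.ofReal (wishartKernel A k y)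

theorem wishartMass_ne_top {p : ℕ} {A : Matrix (Fin p) (Fin p) ℝ} (hA : A.PosDef) {k : ℝ}
    (hk : -1 < k) : wishartMass A k ≠ ⊤ :=
  (integrableOn_wishartKernel hA hk).lintegral_lt_top.ne

theorem wishartMass_ne_zero {p : ℕ} (A : Matrix (Fin p) (Fin p) ℝ) (k : ℝ) :
    wishartMass A k ≠ 0 := by
  have h : 0 < ∫⁻ y in posDefCoords p, ENNReal.ofReal (wishartKernel A k y) := by
    rw [setLIntegral_pos_iff (measurable_wishartKernel A k).ennreal_ofReal]
    refine ((isOpen_posDefCoords p).measure_pos volume (nonempty_posDefCoords p)).trans_le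
      (measure_mono fun y hy => ⟨?_, hy⟩)
    simpa using wishartKernel_pos A k hy
  exact h.ne'

theorem mass_invWishartKernel {p : ℕ} (A : Matrix (Fin p) (Fin p) ℝ) (ν : ℝ) :
    (symmVolume p).withDensity (fun S => ENNReal.ofReal (invWishartKernel A ν S)) Set.univ =
      wishartMass A ((ν - p - 1) / 2) := by
  rw [withDensity_apply _ MeasurableSet.univ, Measure.restrict_univ]
  have h := lintegral_invWishartKernel A ν (F := 1) measurable_one
  simpa [wishartMass] using h

theorem invWishart_eq {p : ℕ} (A : Matrix (Fin p) (Fin p) ℝ) (ν : ℝ) :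
    invWishart A ν = (wishartMass A ((ν - p - 1) / 2))⁻¹ •
      (symmVolume p).withDensity (fun S => ENNReal.ofReal (invWishartKernel A ν S)) := by
  rw [invWishart, normalize, mass_invWishartKernel]

theorem normalize_smul {E : Type*} [MeasurableSpace E] {c : ENNReal} (hc : c ≠ 0) (hc' : c ≠ ⊤)
    (m : Measure E) : normalize (c • m) = normalize m := by
  rw [normalize, normalize, Measure.smul_apply, smul_eq_mul, smul_smul,
    ENNReal.mul_inv (Or.inl hc) (Or.inl hc'), mul_right_comm, ENNReal.inv_mul_cancel hc hc', one_mul]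

theorem isProbabilityMeasure_invWishart {p : ℕ} {A : Matrix (Fin p) (Fin p) ℝ} (hA : A.PosDef)
    {ν : ℝ} (hν : (p : ℝ) - 1 < ν) : IsProbabilityMeasure (invWishart A ν) := by
  constructor
  rw [invWishart_eq, Measure.smul_apply, mass_invWishartKernel, smul_eq_mul,
    ENNReal.inv_mul_cancel (wishartMass_ne_zero _ _) (wishartMass_ne_top hA (by linarith))]

theorem smul_sampleCov {n p : ℕ} (hn : 0 < n) (x : Fin n → EuclideanSpace ℝ (Fin p)) :
    (n : ℝ) • sampleCov x = ∑ i, vecMulVec (x i).ofLp (x i).ofLp := by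
  have : (n : ℝ) ≠ 0 := by positivity
  rw [sampleCov, smul_smul, mul_inv_cancel₀ this, one_smul]

theorem gaussianLikelihood_eq {n p : ℕ} (hn : 0 < n) (x : Fin n → EuclideanSpace ℝ (Fin p))
    {S : Matrix (Fin p) (Fin p) ℝ} (hS : S.PosDef) :
    gaussianLikelihood x S = ((2 * Real.pi) ^ (-(p : ℝ) / 2)) ^ n * (S.det ^ (-(n : ℝ) / 2) *
      Real.exp (-(1 / 2) * ((n : ℝ) • sampleCov x * S⁻¹).trace)) := by
  have hd := hS.det_pos
  rw [gaussianLikelihood, Finset.prod_mul_distrib, Finset.prod_const, Finset.card_univ,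
    Fintype.card_fin, mul_pow, mul_assoc, ← Real.exp_sum, ← Finset.mul_sum, smul_sampleCov hn]
  congr 2
  · rw [← Real.rpow_natCast, ← Real.rpow_mul hd.le]
    congr 1; ring
  · congr 2
    rw [Finset.sum_mul, trace_sum]
    refine Finset.sum_congr rfl fun i _ => ?_
    rw [Matrix.trace_mul_comm, trace_mul_vecMulVec]

/-- The likelihood is itself of the same exponential form, with scale `nΣ̂`. Off the cone both sides
vanish, so the identity needs no restriction on `S`. -/
theorem invWishartKernel_mul_gaussianLikelihood {n p : ℕ} (hn : 0 < n)
    (x : Fin n → EuclideanSpace ℝ (Fin p)) (G : Matrix (Fin p) (Fin p) ℝ) (b : ℝ)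
    (S : Matrix (Fin p) (Fin p) ℝ) :
    invWishartKernel G (p + b - 1) S * gaussianLikelihood x S =
      ((2 * Real.pi) ^ (-(p : ℝ) / 2)) ^ n *
        invWishartKernel ((n : ℝ) • sampleCov x + G) (n + p + b - 1) S := by
  by_cases hS : S.PosDef
  · have hd := hS.det_pos
    rw [invWishartKernel, invWishartKernel, if_pos hS, if_pos hS, gaussianLikelihood_eq hn x hS,
      Matrix.add_mul, trace_add, mul_left_comm, mul_mul_mul_comm, ← Real.rpow_add hd,
      ← Real.exp_add]
    congr 3
    · ring
    · ring
  · simp [invWishartKernel, hS]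

theorem posSemidef_sampleCov {n p : ℕ} (x : Fin n → EuclideanSpace ℝ (Fin p)) :
    (sampleCov x).PosSemidef :=
  PosSemidef.smul (posSemidef_sum _ fun _ _ => posSemidef_vecMulVec _) (by positivity)

theorem posDef_smul_sampleCov_add {n p : ℕ} (x : Fin n → EuclideanSpace ℝ (Fin p))
    {G : Matrix (Fin p) (Fin p) ℝ} (hG : G.PosDef) : ((n : ℝ) • sampleCov x + G).PosDef :=
  PosDef.posSemidef_add ((posSemidef_sampleCov x).smul (by positivity)) hG

/-- Normalization removes the normalizer of the prior and the power of `2π`, but only because both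
are finite and nonzero. -/
theorem posterior_invWishart {n p : ℕ} (hn : 0 < n) {b : ℝ} (hb : 0 < b)
    {G : Matrix (Fin p) (Fin p) ℝ} (hG : G.PosDef) (x : Fin n → EuclideanSpace ℝ (Fin p)) :
    posterior (invWishart G (p + b - 1)) x =
      invWishart ((n : ℝ) • sampleCov x + G) (n + p + b - 1) := by
  set Z := wishartMass G (((p : ℝ) + b - 1 - p - 1) / 2) with hZ
  have hZ0 : Z ≠ 0 := wishartMass_ne_zero _ _
  -- Here `k = (b - 2)/2`, so `b > 0` is exactly the integrability threshold `k > -1`.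
  have hZt : Z ≠ ⊤ := wishartMass_ne_top hG (by linarith)
  set c : ℝ := ((2 * Real.pi) ^ (-(p : ℝ) / 2)) ^ n with hc
  have hc0 : 0 < c := by positivity
  have h1 : (invWishart G (p + b - 1)).withDensity
      (fun S => ENNReal.ofReal (gaussianLikelihood x S)) =
      (Z⁻¹ * ENNReal.ofReal c) • (symmVolume p).withDensity (fun S => ENNReal.ofReal
        (invWishartKernel ((n : ℝ) • sampleCov x + G) (n + p + b - 1) S)) := by
    rw [invWishart_eq, withDensity_smul_measure, ← withDensity_mul _
      (measurable_invWishartKernel _ _).ennreal_ofReal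
      (measurable_gaussianLikelihood x).ennreal_ofReal, ← smul_smul,
      ← withDensity_smul _ (measurable_invWishartKernel _ _).ennreal_ofReal]
    congr 2
    funext S
    have h0 : 0 ≤ invWishartKernel G (p + b - 1) S := by
      rw [invWishartKernel]
      split_ifs with h
      · have := h.det_pos; positivity
      · exact le_rfl
    rw [Pi.mul_apply, ← ENNReal.ofReal_mul h0, invWishartKernel_mul_gaussianLikelihood hn,
      ENNReal.ofReal_mul hc0.le]
    rfl
  rw [posterior, h1, normalize_smul, invWishart]
  · exact mul_ne_zero (ENNReal.inv_ne_zero.2 hZt) (by simpa using hc0)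
  · exact ENNReal.mul_ne_top (ENNReal.inv_ne_top.2 hZ0) ENNReal.ofReal_ne_top

theorem ae_posDef_invWishart {p : ℕ} (A : Matrix (Fin p) (Fin p) ℝ) (ν : ℝ) :
    ∀ᵐ S ∂invWishart A ν, S.PosDef := by
  rw [invWishart_eq]
  refine Measure.ae_smul_measure ?_ _
  rw [ae_withDensity_iff (measurable_invWishartKernel _ _).ennreal_ofReal]
  refine Filter.Eventually.of_forall fun S hS => ?_
  by_contra h
  exact hS (by rw [invWishartKernel, if_neg h, ENNReal.ofReal_zero])

theorem integrable_invWishart_iff {p : ℕ} {A : Matrix (Fin p) (Fin p) ℝ} (hA : A.PosDef)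
    {ν : ℝ} (hν : (p : ℝ) - 1 < ν) {F : Matrix (Fin p) (Fin p) ℝ → ℝ} (hF : Measurable F) :
    Integrable F (invWishart A ν) ↔ IntegrableOn (fun y => wishartKernel A ((ν - p - 1) / 2) y *
      F (symmOfUpper y)⁻¹) (posDefCoords p) := by
  have hm : Measurable fun y : UpperIdx p → ℝ => (symmOfUpper y)⁻¹ :=
    measurable_inv_matrix.comp (measurable_symmOfUpper p)
  rw [invWishart_eq, integrable_smul_measure
    (ENNReal.inv_ne_zero.2 (wishartMass_ne_top hA (by linarith)))
    (ENNReal.inv_ne_top.2 (wishartMass_ne_zero _ _)), withDensity_invWishartKernel,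
    integrable_map_measure hF.aestronglyMeasurable hm.aemeasurable,
    integrable_withDensity_iff_integrable_smul' (measurable_wishartKernel _ _).ennreal_ofReal
    (Filter.Eventually.of_forall fun _ => ENNReal.ofReal_lt_top)]
  refine integrable_congr ((ae_restrict_iff' (measurableSet_posDefCoords p)).2
    (Filter.Eventually.of_forall fun y hy => ?_))
  simp [ENNReal.toReal_ofReal (wishartKernel_pos A _ hy).le]

theorem integral_invWishart {p : ℕ} (A : Matrix (Fin p) (Fin p) ℝ) (ν : ℝ)
    {F : Matrix (Fin p) (Fin p) ℝ → ℝ} (hF : Measurable F) :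
    ∫ S, F S ∂invWishart A ν = (wishartMass A ((ν - p - 1) / 2)).toReal⁻¹ *
      ∫ y in posDefCoords p, wishartKernel A ((ν - p - 1) / 2) y * F (symmOfUpper y)⁻¹ := by
  have hm : Measurable fun y : UpperIdx p → ℝ => (symmOfUpper y)⁻¹ :=
    measurable_inv_matrix.comp (measurable_symmOfUpper p)
  rw [invWishart_eq, integral_smul_measure, withDensity_invWishartKernel,
    integral_map hm.aemeasurable hF.aestronglyMeasurable,
    integral_withDensity_eq_integral_toReal_smul (measurable_wishartKernel _ _).ennreal_ofReal
    (Filter.Eventually.of_forall fun _ => ENNReal.ofReal_lt_top), ENNReal.toReal_inv, smul_eq_mul]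
  congr 1
  refine setIntegral_congr_fun (measurableSet_posDefCoords p) fun y hy => ?_
  simp [ENNReal.toReal_ofReal (wishartKernel_pos A _ hy).le]

end InvWishartBvM
end

noncomputable section

namespace InvWishartBvM

/-! ### Integration by parts for the Inverse Wishart distribution -/

/-- The bound uses `1 + Tr S` rather than `Tr S` because each cofactor is the determinant of a
matrix with one row replaced by a basis vector. -/
theorem trace_adjugate_le {p : ℕ} {S : Matrix (Fin p) (Fin p) ℝ} (hS : S.PosSemidef) :
    |S.adjugate.trace| ≤ p * (p.factorial * (1 + S.trace) ^ p) := by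
  have ht := hS.trace_nonneg
  have h : ∀ i, |S.adjugate i i| ≤ p.factorial * (1 + S.trace) ^ p := by
    intro i
    rw [adjugate_apply]
    have h := Matrix.det_le (A := S.updateRow i (Pi.single i 1)) (abv := AbsoluteValue.abs)
      (x := 1 + S.trace) (fun a c => ?_)
    · simpa using h
    · rw [AbsoluteValue.abs_apply, updateRow_apply]
      split_ifs
      · rw [Pi.single_apply]
        split_ifs <;> simp <;> linarith
      · have := abs_apply_le_trace hS a c
        linarith
  rw [trace]
  refine (Finset.abs_sum_le_sum_abs _ _).trans ?_
  refine (Finset.sum_le_sum fun i _ => h i).trans (le_of_eq ?_)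
  simp

theorem det_mul_trace_inv {p : ℕ} {S : Matrix (Fin p) (Fin p) ℝ} (hS : S.PosDef) :
    S.det * S⁻¹.trace = S.adjugate.trace := by
  rw [inv_def, Ring.inverse_eq_inv', trace_smul, smul_eq_mul, ← mul_assoc,
    mul_inv_cancel₀ hS.det_pos.ne', one_mul]

/-- Two powers of the determinant absorb the square of `Tr(Ω⁻¹)`, since `det(Ω) Tr(Ω⁻¹)` is the
trace of the adjugate, a polynomial. Hence the requirement `k ≥ 2`. -/
theorem integrableOn_wishartKernel_mul {p : ℕ} {A : Matrix (Fin p) (Fin p) ℝ} (hA : A.PosDef)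
    {k K : ℝ} (hk : 2 ≤ k) {F : (UpperIdx p → ℝ) → ℝ} (hF : Measurable F)
    (hle : ∀ y ∈ posDefCoords p, |F y| ≤ K * (1 + (symmOfUpper y)⁻¹.trace) ^ 2) :
    IntegrableOn (fun y => wishartKernel A k y * F y) (posDefCoords p) := by
  obtain ⟨c, hc, hexp⟩ := exists_exp_trace_le hA
  set P : ℝ := (p.factorial : ℝ) with hP
  refine integrableOn_of_le_pow_mul_exp (p * ⌈k - 2⌉₊ + p * 2) hc
    (K := P ^ (k - 2) * (|K| * (P + p * P) ^ 2))
    ((measurable_wishartKernel A k).mul hF).aestronglyMeasurable fun y hy => ?_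
  have hpd : (symmOfUpper y).PosDef := hy
  have hd := hpd.det_pos
  set t := (symmOfUpper y).trace with ht
  have ht0 : 0 ≤ t := hpd.posSemidef.trace_nonneg
  have h1 : (symmOfUpper y).det * (1 + (symmOfUpper y)⁻¹.trace) ≤ (P + p * P) * (1 + t) ^ p := by
    rw [mul_add, mul_one, det_mul_trace_inv hpd]
    have h2 := (le_abs_self _).trans (trace_adjugate_le hpd.posSemidef)
    have h3 := det_le_of_posDef hpd.posSemidef
    have h4 : P * t ^ p ≤ P * (1 + t) ^ p :=
      mul_le_mul_of_nonneg_left (pow_le_pow_left₀ ht0 (by linarith) _) (by positivity)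
    calc _ ≤ P * (1 + t) ^ p + p * (P * (1 + t) ^ p) := add_le_add (h3.trans h4) h2
      _ = _ := by ring
  have hi0 : 0 ≤ (symmOfUpper y)⁻¹.trace := hpd.inv.posSemidef.trace_nonneg
  have h5 : ((symmOfUpper y).det * (1 + (symmOfUpper y)⁻¹.trace)) ^ 2 ≤
      ((P + p * P) * (1 + t) ^ p) ^ 2 := pow_le_pow_left₀ (by positivity) h1 2
  have h6 : (symmOfUpper y).det ^ k = (symmOfUpper y).det ^ (k - 2) * (symmOfUpper y).det ^ 2 := by
    rw [← Real.rpow_natCast _ 2, ← Real.rpow_add hd]; congr 1; norm_num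
  rw [abs_mul, abs_of_pos (wishartKernel_pos A k hy), wishartKernel]
  calc (symmOfUpper y).det ^ k * Real.exp (-(1 / 2) * (A * symmOfUpper y).trace) * |F y|
      ≤ (symmOfUpper y).det ^ k * Real.exp (-c * t) *
          (|K| * (1 + (symmOfUpper y)⁻¹.trace) ^ 2) := by
        refine mul_le_mul (mul_le_mul_of_nonneg_left (hexp y hy) (by positivity)) ?_
          (abs_nonneg _) (by positivity)
        exact (hle y hy).trans (mul_le_mul_of_nonneg_right (le_abs_self K) (by positivity))
    _ = (symmOfUpper y).det ^ (k - 2) *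
          (|K| * ((symmOfUpper y).det * (1 + (symmOfUpper y)⁻¹.trace)) ^ 2) * Real.exp (-c * t) := by
        rw [h6]; ring
    _ ≤ (P ^ (k - 2) * (1 + t) ^ (p * ⌈k - 2⌉₊)) *
          (|K| * ((P + p * P) * (1 + t) ^ p) ^ 2) * Real.exp (-c * t) := by
        refine mul_le_mul_of_nonneg_right (mul_le_mul
          (one_add_trace_pow_bound hy (by linarith)) (mul_le_mul_of_nonneg_left h5 (abs_nonneg _))
          (by positivity) (by positivity)) (Real.exp_pos _).le
    _ = _ := by rw [pow_add, mul_pow, pow_mul]; ring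

theorem abs_trace_mul_le {p : ℕ} (B : Matrix (Fin p) (Fin p) ℝ) {S : Matrix (Fin p) (Fin p) ℝ}
    (hS : S.PosSemidef) : |(B * S).trace| ≤ (∑ i, ∑ j, |B i j|) * S.trace := by
  simp only [trace, diag_apply, mul_apply, Finset.sum_mul]
  refine (Finset.abs_sum_le_sum_abs _ _).trans (Finset.sum_le_sum fun i _ =>
    (Finset.abs_sum_le_sum_abs _ _).trans (Finset.sum_le_sum fun j _ => ?_))
  rw [abs_mul]
  exact mul_le_mul_of_nonneg_left (abs_apply_le_trace hS j i) (abs_nonneg _)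

theorem abs_mul_apply_le {p : ℕ} (B : Matrix (Fin p) (Fin p) ℝ) {S : Matrix (Fin p) (Fin p) ℝ}
    (hS : S.PosSemidef) (i j : Fin p) : |(B * S) i j| ≤ (∑ k, |B i k|) * S.trace := by
  rw [mul_apply, Finset.sum_mul]
  refine (Finset.abs_sum_le_sum_abs _ _).trans (Finset.sum_le_sum fun k _ => ?_)
  rw [abs_mul]
  exact mul_le_mul_of_nonneg_left (abs_apply_le_trace hS k j) (abs_nonneg _)

theorem abs_trace_mul_mul_le {p : ℕ} (B : Matrix (Fin p) (Fin p) ℝ)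
    {S : Matrix (Fin p) (Fin p) ℝ} (hS : S.PosSemidef) :
    |(B * S * (B * S)).trace| ≤ (∑ i, ∑ j, |B i j|) ^ 2 * S.trace ^ 2 := by
  have ht := hS.trace_nonneg
  rw [trace]
  simp only [diag_apply]
  calc |∑ i, (B * S * (B * S)) i i| ≤ ∑ i, ∑ j, |(B * S) i j| * |(B * S) j i| := by
        refine (Finset.abs_sum_le_sum_abs _ _).trans (Finset.sum_le_sum fun i _ => ?_)
        rw [mul_apply]
        refine (Finset.abs_sum_le_sum_abs _ _).trans (le_of_eq ?_)
        simp only [abs_mul]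
    _ ≤ ∑ i, ∑ j, ((∑ k, |B i k|) * S.trace) * ((∑ k, |B j k|) * S.trace) :=
        Finset.sum_le_sum fun i _ => Finset.sum_le_sum fun j _ =>
          mul_le_mul (abs_mul_apply_le B hS i j) (abs_mul_apply_le B hS j i) (abs_nonneg _)
            (mul_nonneg (Finset.sum_nonneg fun _ _ => abs_nonneg _) ht)
    _ = _ := by
        rw [sq (∑ i, ∑ j, |B i j|), Finset.sum_mul_sum, Finset.sum_mul]
        refine Finset.sum_congr rfl fun i _ => ?_
        simp only [Finset.mul_sum, Finset.sum_mul]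
        refine Finset.sum_congr rfl fun j _ => ?_
        exact Finset.sum_congr rfl fun _ _ => Finset.sum_congr rfl fun _ _ => by ring

theorem hasDerivAt_det_one_add_smul {p : ℕ} (M : Matrix (Fin p) (Fin p) ℝ) :
    HasDerivAt (fun t : ℝ => (1 + t • M).det) M.trace 0 := by
  have h := (det (1 + (Polynomial.X : Polynomial ℝ) • M.map Polynomial.C)).hasDerivAt 0
  rw [derivative_det_one_add_X_smul] at h
  refine h.congr_of_eventuallyEq (Filter.Eventually.of_forall fun t => ?_)
  simp only
  rw [← Polynomial.coe_evalRingHom, RingHom.map_det]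
  congr 1
  ext i j
  simp [Matrix.one_apply, apply_ite]
  ring

theorem symmOfUpper_add_smul {p : ℕ} (y : UpperIdx p → ℝ) {B : Matrix (Fin p) (Fin p) ℝ}
    (hB : B.IsSymm) (t : ℝ) :
    symmOfUpper (y + t • upperOf B) = symmOfUpper y + t • B := by
  rw [symmOfUpper_add, symmOfUpper_smul, symmOfUpper_upperOf hB]

theorem hasDerivAt_det_symmOfUpper {p : ℕ} {y : UpperIdx p → ℝ} (hy : y ∈ posDefCoords p)
    {B : Matrix (Fin p) (Fin p) ℝ} (hB : B.IsSymm) :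
    HasDerivAt (fun t : ℝ => (symmOfUpper (y + t • upperOf B)).det)
      ((symmOfUpper y).det * (B * (symmOfUpper y)⁻¹).trace) 0 := by
  have hu : IsUnit (symmOfUpper y).det := (PosDef.det_pos hy).ne'.isUnit
  have h := (hasDerivAt_det_one_add_smul ((symmOfUpper y)⁻¹ * B)).const_mul (symmOfUpper y).det
  rw [Matrix.trace_mul_comm] at h
  refine h.congr_of_eventuallyEq (Filter.Eventually.of_forall fun t => ?_)
  simp only
  rw [symmOfUpper_add_smul y hB, ← det_mul, Matrix.mul_add, Matrix.mul_one, Matrix.mul_smul,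
    ← Matrix.mul_assoc, mul_nonsing_inv _ hu, Matrix.one_mul]

theorem hasDerivAt_trace_mul_inv {p : ℕ} {y : UpperIdx p → ℝ} (hy : y ∈ posDefCoords p)
    {B : Matrix (Fin p) (Fin p) ℝ} (hB : B.IsSymm) :
    HasDerivAt (fun t : ℝ => (B * (symmOfUpper (y + t • upperOf B))⁻¹).trace)
      (-(B * (symmOfUpper y)⁻¹ * (B * (symmOfUpper y)⁻¹)).trace) 0 := by
  let L : (UpperIdx p → ℝ) →ₗ[ℝ] ℝ :=
    { toFun := fun z => (B * symmOfUpper z).trace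
      map_add' := fun u v => by rw [symmOfUpper_add, Matrix.mul_add, trace_add]
      map_smul' := fun c u => by rw [symmOfUpper_smul, Matrix.mul_smul, trace_smul]; rfl }
  have h1 : HasFDerivAt (fun z : UpperIdx p → ℝ => (B * symmOfUpper z).trace)
    L.toContinuousLinearMap (invCoords y) := L.toContinuousLinearMap.hasFDerivAt
  have h2 := ((h1.comp y (hasFDerivAt_invCoords hy)).hasLineDerivAt (upperOf B))
  have hinvs : (symmOfUpper y)⁻¹.IsSymm := by
    rw [IsSymm, transpose_nonsing_inv, (symmOfUpper_isSymm y).eq]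
  have h3 : HasDerivAt (fun t : ℝ => (B * symmOfUpper (invCoords (y + t • upperOf B))).trace)
      ((B * symmOfUpper (-(upperOf ((symmOfUpper y)⁻¹ * symmOfUpper (upperOf B) *
        ((symmOfUpper y)⁻¹)ᵀ)))).trace) 0 := h2
  have hsym : ((symmOfUpper y)⁻¹ * B * (symmOfUpper y)⁻¹).IsSymm := by
    rw [IsSymm, transpose_mul, transpose_mul, hinvs.eq, hB.eq, Matrix.mul_assoc]
  have hneg : ∀ u : UpperIdx p → ℝ, symmOfUpper (-u) = -symmOfUpper u := fun u => rfl
  simp only [symmOfUpper_invCoords] at h3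
  rw [symmOfUpper_upperOf hB, hinvs.eq, hneg, symmOfUpper_upperOf hsym, Matrix.mul_neg,
    trace_neg] at h3
  simpa only [Matrix.mul_assoc] using h3

/-- The line derivative of the Wishart density times a function of `Tr(B Ω⁻¹)`. -/
def wishartLineDeriv {p : ℕ} (A B : Matrix (Fin p) (Fin p) ℝ) (k : ℝ) (g g' : ℝ → ℝ)
    (y : UpperIdx p → ℝ) : ℝ :=
  (k * (B * (symmOfUpper y)⁻¹).trace - 1 / 2 * (A * B).trace) * g (B * (symmOfUpper y)⁻¹).trace -
    (B * (symmOfUpper y)⁻¹ * (B * (symmOfUpper y)⁻¹)).trace * g' (B * (symmOfUpper y)⁻¹).trace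

theorem hasDerivAt_wishartKernel_mul {p : ℕ} {A B : Matrix (Fin p) (Fin p) ℝ} (hB : B.IsSymm)
    (k : ℝ) {g g' : ℝ → ℝ} (hg : ∀ x, HasDerivAt g (g' x) x) {y : UpperIdx p → ℝ}
    (hy : y ∈ posDefCoords p) :
    HasDerivAt (fun t : ℝ => wishartKernel A k (y + t • upperOf B) *
        g (B * (symmOfUpper (y + t • upperOf B))⁻¹).trace)
      (wishartKernel A k y * wishartLineDeriv A B k g g' y) 0 := by
  have hd : 0 < (symmOfUpper y).det := PosDef.det_pos hy
  have e0 : y + (0 : ℝ) • upperOf B = y := by simp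
  have h1 := (hasDerivAt_det_symmOfUpper hy hB).rpow_const (p := k)
    (Or.inl (by simp only [e0]; exact hd.ne'))
  have h2 : HasDerivAt (fun t : ℝ => (A * symmOfUpper (y + t • upperOf B)).trace)
      (A * B).trace 0 := by
    have h : HasDerivAt (fun t : ℝ => (A * symmOfUpper y).trace + id t * (A * B).trace)
        (A * B).trace 0 := by
      simpa using ((hasDerivAt_id (0 : ℝ)).mul_const (A * B).trace).const_add
        (A * symmOfUpper y).trace
    refine h.congr_of_eventuallyEq (Filter.Eventually.of_forall fun t => ?_)
    simp only
    rw [symmOfUpper_add_smul y hB, Matrix.mul_add, trace_add, Matrix.mul_smul, trace_smul,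
      smul_eq_mul, id]
  have h3 := (h2.const_mul (-(1 / 2))).exp
  have h4 := hasDerivAt_trace_mul_inv hy hB
  have h5 : HasDerivAt (fun t : ℝ => g (B * (symmOfUpper (y + t • upperOf B))⁻¹).trace) _ 0 :=
    (hg _).comp 0 h4
  have h6 := (h1.mul h3).mul h5
  simp only [e0] at h6
  refine h6.congr_deriv ?_
  simp only [Pi.mul_apply, e0]
  have h7 : (symmOfUpper y).det ^ (k - 1) * (symmOfUpper y).det = (symmOfUpper y).det ^ k := by
    rw [← Real.rpow_add_one hd.ne']; congr 1; ring
  rw [wishartKernel, wishartLineDeriv, ← h7]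
  ring

end InvWishartBvM
end

/-! ### Vanishing at the boundary of the cone and the Stein identity -/

noncomputable section

namespace InvWishartBvM

theorem hasDerivAt_zero_of_isLittleO {u : ℝ → ℝ} (h0 : u 0 = 0)
    (h : u =o[nhds 0] fun t : ℝ => t) : HasDerivAt u 0 0 := by
  rw [hasDerivAt_iff_isLittleO_nhds_zero]
  simpa [h0] using h

theorem differentiable_det_line {p : ℕ} (y v : UpperIdx p → ℝ) :
    Differentiable ℝ fun t : ℝ => (symmOfUpper (y + t • v)).det := by
  have h : ∀ i j, Differentiable ℝ fun t : ℝ => symmOfUpper (y + t • v) i j := by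
    intro i j
    have e : (fun t : ℝ => symmOfUpper (y + t • v) i j) = fun t =>
        symmOfUpper y i j + t * symmOfUpper v i j := rfl
    rw [e]
    fun_prop
  simp only [det_apply']
  fun_prop

theorem continuous_line {p : ℕ} (y v : UpperIdx p → ℝ) : Continuous fun t : ℝ => y + t • v :=
  continuous_const.add (continuous_id.smul continuous_const)

/-- At a point outside the open cone of positive definite matrices, a function supported on that
cone and bounded there by a high enough power of the determinant has zero line derivatives. -/
theorem hasDerivAt_zero_of_not_posDef {p : ℕ} {y : UpperIdx p → ℝ} (hy : y ∉ posDefCoords p)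
    (v : UpperIdx p → ℝ) {u R : (UpperIdx p → ℝ) → ℝ} {k : ℝ} (hk : 1 < k) (hR : Continuous R)
    (hu0 : ∀ z ∉ posDefCoords p, u z = 0)
    (hu : ∀ z ∈ posDefCoords p, |u z| ≤ (symmOfUpper z).det ^ k * R z) :
    HasDerivAt (fun t : ℝ => u (y + t • v)) 0 0 := by
  have e0 : y + (0 : ℝ) • v = y := by simp
  by_cases hps : (symmOfUpper y).PosSemidef
  -- At a boundary point the determinant vanishes and is `O(t)` along the line, and the surplus
  -- power `k - 1 > 0` makes `u` of order `o(t)`.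
  · have hdet : (symmOfUpper y).det = 0 := by
      by_contra h
      exact hy (hps.posDef_iff_det_ne_zero.2 h)
    refine hasDerivAt_zero_of_isLittleO (by simp [hu0 y hy]) ?_
    have h1 : (fun t : ℝ => (symmOfUpper (y + t • v)).det) =O[nhds 0] fun t : ℝ => t := by
      have h := (differentiable_det_line y v).differentiableAt (x := 0) |>.hasDerivAt.isBigO_sub
      simpa [e0, hdet] using h
    have h2 : (fun t : ℝ => |(symmOfUpper (y + t • v)).det| ^ (k - 1) * R (y + t • v)) =o[nhds 0]
        fun _ => (1 : ℝ) := by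
      rw [Asymptotics.isLittleO_one_iff]
      have hc : Continuous fun t : ℝ =>
          |(symmOfUpper (y + t • v)).det| ^ (k - 1) * R (y + t • v) := by
        refine Continuous.mul ?_ (hR.comp (continuous_line y v))
        exact (differentiable_det_line y v).continuous.abs.rpow_const
          fun _ => Or.inr (by linarith)
      have h := hc.tendsto 0
      rwa [e0, hdet, abs_zero, Real.zero_rpow (by linarith), zero_mul] at h
    have h3 := h1.mul_isLittleO h2
    simp only [mul_one] at h3
    refine Asymptotics.IsBigO.trans_isLittleO ?_ h3
    refine Asymptotics.IsBigO.of_bound 1 (Filter.Eventually.of_forall fun t => ?_)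
    rw [one_mul, Real.norm_eq_abs, Real.norm_eq_abs]
    by_cases hz : y + t • v ∈ posDefCoords p
    · have hd : 0 < (symmOfUpper (y + t • v)).det := PosDef.det_pos hz
      refine (hu _ hz).trans ((le_abs_self _).trans (le_of_eq ?_))
      congr 1
      rw [abs_of_pos hd, ← mul_assoc, ← Real.rpow_one_add' hd.le (by linarith)]
      congr 2; ring
    · rw [hu0 _ hz, abs_zero]; exact abs_nonneg _
  -- Away from the closed cone a negative direction persists nearby, so `u` vanishes along the line
  -- near `y`.
  · have hx : ∃ x, x ⬝ᵥ (symmOfUpper y *ᵥ x) < 0 := by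
      by_contra! h
      exact hps (posSemidef_iff_real.2 ⟨symmOfUpper_isSymm y, h⟩)
    obtain ⟨x, hx⟩ := hx
    have hc : Continuous fun t : ℝ => x ⬝ᵥ (symmOfUpper (y + t • v) *ᵥ x) :=
      continuous_const.dotProduct
        (((continuous_symmOfUpper p).comp (continuous_line y v)).matrix_mulVec continuous_const)
    have hev : ∀ᶠ t in nhds (0 : ℝ), x ⬝ᵥ (symmOfUpper (y + t • v) *ᵥ x) < 0 :=
      hc.continuousAt.eventually_lt continuousAt_const (by rwa [e0])
    refine (hasDerivAt_const (0 : ℝ) (0 : ℝ)).congr_of_eventuallyEq ?_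
    filter_upwards [hev] with t ht
    refine hu0 _ fun h => ?_
    have := (posSemidef_iff_real.1 (PosDef.posSemidef h)).2 x
    linarith

theorem abs_le_of_hasDerivAt {g g' : ℝ → ℝ} (hg : ∀ x, HasDerivAt g (g' x) x) {K : ℝ}
    (hK : ∀ x, |g' x| ≤ K) (x : ℝ) : |g x| ≤ |g 0| + K * |x| := by
  have h := Convex.norm_image_sub_le_of_norm_hasDerivWithin_le (s := Set.univ)
    (fun z _ => (hg z).hasDerivWithinAt) (fun z _ => hK z) convex_univ (Set.mem_univ 0)
    (Set.mem_univ x)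
  simp only [Real.norm_eq_abs, sub_zero] at h
  have := abs_sub_abs_le_abs_sub (g x) (g 0)
  linarith

/-- Integration by parts against the constant function `1`. -/
theorem integral_eq_zero_of_hasDerivAt_line {E : Type*} [NormedAddCommGroup E] [NormedSpace ℝ E]
    [MeasurableSpace E] [BorelSpace E] [FiniteDimensional ℝ E] {μ : Measure E}
    [μ.IsAddHaarMeasure] {u u' : E → ℝ} {v : E} (hu : Integrable u μ) (hu' : Integrable u' μ)
    (h : ∀ x, HasDerivAt (fun t : ℝ => u (x + t • v)) (u' x) 0) : ∫ x, u' x ∂μ = 0 := by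
  have h1 := integral_bilinear_hasLineDerivAt_right_eq_neg_left_of_integrable (μ := μ) (v := v)
    (f := fun _ => (1 : ℝ)) (f' := fun _ => 0) (g := u) (g' := u')
    (B := ContinuousLinearMap.mul ℝ ℝ) (by simp) (by simpa using hu') (by simpa using hu)
    (fun x _ => (hasFDerivAt_const (1 : ℝ) x).hasLineDerivAt v) (fun x _ => h x)
  simpa using h1

variable {p : ℕ} {A B : Matrix (Fin p) (Fin p) ℝ}

theorem measurable_trace_mul_inv (B : Matrix (Fin p) (Fin p) ℝ) :
    Measurable fun y : UpperIdx p → ℝ => (B * (symmOfUpper y)⁻¹).trace :=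
  (measurable_trace_mul_matrix B).comp (measurable_inv_matrix.comp (measurable_symmOfUpper p))

theorem measurable_trace_mul_mul (B : Matrix (Fin p) (Fin p) ℝ) :
    Measurable fun S : Matrix (Fin p) (Fin p) ℝ => (B * S * (B * S)).trace := by
  have h : Continuous fun S : Matrix (Fin p) (Fin p) ℝ => B * S :=
    continuous_const.matrix_mul continuous_id
  exact ((h.matrix_mul h).matrix_trace).measurable

theorem abs_quadratic_bound {c₁ c₂ a b₁ b₂ s K : ℝ} (hs : 0 ≤ s) (hK : 0 ≤ K) (hb₁ : 0 ≤ b₁)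
    (hc₁ : 0 ≤ c₁) (hc₂ : 0 ≤ c₂) (ha : 0 ≤ a) (hb₂ : 0 ≤ b₂) :
    (c₁ * (b₁ * s) + c₂) * (a + K * (b₁ * s)) + b₂ * s ^ 2 * K ≤
      ((c₁ * b₁ + c₂) * (a + K * b₁) + b₂ * K) * (1 + s) ^ 2 := by
  have h1 : c₁ * (b₁ * s) + c₂ ≤ (c₁ * b₁ + c₂) * (1 + s) := by
    have := mul_nonneg hc₁ hb₁; have := mul_nonneg hc₂ hs; nlinarith
  have h2 : a + K * (b₁ * s) ≤ (a + K * b₁) * (1 + s) := by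
    have := mul_nonneg hK hb₁; have := mul_nonneg ha hs; nlinarith
  have h3 : b₂ * s ^ 2 * K ≤ b₂ * K * (1 + s) ^ 2 := by
    have h := mul_nonneg hb₂ hK
    nlinarith [mul_nonneg h hs]
  have h4 : (c₁ * (b₁ * s) + c₂) * (a + K * (b₁ * s)) ≤
      (c₁ * b₁ + c₂) * (1 + s) * ((a + K * b₁) * (1 + s)) :=
    mul_le_mul h1 h2 (by positivity) (by positivity)
  nlinarith

theorem exists_abs_wishartLineDeriv_le {g g' : ℝ → ℝ} (k : ℝ)
    (hg : ∀ x, HasDerivAt g (g' x) x) {K : ℝ} (hK : ∀ x, |g' x| ≤ K) :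
    ∃ C, ∀ y ∈ posDefCoords p, |wishartLineDeriv A B k g g' y| ≤
      C * (1 + (symmOfUpper y)⁻¹.trace) ^ 2 := by
  have hK0 : 0 ≤ K := (abs_nonneg _).trans (hK 0)
  set β := ∑ i, ∑ j, |B i j|
  have hβ : 0 ≤ β := Finset.sum_nonneg fun _ _ => Finset.sum_nonneg fun _ _ => abs_nonneg _
  refine ⟨(|k| * β + |1 / 2 * (A * B).trace|) * (|g 0| + K * β) + β ^ 2 * K, fun y hy => ?_⟩
  have hi : ((symmOfUpper y)⁻¹).PosSemidef := (PosDef.inv hy).posSemidef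
  set s := (symmOfUpper y)⁻¹.trace
  have hs : 0 ≤ s := hi.trace_nonneg
  have h1 : |(B * (symmOfUpper y)⁻¹).trace| ≤ β * s := abs_trace_mul_le B hi
  have h2 : |(B * (symmOfUpper y)⁻¹ * (B * (symmOfUpper y)⁻¹)).trace| ≤ β ^ 2 * s ^ 2 :=
    abs_trace_mul_mul_le B hi
  have h3 := abs_le_of_hasDerivAt hg hK (B * (symmOfUpper y)⁻¹).trace
  have h4 : |k * (B * (symmOfUpper y)⁻¹).trace - 1 / 2 * (A * B).trace| ≤
      |k| * (β * s) + |1 / 2 * (A * B).trace| := by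
    refine (abs_sub _ _).trans ?_
    rw [abs_mul]
    gcongr
  rw [wishartLineDeriv]
  refine (abs_sub _ _).trans ?_
  rw [abs_mul, abs_mul]
  refine le_trans ?_ (abs_quadratic_bound hs hK0 hβ (abs_nonneg k)
    (abs_nonneg (1 / 2 * (A * B).trace)) (abs_nonneg (g 0)) (sq_nonneg β))
  refine add_le_add (mul_le_mul h4 (h3.trans ?_) (abs_nonneg _) (by positivity))
    (mul_le_mul h2 (hK _) (abs_nonneg _) (by positivity))
  gcongr

/-- Extended by zero, the density times `g` is differentiable along lines at every point, boundary
included, once `k > 2`. Its directional derivative therefore integrates to zero without a boundary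
term. -/
theorem integral_wishartLineDeriv (hA : A.PosDef) (hB : B.IsSymm) {k : ℝ} (hk : 2 < k)
    {g g' : ℝ → ℝ} (hg : ∀ x, HasDerivAt g (g' x) x) (hg' : Measurable g') {K : ℝ}
    (hK : ∀ x, |g' x| ≤ K) :
    ∫ y in posDefCoords p, wishartKernel A k y * wishartLineDeriv A B k g g' y = 0 := by
  have hK0 : 0 ≤ K := (abs_nonneg _).trans (hK 0)
  have hgm : Measurable g :=
    (continuous_iff_continuousAt.2 fun x => (hg x).continuousAt).measurable
  have hm := measurable_trace_mul_inv B
  have hm2 : Measurable fun y : UpperIdx p → ℝ =>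
      (B * (symmOfUpper y)⁻¹ * (B * (symmOfUpper y)⁻¹)).trace :=
    (measurable_trace_mul_mul B).comp (measurable_inv_matrix.comp (measurable_symmOfUpper p))
  set β := ∑ i, ∑ j, |B i j|
  have hβ : 0 ≤ β := Finset.sum_nonneg fun _ _ => Finset.sum_nonneg fun _ _ => abs_nonneg _
  set u : (UpperIdx p → ℝ) → ℝ := (posDefCoords p).indicator fun y =>
    wishartKernel A k y * g (B * (symmOfUpper y)⁻¹).trace with hu
  set u' : (UpperIdx p → ℝ) → ℝ := (posDefCoords p).indicator fun y =>
    wishartKernel A k y * wishartLineDeriv A B k g g' y with hu'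
  have hgle : ∀ y ∈ posDefCoords p, |g (B * (symmOfUpper y)⁻¹).trace| ≤
      |g 0| + K * |(B * (symmOfUpper y)⁻¹).trace| := fun y _ => abs_le_of_hasDerivAt hg hK _
  have hui : Integrable u := by
    rw [hu, integrable_indicator_iff (measurableSet_posDefCoords p)]
    refine integrableOn_wishartKernel_mul hA hk.le (K := |g 0| + K * β) (hgm.comp hm)
      fun y hy => (hgle y hy).trans ?_
    have hi : ((symmOfUpper y)⁻¹).PosSemidef := (PosDef.inv hy).posSemidef
    have hs := hi.trace_nonneg
    have h1 := abs_trace_mul_le B hi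
    calc |g 0| + K * |(B * (symmOfUpper y)⁻¹).trace|
        ≤ |g 0| + K * (β * (symmOfUpper y)⁻¹.trace) := by gcongr
      _ ≤ (|g 0| + K * β) * (1 + (symmOfUpper y)⁻¹.trace) ^ 2 := by
        have h2 : 0 ≤ |g 0| := abs_nonneg _
        have h3 : 0 ≤ K * β := mul_nonneg hK0 hβ
        nlinarith [mul_nonneg h2 hs, mul_nonneg h3 hs, mul_nonneg h2 (sq_nonneg _ :
          0 ≤ ((symmOfUpper y)⁻¹.trace) ^ 2), mul_nonneg h3 (sq_nonneg _ :
          0 ≤ ((symmOfUpper y)⁻¹.trace) ^ 2)]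
  have hui' : Integrable u' := by
    rw [hu', integrable_indicator_iff (measurableSet_posDefCoords p)]
    obtain ⟨C, hC⟩ := exists_abs_wishartLineDeriv_le (A := A) (B := B) k hg hK
    refine integrableOn_wishartKernel_mul hA hk.le (K := C) ?_ hC
    unfold wishartLineDeriv
    exact (((hm.const_mul _).sub_const _).mul (hgm.comp hm)).sub (hm2.mul (hg'.comp hm))
  rw [← integral_indicator (measurableSet_posDefCoords p), ← hu']
  refine integral_eq_zero_of_hasDerivAt_line (v := upperOf B) hui hui' fun y => ?_
  by_cases hy : y ∈ posDefCoords p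
  · have h := hasDerivAt_wishartKernel_mul (A := A) hB k hg hy
    rw [hu', Set.indicator_of_mem hy]
    refine h.congr_of_eventuallyEq ?_
    have hc : Filter.Tendsto (fun t : ℝ => y + t • upperOf B) (nhds 0) (nhds y) := by
      have := (continuous_line y (upperOf B)).tendsto 0
      simpa using this
    filter_upwards [hc ((isOpen_posDefCoords p).mem_nhds hy)] with t ht
    have ht' : y + t • upperOf B ∈ posDefCoords p := ht
    rw [hu, Set.indicator_of_mem ht']
  · rw [hu', Set.indicator_of_notMem hy]
    -- One factor of the determinant turns `Ω⁻¹` into the adjugate and makes `R` continuous; the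
    -- power `k - 1 > 1` that remains is enough.
    refine hasDerivAt_zero_of_not_posDef hy (upperOf B) (k := k - 1) (by linarith)
      (R := fun z => Real.exp (-(1 / 2) * (A * symmOfUpper z).trace) *
        (|g 0| * (symmOfUpper z).det + K * |(B * (symmOfUpper z).adjugate).trace|)) ?_
      (fun z hz => by rw [hu, Set.indicator_of_notMem hz]) fun z hz => ?_
    · have h1 := continuous_trace_mul_symmOfUpper A
      have h2 := (continuous_symmOfUpper p).matrix_det
      have h3 := (continuous_const (y := B)).matrix_mul
        (continuous_symmOfUpper p).matrix_adjugate |>.matrix_trace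
      fun_prop
    · have hd : 0 < (symmOfUpper z).det := PosDef.det_pos hz
      rw [hu, Set.indicator_of_mem hz, abs_mul, abs_of_pos (wishartKernel_pos A k hz)]
      refine (mul_le_mul_of_nonneg_left (hgle z hz) (wishartKernel_pos A k hz).le).trans
        (le_of_eq ?_)
      have h1 : (symmOfUpper z).det ^ k =
          (symmOfUpper z).det ^ (k - 1) * (symmOfUpper z).det := by
        rw [← Real.rpow_add_one hd.ne']; congr 1; ring
      have h2 : |(B * (symmOfUpper z).adjugate).trace| =
          (symmOfUpper z).det * |(B * (symmOfUpper z)⁻¹).trace| := by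
        rw [inv_def, Ring.inverse_eq_inv', Matrix.mul_smul, trace_smul, smul_eq_mul, abs_mul,
          abs_of_pos (inv_pos.2 hd), ← mul_assoc, mul_inv_cancel₀ hd.ne', one_mul]
      rw [wishartKernel, h1, h2]
      ring

theorem integrable_invWishart_of_le (hA : A.PosDef) {ν K : ℝ} (hν : (p : ℝ) + 5 ≤ ν)
    {F : Matrix (Fin p) (Fin p) ℝ → ℝ} (hF : Measurable F)
    (hle : ∀ S : Matrix (Fin p) (Fin p) ℝ, S.PosDef → |F S| ≤ K * (1 + S.trace) ^ 2) :
    Integrable F (invWishart A ν) := by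
  rw [integrable_invWishart_iff hA (by linarith) hF]
  exact integrableOn_wishartKernel_mul hA (by linarith)
    (hF.comp (measurable_inv_matrix.comp (measurable_symmOfUpper p)))
    fun y hy => hle _ (PosDef.inv hy)

/-- The Stein identity of the Inverse Wishart distribution. -/
theorem integral_invWishart_stein (hA : A.PosDef) (hB : B.IsSymm) {ν : ℝ} (hν : (p : ℝ) + 5 < ν)
    {g g' : ℝ → ℝ} (hg : ∀ x, HasDerivAt g (g' x) x) (hg' : Measurable g') {K : ℝ}
    (hK : ∀ x, |g' x| ≤ K) :
    ∫ S, (((ν - p - 1) * (B * S).trace - (A * B).trace) * g (B * S).trace -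
      2 * (B * S * (B * S)).trace * g' (B * S).trace) ∂invWishart A ν = 0 := by
  have hgm : Measurable g :=
    (continuous_iff_continuousAt.2 fun x => (hg x).continuousAt).measurable
  have hm := measurable_trace_mul_matrix B
  rw [integral_invWishart]
  -- With `k = (ν - p - 1)/2` the condition `k > 2` is `ν > p + 5`; the factor `2` clears the
  -- halves.
  · have h := integral_wishartLineDeriv hA hB (k := (ν - p - 1) / 2) (by linarith) hg hg' hK
    have h2 : ∀ y : UpperIdx p → ℝ, wishartKernel A ((ν - p - 1) / 2) y *
        (((ν - p - 1) * (B * (symmOfUpper y)⁻¹).trace - (A * B).trace) *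
          g (B * (symmOfUpper y)⁻¹).trace - 2 * (B * (symmOfUpper y)⁻¹ *
          (B * (symmOfUpper y)⁻¹)).trace * g' (B * (symmOfUpper y)⁻¹).trace) =
        2 * (wishartKernel A ((ν - p - 1) / 2) y *
          wishartLineDeriv A B ((ν - p - 1) / 2) g g' y) := by
      intro y; rw [wishartLineDeriv]; ring
    simp only [h2]
    rw [integral_const_mul, h, mul_zero, mul_zero]
  · exact (((hm.const_mul _).sub_const _).mul (hgm.comp hm)).sub
      (((measurable_trace_mul_mul B).const_mul _).mul (hg'.comp hm))

end InvWishartBvM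
end

noncomputable section

namespace InvWishartBvM

/-! ### Moments of quadratic forms under the Inverse Wishart distribution -/

theorem trace_vecMulVec_mul {p : ℕ} (v : Fin p → ℝ) (S : Matrix (Fin p) (Fin p) ℝ) :
    (vecMulVec v v * S).trace = v ⬝ᵥ (S *ᵥ v) := by
  rw [Matrix.trace_mul_comm, trace_mul_vecMulVec]

theorem trace_vecMulVec_mul_sq {p : ℕ} (v : Fin p → ℝ) (S : Matrix (Fin p) (Fin p) ℝ) :
    (vecMulVec v v * S * (vecMulVec v v * S)).trace = (v ⬝ᵥ (S *ᵥ v)) ^ 2 := by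
  rw [vecMulVec_mul, vecMulVec_mul_vecMulVec, vecMulVec_smul, trace_smul, trace_vecMulVec,
    smul_eq_mul, sq, dotProduct_comm v (v ᵥ* S), ← dotProduct_mulVec]

theorem isSymm_vecMulVec {p : ℕ} (v : Fin p → ℝ) : (vecMulVec v v).IsSymm := by
  ext i j; simp [vecMulVec_apply, mul_comm]

theorem measurable_quadForm {p : ℕ} (v : Fin p → ℝ) :
    Measurable fun S : Matrix (Fin p) (Fin p) ℝ => v ⬝ᵥ (S *ᵥ v) :=
  (continuous_const.dotProduct (continuous_id.matrix_mulVec continuous_const)).measurable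

theorem quadForm_le_trace {p : ℕ} (v : Fin p → ℝ) {S : Matrix (Fin p) (Fin p) ℝ}
    (hS : S.PosSemidef) : |v ⬝ᵥ (S *ᵥ v)| ≤
      (∑ i, ∑ j, |vecMulVec v v i j|) * (1 + S.trace) := by
  rw [← trace_vecMulVec_mul]
  refine (abs_trace_mul_le _ hS).trans (mul_le_mul_of_nonneg_left (by linarith) ?_)
  exact Finset.sum_nonneg fun _ _ => Finset.sum_nonneg fun _ _ => abs_nonneg _

variable {p : ℕ} {A : Matrix (Fin p) (Fin p) ℝ} {ν : ℝ}

theorem integrable_quadForm_sq (hA : A.PosDef) (hν : (p : ℝ) + 5 ≤ ν) (v : Fin p → ℝ) :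
    Integrable (fun S => (v ⬝ᵥ (S *ᵥ v)) ^ 2) (invWishart A ν) := by
  refine integrable_invWishart_of_le hA hν ((measurable_quadForm v).pow_const 2)
    (K := (∑ i, ∑ j, |vecMulVec v v i j|) ^ 2) fun S hS => ?_
  rw [abs_pow, ← mul_pow]
  exact pow_le_pow_left₀ (abs_nonneg _) (quadForm_le_trace v hS.posSemidef) 2

theorem integrable_quadForm (hA : A.PosDef) (hν : (p : ℝ) + 5 ≤ ν) (v : Fin p → ℝ) :
    Integrable (fun S => v ⬝ᵥ (S *ᵥ v)) (invWishart A ν) := by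
  refine integrable_invWishart_of_le hA hν (measurable_quadForm v)
    (K := (∑ i, ∑ j, |vecMulVec v v i j|)) fun S hS => ?_
  refine (quadForm_le_trace v hS.posSemidef).trans (mul_le_mul_of_nonneg_left ?_ ?_)
  · have := hS.posSemidef.trace_nonneg
    nlinarith
  · exact Finset.sum_nonneg fun _ _ => Finset.sum_nonneg fun _ _ => abs_nonneg _

/-- Stein identity with `B = v vᵀ` and `g = 1`. -/
theorem integral_quadForm (hA : A.PosDef) (hν : (p : ℝ) + 5 < ν) (v : Fin p → ℝ) :
    ∫ S, v ⬝ᵥ (S *ᵥ v) ∂invWishart A ν = v ⬝ᵥ (A *ᵥ v) / (ν - p - 1) := by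
  have := isProbabilityMeasure_invWishart hA (ν := ν) (by linarith)
  have h := integral_invWishart_stein hA (isSymm_vecMulVec v) hν (g := fun _ => 1)
    (g' := fun _ => 0) (fun x => hasDerivAt_const _ _) measurable_const (K := 0) (by simp)
  simp only [trace_vecMulVec_mul, trace_mul_vecMulVec, mul_one, mul_zero, sub_zero] at h
  rw [integral_sub ((integrable_quadForm hA hν.le v).const_mul _) (integrable_const _),
    integral_const_mul, integral_const, probReal_univ, one_smul] at h
  rw [eq_div_iff (by linarith)]
  linarith

/-- Stein identity with `g x = x`: for `B = v vᵀ` the factor `Tr(BSBS)` is again `(vᵀSv)²`, so the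
second moment solves a linear equation. -/
theorem integral_quadForm_sq (hA : A.PosDef) (hν : (p : ℝ) + 5 < ν) (v : Fin p → ℝ) :
    (ν - p - 3) * ∫ S, (v ⬝ᵥ (S *ᵥ v)) ^ 2 ∂invWishart A ν =
      (v ⬝ᵥ (A *ᵥ v)) ^ 2 / (ν - p - 1) := by
  have h := integral_invWishart_stein hA (isSymm_vecMulVec v) hν (g := fun x => x)
    (g' := fun _ => 1) (fun x => hasDerivAt_id _) measurable_const (K := 1) (by simp)
  simp only [trace_vecMulVec_mul, trace_mul_vecMulVec, trace_vecMulVec_mul_sq, mul_one] at h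
  have e : ∀ S : Matrix (Fin p) (Fin p) ℝ, ((ν - p - 1) * v ⬝ᵥ (S *ᵥ v) - v ⬝ᵥ (A *ᵥ v)) *
      v ⬝ᵥ (S *ᵥ v) - 2 * (v ⬝ᵥ (S *ᵥ v)) ^ 2 =
      (ν - p - 3) * (v ⬝ᵥ (S *ᵥ v)) ^ 2 - v ⬝ᵥ (A *ᵥ v) * v ⬝ᵥ (S *ᵥ v) := fun S => by ring
  simp only [e] at h
  rw [integral_sub ((integrable_quadForm_sq hA hν.le v).const_mul _)
    ((integrable_quadForm hA hν.le v).const_mul _), integral_const_mul, integral_const_mul,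
    integral_quadForm hA hν] at h
  rw [sub_eq_zero.1 h]; ring

theorem integral_quadForm_sub_sq (hA : A.PosDef) (hν : (p : ℝ) + 5 < ν) (v : Fin p → ℝ) (c : ℝ) :
    ∫ S, (v ⬝ᵥ (S *ᵥ v) - c) ^ 2 ∂invWishart A ν =
      2 * (v ⬝ᵥ (A *ᵥ v) / (ν - p - 1)) ^ 2 / (ν - p - 3) +
        (v ⬝ᵥ (A *ᵥ v) / (ν - p - 1) - c) ^ 2 := by
  have := isProbabilityMeasure_invWishart hA (ν := ν) (by linarith)
  have e : ∀ S : Matrix (Fin p) (Fin p) ℝ, (v ⬝ᵥ (S *ᵥ v) - c) ^ 2 =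
      ((v ⬝ᵥ (S *ᵥ v)) ^ 2 - 2 * c * v ⬝ᵥ (S *ᵥ v)) + c ^ 2 := fun S => by ring
  have h1 := (integrable_quadForm hA hν.le v).const_mul (2 * c)
  have h2 := integrable_quadForm_sq hA hν.le v
  have h3 := integral_quadForm_sq hA hν v
  have hm : ν - p - 1 ≠ 0 := by linarith
  have hm' : ν - p - 3 ≠ 0 := by linarith
  rw [mul_comm, ← eq_div_iff hm'] at h3
  simp only [e]
  have h12 : Integrable (fun S => (v ⬝ᵥ (S *ᵥ v)) ^ 2 - 2 * c * v ⬝ᵥ (S *ᵥ v))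
    (invWishart A ν) := h2.sub h1
  rw [integral_add h12 (integrable_const _), integral_sub h2 h1, integral_const_mul,
    integral_const, probReal_univ, one_smul, integral_quadForm hA hν, h3]
  field_simp
  ring

theorem integrable_quadForm_sub_sq (hA : A.PosDef) (hν : (p : ℝ) + 5 < ν) (v : Fin p → ℝ) (c : ℝ) :
    Integrable (fun S => (v ⬝ᵥ (S *ᵥ v) - c) ^ 2) (invWishart A ν) := by
  have := isProbabilityMeasure_invWishart hA (ν := ν) (by linarith)
  have e : ∀ S : Matrix (Fin p) (Fin p) ℝ, (v ⬝ᵥ (S *ᵥ v) - c) ^ 2 =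
      ((v ⬝ᵥ (S *ᵥ v)) ^ 2 - 2 * c * v ⬝ᵥ (S *ᵥ v)) + c ^ 2 := fun S => by ring
  simp only [e]
  exact ((integrable_quadForm_sq hA hν.le v).sub
    ((integrable_quadForm hA hν.le v).const_mul (2 * c))).add (integrable_const _)

/-- Uses `|z| ≤ s z²/2 + 1/(2s)` for the deviation `z` from the mean. The free parameter will be
`√n`, which balances a variance of order `1/n`. -/
theorem integral_abs_quadForm_sub_le (hA : A.PosDef) (hν : (p : ℝ) + 5 < ν) (v : Fin p → ℝ)
    (c : ℝ) {s : ℝ} (hs : 0 < s) :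
    ∫ S, |v ⬝ᵥ (S *ᵥ v) - c| ∂invWishart A ν ≤
      s * (v ⬝ᵥ (A *ᵥ v) / (ν - p - 1)) ^ 2 / (ν - p - 3) + 1 / (2 * s) +
        |v ⬝ᵥ (A *ᵥ v) / (ν - p - 1) - c| := by
  have := isProbabilityMeasure_invWishart hA (ν := ν) (by linarith)
  set μ := v ⬝ᵥ (A *ᵥ v) / (ν - p - 1) with hμ
  have h1 := (integrable_quadForm_sub_sq hA hν v μ).const_mul (s / 2)
  have h2 : ∫ S, |v ⬝ᵥ (S *ᵥ v) - c| ∂invWishart A ν ≤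
      ∫ S, (s / 2 * (v ⬝ᵥ (S *ᵥ v) - μ) ^ 2 + (1 / (2 * s) + |μ - c|)) ∂invWishart A ν := by
    refine integral_mono ((integrable_quadForm hA hν.le v).sub (integrable_const c)).abs
      (h1.add (integrable_const _)) fun S => ?_
    simp only
    have h3 : |v ⬝ᵥ (S *ᵥ v) - c| ≤ |v ⬝ᵥ (S *ᵥ v) - μ| + |μ - c| := abs_sub_le _ _ _
    have h4 : |v ⬝ᵥ (S *ᵥ v) - μ| ≤ s / 2 * (v ⬝ᵥ (S *ᵥ v) - μ) ^ 2 + 1 / (2 * s) := by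
      rw [← sq_abs]
      have h5 : s / 2 * |v ⬝ᵥ (S *ᵥ v) - μ| ^ 2 + 1 / (2 * s) - |v ⬝ᵥ (S *ᵥ v) - μ| =
          (s * |v ⬝ᵥ (S *ᵥ v) - μ| - 1) ^ 2 / (2 * s) := by field_simp; ring
      have h6 : 0 ≤ (s * |v ⬝ᵥ (S *ᵥ v) - μ| - 1) ^ 2 / (2 * s) := by positivity
      linarith
    linarith
  rw [integral_add h1 (integrable_const _), integral_const_mul, integral_quadForm_sub_sq hA hν v μ,
    integral_const, probReal_univ, one_smul, ← hμ] at h2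
  refine h2.trans (le_of_eq ?_)
  ring

/-! ### Stein's method for the standard normal distribution -/

theorem integrable_gauss_weight : Integrable fun t : ℝ => Real.exp (-t ^ 2 / 2) := by
  have h := integrable_exp_neg_mul_sq (b := 1 / 2) (by norm_num)
  refine h.congr (Filter.Eventually.of_forall fun t => ?_)
  simp only; congr 1; ring

theorem integral_gaussianReal_std (h : ℝ → ℝ) :
    ∫ x, h x ∂gaussianReal 0 1 = (√(2 * Real.pi))⁻¹ * ∫ x, h x * Real.exp (-x ^ 2 / 2) := by
  rw [integral_gaussianReal_eq_integral_smul (by norm_num), ← integral_const_mul]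
  refine integral_congr_ae (Filter.Eventually.of_forall fun x => ?_)
  simp only [gaussianPDFReal, smul_eq_mul, NNReal.coe_one, mul_one, sub_zero]
  ring

theorem tendsto_gauss_weight_atTop :
    Filter.Tendsto (fun t : ℝ => Real.exp (-t ^ 2 / 2)) Filter.atTop (nhds 0) := by
  refine Real.tendsto_exp_atBot.comp ?_
  have h : Filter.Tendsto (fun t : ℝ => t ^ 2 / 2) Filter.atTop Filter.atTop :=
    (Filter.tendsto_pow_atTop (by norm_num)).atTop_div_const (by norm_num)
  refine (Filter.tendsto_neg_atTop_atBot.comp h).congr fun t => ?_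
  simp only [Function.comp_apply]; ring

/-- On the tail `x ≤ t`, and `t exp(-t²/2)` has an explicit primitive. -/
theorem gauss_tail_le {x : ℝ} (hx : 0 ≤ x) :
    x * ∫ t in Set.Ioi x, Real.exp (-t ^ 2 / 2) ≤ Real.exp (-x ^ 2 / 2) := by
  have hd : ∀ t : ℝ, HasDerivAt (fun t : ℝ => -Real.exp (-t ^ 2 / 2))
      (t * Real.exp (-t ^ 2 / 2)) t := by
    intro t
    have h := (((hasDerivAt_pow 2 t).neg.div_const 2).exp).neg
    refine h.congr_deriv ?_
    simp; ring
  have hlim : Filter.Tendsto (fun t : ℝ => -Real.exp (-t ^ 2 / 2)) Filter.atTop (nhds 0) := by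
    simpa using tendsto_gauss_weight_atTop.neg
  have hint : IntegrableOn (fun t : ℝ => t * Real.exp (-t ^ 2 / 2)) (Set.Ioi x) :=
    integrableOn_Ioi_deriv_of_nonneg' (fun t _ => hd t)
      (fun t ht => mul_nonneg (hx.trans (le_of_lt ht)) (Real.exp_pos _).le) hlim
  have h1 : ∫ t in Set.Ioi x, t * Real.exp (-t ^ 2 / 2) = Real.exp (-x ^ 2 / 2) := by
    rw [integral_Ioi_of_hasDerivAt_of_tendsto' (fun t _ => hd t) hint hlim]
    simp
  rw [← h1, ← integral_const_mul]
  refine setIntegral_mono_on (integrable_gauss_weight.integrableOn.const_mul x) hint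
    measurableSet_Ioi fun t ht => ?_
  exact mul_le_mul_of_nonneg_right (le_of_lt ht) (Real.exp_pos _).le

theorem gauss_tail_le_Iic {x : ℝ} (hx : x ≤ 0) :
    -x * ∫ t in Set.Iic x, Real.exp (-t ^ 2 / 2) ≤ Real.exp (-x ^ 2 / 2) := by
  have h := gauss_tail_le (x := -x) (by linarith)
  rw [← integral_comp_neg_Iic x (fun t => Real.exp (-t ^ 2 / 2))] at h
  simpa using h

/-- Solutions of the Stein equation for continuous test functions with values in `[0, 1]`. -/
theorem exists_stein_solution {h : ℝ → ℝ} (hc : Continuous h) (h0 : ∀ x, 0 ≤ h x)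
    (h1 : ∀ x, h x ≤ 1) : ∃ f f' : ℝ → ℝ, (∀ x, HasDerivAt f (f' x) x) ∧ Measurable f' ∧
      (∀ x, |f' x| ≤ 2) ∧ ∀ x, f' x - x * f x = h x - ∫ y, h y ∂gaussianReal 0 1 := by
  set N := ∫ y, h y ∂gaussianReal 0 1 with hN
  have hint : Integrable h (gaussianReal 0 1) :=
    Integrable.of_bound hc.aestronglyMeasurable 1
      (Filter.Eventually.of_forall fun x => by
        rw [Real.norm_eq_abs, abs_of_nonneg (h0 x)]; exact h1 x)
  have hN0 : 0 ≤ N := integral_nonneg h0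
  have hN1 : N ≤ 1 := by
    have := integral_mono hint (integrable_const 1) h1
    simpa using this
  set c : ℝ → ℝ := fun t => h t - N with hcdef
  have hcc : Continuous c := hc.sub continuous_const
  have hc1 : ∀ t, |c t| ≤ 1 := fun t => by
    rw [abs_le]; constructor <;> simp only [hcdef] <;> linarith [h0 t, h1 t]
  set w : ℝ → ℝ := fun t => Real.exp (-t ^ 2 / 2) with hw
  have hwc : Continuous w := by fun_prop
  have hwpos : ∀ t, 0 < w t := fun t => Real.exp_pos _
  have hcw : Integrable fun t => c t * w t := by
    refine integrable_gauss_weight.mono' (hcc.mul hwc).aestronglyMeasurable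
      (Filter.Eventually.of_forall fun t => ?_)
    rw [Real.norm_eq_abs, abs_mul, abs_of_pos (hwpos t)]
    exact mul_le_of_le_one_left (hwpos t).le (hc1 t)
  have hz : ∫ t, c t * w t = 0 := by
    have h2 := integral_gaussianReal_std c
    have h3 : ∫ x, c x ∂gaussianReal 0 1 = 0 := by
      rw [hcdef, integral_sub hint (integrable_const _)]; simp [hN]
    rw [h3] at h2
    have h4 : (√(2 * Real.pi))⁻¹ ≠ 0 := by positivity
    exact (mul_eq_zero.1 h2.symm).resolve_left h4
  -- The solution is `f = I / w`, and `f' = x f + c`; bounding `f'` by `2` thus needs only `|x I| ≤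
  -- w`.
  set I : ℝ → ℝ := fun x => ∫ t in Set.Iic x, c t * w t with hI
  have hId : ∀ x, HasDerivAt I (c x * w x) x := by
    intro x
    have e : ∀ y, I y = I 0 + ∫ t in (0 : ℝ)..y, c t * w t := fun y => by
      rw [hI, intervalIntegral.integral_Iic_sub_Iic hcw.integrableOn hcw.integrableOn |>.symm]
      ring
    have h2 := (intervalIntegral.integral_hasDerivAt_right (a := 0) (b := x)
      (hcw.intervalIntegrable) ((hcc.mul hwc).stronglyMeasurableAtFilter _ _)
      (hcc.mul hwc).continuousAt).const_add (I 0)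
    exact h2.congr_of_eventuallyEq (Filter.Eventually.of_forall e)
  have hbound : ∀ x, |x * I x| ≤ w x := by
    intro x
    have habs : ∀ s : Set ℝ, |∫ t in s, c t * w t| ≤ ∫ t in s, w t := by
      intro s
      refine (abs_integral_le_integral_abs).trans ?_
      refine integral_mono hcw.abs.integrableOn integrable_gauss_weight.integrableOn fun t => ?_
      simp only [abs_mul, abs_of_pos (hwpos t)]
      exact mul_le_of_le_one_left (hwpos t).le (hc1 t)
    rw [abs_mul]
    -- Since `c w` has total integral zero, `I x` may be read off whichever tail lies on the far
    -- side of `x` from the origin.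
    rcases le_total 0 x with hx | hx
    · have h2 : I x = -∫ t in Set.Ioi x, c t * w t := by
        have := intervalIntegral.integral_Iic_add_Ioi (b := x) hcw.integrableOn hcw.integrableOn
        rw [hz] at this
        simp only [hI]; linarith
      rw [h2, abs_neg, abs_of_nonneg hx]
      exact (mul_le_mul_of_nonneg_left (habs _) hx).trans (gauss_tail_le hx)
    · rw [abs_of_nonpos hx]
      exact (mul_le_mul_of_nonneg_left (habs _) (by linarith)).trans (gauss_tail_le_Iic hx)
  have hww : ∀ x, (w x)⁻¹ * w x = 1 := fun x => inv_mul_cancel₀ (hwpos x).ne'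
  have hwd : ∀ x, HasDerivAt (fun x => (w x)⁻¹) (x * (w x)⁻¹) x := by
    intro x
    have h2 : HasDerivAt (fun x : ℝ => Real.exp (x ^ 2 / 2)) (Real.exp (x ^ 2 / 2) * x) x := by
      refine ((hasDerivAt_pow 2 x).div_const 2).exp.congr_deriv ?_
      simp
    have e : ∀ x, (w x)⁻¹ = Real.exp (x ^ 2 / 2) := fun x => by
      rw [hw, ← Real.exp_neg]; congr 1; ring
    simp only [e]
    exact h2.congr_deriv (mul_comm _ _)
  refine ⟨fun x => (w x)⁻¹ * I x, fun x => x * ((w x)⁻¹ * I x) + c x, fun x => ?_, ?_, fun x => ?_,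
    fun x => by simp only [hcdef]; ring⟩
  · refine ((hwd x).mul (hId x)).congr_deriv ?_
    linear_combination c x * hww x
  · have hIc : Continuous I := continuous_iff_continuousAt.2 fun x => (hId x).continuousAt
    have h2 : Measurable w := hwc.measurable
    have h3 : Measurable I := hIc.measurable
    have h4 : Measurable c := hcc.measurable
    exact (measurable_id.mul (h2.inv.mul h3)).add h4
  · have h2 : |x * ((w x)⁻¹ * I x)| ≤ 1 := by
      rw [mul_left_comm, abs_mul, abs_of_pos (inv_pos.2 (hwpos x)), ← hww x]
      exact mul_le_mul_of_nonneg_left (hbound x) (inv_pos.2 (hwpos x)).le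
    have := abs_add_le (x * ((w x)⁻¹ * I x)) (c x)
    linarith [hc1 x]

end InvWishartBvM
end

noncomputable section

namespace InvWishartBvM

/-! ### Kolmogorov distance to the normal distribution -/

/-- The standard normal density is at most `1`; this cruder constant saves carrying `1/√(2π)`. -/
theorem gaussianReal_real_Iic_add_le (t : ℝ) {ε : ℝ} (hε : 0 ≤ ε) :
    (gaussianReal 0 1).real (Set.Iic (t + ε)) ≤ (gaussianReal 0 1).real (Set.Iic t) + ε := by
  have hu : Set.Iic (t + ε) = Set.Iic t ∪ Set.Ioc t (t + ε) :=
    (Set.Iic_union_Ioc_eq_Iic (by linarith)).symm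
  have hI : (gaussianReal 0 1).real (Set.Ioc t (t + ε)) ≤ ε := by
    rw [measureReal_def, gaussianReal_apply 0 (by norm_num)]
    have h1 : ∫⁻ x in Set.Ioc t (t + ε), gaussianPDF 0 1 x ≤ ENNReal.ofReal ε := by
      calc ∫⁻ x in Set.Ioc t (t + ε), gaussianPDF 0 1 x
          ≤ ∫⁻ x in Set.Ioc t (t + ε), 1 := by
            refine lintegral_mono fun x => ?_
            rw [gaussianPDF, ← ENNReal.ofReal_one]
            refine ENNReal.ofReal_le_ofReal ?_
            rw [gaussianPDFReal]
            refine mul_le_one₀ (inv_le_one_of_one_le₀ ?_) (Real.exp_pos _).le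
              (Real.exp_le_one_iff.2 ?_)
            · rw [Real.one_le_sqrt]
              simp only [NNReal.coe_one]
              nlinarith [Real.pi_gt_three]
            · exact div_nonpos_of_nonpos_of_nonneg (by nlinarith [sq_nonneg (x - 0)]) (by simp)
        _ = ENNReal.ofReal ε := by simp
    exact ENNReal.toReal_le_of_le_ofReal hε h1
  rw [hu]
  exact (measureReal_union_le _ _).trans (by linarith)

/-- Continuous ramps of width `ε` enclose the indicator of a half-line. Since the bound `η` does not
depend on the slope of the ramp, `ε` tends to zero at no cost. -/
theorem abs_measureReal_sub_le_of_test {E : Type*} [MeasurableSpace E] {P : Measure E}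
    [IsProbabilityMeasure P] {F : E → ℝ} (hF : Measurable F) {η : ℝ}
    (h : ∀ u : ℝ → ℝ, Continuous u → (∀ x, 0 ≤ u x) → (∀ x, u x ≤ 1) →
      |∫ S, u (F S) ∂P - ∫ x, u x ∂gaussianReal 0 1| ≤ η) (t : ℝ) :
    |P.real {S | F S ≤ t} - (gaussianReal 0 1).real (Set.Iic t)| ≤ η := by
  have key : ∀ ε > 0, ∀ s : ℝ, ∃ u : ℝ → ℝ, Continuous u ∧ (∀ x, 0 ≤ u x) ∧ (∀ x, u x ≤ 1) ∧
      (∀ x ≤ s, u x = 1) ∧ (∀ x, s + ε < x → u x = 0) := by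
    intro ε hε s
    refine ⟨fun x => max 0 (min 1 ((s + ε - x) / ε)), by fun_prop, fun x => le_max_left _ _,
      fun x => max_le zero_le_one (min_le_left _ _), fun x hx => ?_, fun x hx => ?_⟩
    · have h1 : 1 ≤ (s + ε - x) / ε := by rw [le_div_iff₀ hε]; linarith
      simp [min_eq_left h1]
    · have h1 : (s + ε - x) / ε < 0 := div_neg_of_neg_of_pos (by linarith) hε
      exact max_eq_left ((min_le_right _ _).trans h1.le)
  have hlow : ∀ (Q : Measure ℝ) [IsProbabilityMeasure Q] (u : ℝ → ℝ) (s : ℝ), Continuous u →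
      (∀ x, 0 ≤ u x) → (∀ x, u x ≤ 1) → (∀ x ≤ s, u x = 1) → Q.real (Set.Iic s) ≤ ∫ x, u x ∂Q := by
    intro Q _ u s hc h0 h1 hs
    rw [← integral_indicator_one measurableSet_Iic]
    refine integral_mono ((integrable_const 1).indicator measurableSet_Iic)
      (Integrable.of_bound hc.aestronglyMeasurable 1 (Filter.Eventually.of_forall fun x => by
        rw [Real.norm_eq_abs, abs_of_nonneg (h0 x)]; exact h1 x)) fun x => ?_
    by_cases hx : x ∈ Set.Iic s
    · rw [Set.indicator_of_mem hx, hs x hx]; rfl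
    · rw [Set.indicator_of_notMem hx]; exact h0 x
  have hupp : ∀ (Q : Measure ℝ) [IsProbabilityMeasure Q] (u : ℝ → ℝ) (s : ℝ), Continuous u →
      (∀ x, 0 ≤ u x) → (∀ x, u x ≤ 1) → (∀ x, s < x → u x = 0) →
      ∫ x, u x ∂Q ≤ Q.real (Set.Iic s) := by
    intro Q _ u s hc h0 h1 hs
    rw [← integral_indicator_one measurableSet_Iic]
    refine integral_mono (Integrable.of_bound hc.aestronglyMeasurable 1
      (Filter.Eventually.of_forall fun x => by
        rw [Real.norm_eq_abs, abs_of_nonneg (h0 x)]; exact h1 x))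
      ((integrable_const 1).indicator measurableSet_Iic) fun x => ?_
    by_cases hx : x ∈ Set.Iic s
    · rw [Set.indicator_of_mem hx]; exact h1 x
    · rw [Set.indicator_of_notMem hx, hs x (not_le.1 hx)]
  have : IsProbabilityMeasure (P.map F) := Measure.isProbabilityMeasure_map hF.aemeasurable
  have hmap : ∀ s, P.real {S | F S ≤ s} = (P.map F).real (Set.Iic s) := fun s => by
    rw [measureReal_def, measureReal_def, Measure.map_apply hF measurableSet_Iic]; rfl
  have hint : ∀ u : ℝ → ℝ, Continuous u → ∫ S, u (F S) ∂P = ∫ x, u x ∂(P.map F) := fun u hu =>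
    (integral_map hF.aemeasurable hu.aestronglyMeasurable).symm
  refine le_of_forall_pos_le_add fun ε hε => ?_
  rw [hmap, abs_le]
  constructor
  · obtain ⟨u, hc, h0, h1, hs, hs'⟩ := key ε hε (t - ε)
    have e1 := (abs_le.1 (h u hc h0 h1)).1
    rw [hint u hc] at e1
    have e2 := hupp (P.map F) u t hc h0 h1 (fun x hx => hs' x (by linarith))
    have e3 := hlow (gaussianReal 0 1) u (t - ε) hc h0 h1 hs
    have e4 := gaussianReal_real_Iic_add_le (t - ε) hε.le
    rw [sub_add_cancel] at e4
    linarith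
  · obtain ⟨u, hc, h0, h1, hs, hs'⟩ := key ε hε t
    have e1 := (abs_le.1 (h u hc h0 h1)).2
    rw [hint u hc] at e1
    have e2 := hupp (gaussianReal 0 1) u (t + ε) hc h0 h1 hs'
    have e3 := hlow (P.map F) u t hc h0 h1 hs
    have e4 := gaussianReal_real_Iic_add_le t hε.le
    linarith

theorem gaussianReal_real_Iic {σ : ℝ} (hσ : 0 < σ) (x : ℝ) :
    (gaussianReal 0 (σ ^ 2).toNNReal).real (Set.Iic x) =
      (gaussianReal 0 1).real (Set.Iic (x / σ)) := by
  have h := gaussianReal_map_const_mul (μ := 0) (v := 1) σ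
  have h2 : NNReal.mk (σ ^ 2) (sq_nonneg _) = (σ ^ 2).toNNReal :=
    (Real.toNNReal_of_nonneg (sq_nonneg σ)).symm
  rw [mul_zero, mul_one, h2] at h
  rw [← h, measureReal_def, measureReal_def, Measure.map_apply (by fun_prop) measurableSet_Iic]
  congr 2
  ext y
  simp only [Set.mem_preimage, Set.mem_Iic]
  rw [le_div_iff₀ hσ, mul_comm]

/-- Off `N`, the sublevel sets of `R` lie between those of `σF` shifted by `±Δ`, and a shift by
`Δ/σ` changes the normal distribution function by at most `Δ/σ`. -/
theorem kolmogorovDist_le_of_approx {E : Type*} [MeasurableSpace E] {P : Measure E}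
    [IsProbabilityMeasure P] {F R : E → ℝ} (hR : Measurable R) {η δ Δ σ : ℝ} {N : Set E}
    (hσ : 0 < σ) (hΔ : 0 ≤ Δ) (hN : P.real N ≤ δ)
    (hF : ∀ t, |P.real {S | F S ≤ t} - (gaussianReal 0 1).real (Set.Iic t)| ≤ η)
    (h : ∀ S ∉ N, |R S - σ * F S| ≤ Δ) :
    kolmogorovDist (P.map R) (gaussianReal 0 (σ ^ 2).toNNReal) ≤ η + δ + Δ / σ := by
  refine ciSup_le fun x => ?_
  rw [gaussianReal_real_Iic hσ, measureReal_def, Measure.map_apply hR measurableSet_Iic,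
    ← measureReal_def, abs_le]
  have hd : 0 ≤ Δ / σ := by positivity
  constructor
  · have h1 := (abs_le.1 (hF ((x - Δ) / σ))).1
    have h2 : P.real {S | F S ≤ (x - Δ) / σ} ≤ P.real (R ⁻¹' Set.Iic x) + P.real N := by
      refine (measureReal_mono (fun S hS => ?_)).trans (measureReal_union_le _ _)
      by_cases hSN : S ∈ N
      · exact Or.inr hSN
      · left
        have h3 := (abs_le.1 (h S hSN)).2
        have h4 : F S * σ ≤ x - Δ := (le_div_iff₀ hσ).1 hS
        simp only [Set.mem_preimage, Set.mem_Iic]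
        linarith
    have h5 := gaussianReal_real_Iic_add_le ((x - Δ) / σ) hd
    rw [← add_div, sub_add_cancel] at h5
    linarith
  · have h1 := (abs_le.1 (hF ((x + Δ) / σ))).2
    have h2 : P.real (R ⁻¹' Set.Iic x) ≤ P.real {S | F S ≤ (x + Δ) / σ} + P.real N := by
      refine (measureReal_mono (fun S hS => ?_)).trans (measureReal_union_le _ _)
      by_cases hSN : S ∈ N
      · exact Or.inr hSN
      · left
        have h3 := (abs_le.1 (h S hSN)).1
        have h4 : R S ≤ x := hS
        refine (le_div_iff₀ hσ).2 ?_
        linarith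
    have h5 := gaussianReal_real_Iic_add_le (x / σ) hd
    rw [← add_div] at h5
    linarith

theorem kolmogorovDist_le_one (m₁ m₂ : Measure ℝ) [IsProbabilityMeasure m₁]
    [IsProbabilityMeasure m₂] : kolmogorovDist m₁ m₂ ≤ 1 := by
  refine ciSup_le fun x => ?_
  have h1 : m₁.real (Set.Iic x) ≤ 1 := measureReal_le_one
  have h2 : m₂.real (Set.Iic x) ≤ 1 := measureReal_le_one
  have h3 : 0 ≤ m₁.real (Set.Iic x) := measureReal_nonneg
  have h4 : 0 ≤ m₂.real (Set.Iic x) := measureReal_nonneg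
  rw [abs_le]; constructor <;> linarith

/-! ### Normal approximation of linear functionals -/

variable {p : ℕ} {A B : Matrix (Fin p) (Fin p) ℝ} {ν : ℝ}

theorem integrable_trace_mul_mul (hA : A.PosDef) (hν : (p : ℝ) + 5 ≤ ν)
    (B : Matrix (Fin p) (Fin p) ℝ) :
    Integrable (fun S => (B * S * (B * S)).trace) (invWishart A ν) := by
  refine integrable_invWishart_of_le hA hν (measurable_trace_mul_mul B)
    (K := (∑ i, ∑ j, |B i j|) ^ 2) fun S hS => ?_
  refine (abs_trace_mul_mul_le B hS.posSemidef).trans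
    (mul_le_mul_of_nonneg_left ?_ (sq_nonneg _))
  have := hS.posSemidef.trace_nonneg
  nlinarith

/-- The total variation type bound of Stein's method for a linear functional of an Inverse Wishart
matrix. -/
theorem abs_measureReal_linear_sub_gaussian_le (hA : A.PosDef) (hB : B.IsSymm)
    (hν : (p : ℝ) + 5 < ν) {s : ℝ} (hs : 0 < s) (t : ℝ) :
    |(invWishart A ν).real {S | s * ((B * S).trace - (A * B).trace / (ν - p - 1)) ≤ t} -
      (gaussianReal 0 1).real (Set.Iic t)| ≤
    2 * ∫ S, |1 - 2 * s ^ 2 / (ν - p - 1) * (B * S * (B * S)).trace| ∂invWishart A ν := by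
  have := isProbabilityMeasure_invWishart hA (ν := ν) (by linarith)
  set m := ν - p - 1 with hm
  have hm0 : 0 < m := by linarith
  set y₀ := (A * B).trace / m with hy₀
  have hFm : Measurable fun S : Matrix (Fin p) (Fin p) ℝ => s * ((B * S).trace - y₀) :=
    ((measurable_trace_mul_matrix B).sub_const _).const_mul _
  have hτm := measurable_trace_mul_mul B
  have hτi := integrable_trace_mul_mul hA hν.le B
  refine abs_measureReal_sub_le_of_test hFm (fun h hc h0 h1 => ?_) t
  obtain ⟨f, f', hf, hf'm, hf'2, hst⟩ := exists_stein_solution hc h0 h1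
  have hfm : Measurable f := (continuous_iff_continuousAt.2 fun x => (hf x).continuousAt).measurable
  have hg : ∀ x, HasDerivAt (fun y => f (s * (y - y₀))) (s * f' (s * (x - y₀))) x := fun x => by
    have h2 := (hf (s * (x - y₀))).comp x (((hasDerivAt_id x).sub_const y₀).const_mul s)
    refine h2.congr_deriv ?_
    ring
  have hid := integral_invWishart_stein hA hB hν hg
    (g' := fun x => s * f' (s * (x - y₀)))
    ((hf'm.comp ((measurable_id.sub_const _).const_mul _)).const_mul _) (K := s * 2)
    (fun x => by rw [abs_mul, abs_of_pos hs]; exact mul_le_mul_of_nonneg_left (hf'2 _) hs.le)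
  have hhi : Integrable (fun S => h (s * ((B * S).trace - y₀))) (invWishart A ν) :=
    Integrable.of_bound (hc.measurable.comp hFm).aestronglyMeasurable 1
      (Filter.Eventually.of_forall fun x => by
        rw [Real.norm_eq_abs, abs_of_nonneg (h0 _)]; exact h1 _)
  have hf'i : Integrable (fun S => f' (s * ((B * S).trace - y₀)) *
      (1 - 2 * s ^ 2 / m * (B * S * (B * S)).trace)) (invWishart A ν) :=
    ((integrable_const 1).sub (hτi.const_mul _)).bdd_mul (hf'm.comp hFm).aestronglyMeasurable
      (c := 2) (Filter.Eventually.of_forall fun S => hf'2 _)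
  -- The Stein equation at `s(Tr(BS) - y₀)`, with `x f` exchanged for `s/m` times the integrand of
  -- the Stein identity, whose integral vanishes.
  have hpt : ∀ S : Matrix (Fin p) (Fin p) ℝ,
      h (s * ((B * S).trace - y₀)) - ∫ y, h y ∂gaussianReal 0 1 =
      f' (s * ((B * S).trace - y₀)) * (1 - 2 * s ^ 2 / m * (B * S * (B * S)).trace) -
      s / m * ((m * (B * S).trace - (A * B).trace) * f (s * ((B * S).trace - y₀)) -
        2 * (B * S * (B * S)).trace * (s * f' (s * ((B * S).trace - y₀)))) := by
    intro S
    rw [← hst]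
    have e : (A * B).trace = m * y₀ := by rw [hy₀]; field_simp
    rw [e]
    field_simp
    ring
  have hmain : ∫ S, h (s * ((B * S).trace - y₀)) ∂invWishart A ν - ∫ y, h y ∂gaussianReal 0 1 =
      ∫ S, f' (s * ((B * S).trace - y₀)) *
        (1 - 2 * s ^ 2 / m * (B * S * (B * S)).trace) ∂invWishart A ν := by
    have e1 : ∫ S, h (s * ((B * S).trace - y₀)) ∂invWishart A ν - ∫ y, h y ∂gaussianReal 0 1 =
        ∫ S, (h (s * ((B * S).trace - y₀)) - ∫ y, h y ∂gaussianReal 0 1) ∂invWishart A ν := by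
      rw [integral_sub hhi (integrable_const _)]; simp
    have e2 : ∀ S : Matrix (Fin p) (Fin p) ℝ,
        s / m * ((m * (B * S).trace - (A * B).trace) * f (s * ((B * S).trace - y₀)) -
          2 * (B * S * (B * S)).trace * (s * f' (s * ((B * S).trace - y₀)))) =
        f' (s * ((B * S).trace - y₀)) * (1 - 2 * s ^ 2 / m * (B * S * (B * S)).trace) -
          (h (s * ((B * S).trace - y₀)) - ∫ y, h y ∂gaussianReal 0 1) := fun S => by
      rw [hpt S]; ring
    have e3 : ∫ S, s / m * ((m * (B * S).trace - (A * B).trace) *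
        f (s * ((B * S).trace - y₀)) - 2 * (B * S * (B * S)).trace *
          (s * f' (s * ((B * S).trace - y₀)))) ∂invWishart A ν = 0 := by
      rw [integral_const_mul]
      exact (congrArg (fun x => s / m * x) hid).trans (mul_zero _)
    simp only [e2] at e3
    have hhi2 : Integrable (fun S => h (s * ((B * S).trace - y₀)) -
        ∫ y, h y ∂gaussianReal 0 1) (invWishart A ν) := hhi.sub (integrable_const _)
    rw [integral_sub hf'i hhi2] at e3
    rw [e1]
    linarith
  rw [hmain, ← integral_const_mul]
  refine abs_integral_le_integral_abs.trans (integral_mono hf'i.abs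
    (((integrable_const 1).sub (hτi.const_mul _)).abs.const_mul 2) fun S => ?_)
  simp only [abs_mul]
  exact mul_le_mul_of_nonneg_right (hf'2 _) (abs_nonneg _)

end InvWishartBvM
end

noncomputable section

namespace InvWishartBvM

/-! ### Concentration of the sample covariance -/

theorem integral_exp_sq_sub_one {t : ℝ} (ht : t < 1 / 2) :
    ∫ x, Real.exp (t * (x ^ 2 - 1)) ∂gaussianReal 0 1 =
      Real.exp (-t) * √(1 / (1 - 2 * t)) := by
  rw [integral_gaussianReal_std]
  have e : ∀ x : ℝ, Real.exp (t * (x ^ 2 - 1)) * Real.exp (-x ^ 2 / 2) =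
      Real.exp (-t) * Real.exp (-(1 / 2 - t) * x ^ 2) := fun x => by
    rw [← Real.exp_add, ← Real.exp_add]; congr 1; ring
  simp only [e]
  rw [integral_const_mul, integral_gaussian, mul_left_comm, ← Real.sqrt_inv,
    ← Real.sqrt_mul (by positivity)]
  congr 2
  have h1 : 1 / 2 - t ≠ 0 := by linarith
  have h2 : 1 - 2 * t ≠ 0 := by linarith
  field_simp

/-- From `-log(1 - 2t) ≤ 2t + 8t²` for `|t| ≤ 1/4`: the linear term cancels, so centered squares of
normals are sub-Gaussian in this range. -/
theorem exp_mul_sqrt_le {t : ℝ} (ht : |t| ≤ 1 / 4) :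
    Real.exp (-t) * √(1 / (1 - 2 * t)) ≤ Real.exp (4 * t ^ 2) := by
  obtain ⟨h1, h2⟩ := abs_le.1 ht
  have hpos : 0 < 1 - 2 * t := by linarith
  have hx : |2 * t| ≤ 1 / 2 := by rw [abs_mul, abs_two]; linarith
  have hlog := Real.abs_log_sub_add_sum_range_le (x := 2 * t) (by linarith) 1
  simp only [Finset.range_one, Finset.sum_singleton, zero_add, pow_one, Nat.cast_zero, div_one,
    one_add_one_eq_two, sq_abs] at hlog
  have h3 : (2 * t) ^ 2 / (1 - |2 * t|) ≤ 8 * t ^ 2 := by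
    rw [div_le_iff₀ (by linarith)]
    nlinarith [sq_nonneg t]
  have h4 : -Real.log (1 - 2 * t) ≤ 2 * t + 8 * t ^ 2 := by
    have := (abs_le.1 hlog).1
    linarith
  have h5 : 1 / (1 - 2 * t) ≤ Real.exp (t + 4 * t ^ 2) ^ 2 := by
    rw [← Real.exp_nat_mul, one_div, ← Real.exp_log hpos, ← Real.exp_neg]
    refine Real.exp_le_exp.2 (h4.trans (le_of_eq ?_))
    push_cast; ring
  calc Real.exp (-t) * √(1 / (1 - 2 * t)) ≤ Real.exp (-t) * Real.exp (t + 4 * t ^ 2) :=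
        mul_le_mul_of_nonneg_left (Real.sqrt_le_iff.2 ⟨(Real.exp_pos _).le, h5⟩)
          (Real.exp_pos _).le
    _ = _ := by rw [← Real.exp_add]; congr 1; ring

theorem map_dotProduct_multivariateGaussian {p : ℕ} {S : Matrix (Fin p) (Fin p) ℝ}
    (hS : S.PosSemidef) (v : Fin p → ℝ) :
    (multivariateGaussian 0 S).map (fun x : EuclideanSpace ℝ (Fin p) => v ⬝ᵥ x.ofLp) =
      gaussianReal 0 (v ⬝ᵥ (S *ᵥ v)).toNNReal := by
  have hL : (fun x : EuclideanSpace ℝ (Fin p) => v ⬝ᵥ x.ofLp) =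
      innerSL ℝ (WithLp.toLp 2 v) := by
    funext x
    simp [PiLp.inner_apply, dotProduct, mul_comm]
  rw [hL, IsGaussian.map_eq_gaussianReal]
  have hmean : ∫ x, (innerSL ℝ (WithLp.toLp 2 v)) x ∂(multivariateGaussian 0 S) = 0 := by
    rw [ContinuousLinearMap.integral_comp_id_comm IsGaussian.integrable_id,
      integral_id_multivariateGaussian, map_zero]
  have hvar : Var[innerSL ℝ (WithLp.toLp 2 v); multivariateGaussian 0 S] =
      v ⬝ᵥ (S *ᵥ v) := by
    have h := covarianceBilin_self (μ := multivariateGaussian 0 S) IsGaussian.memLp_two_id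
      (WithLp.toLp 2 v)
    rw [covarianceBilin_multivariateGaussian hS] at h
    exact h.symm
  rw [hmean, hvar]

theorem quadForm_sampleCov {n p : ℕ} (x : Fin n → EuclideanSpace ℝ (Fin p)) (v : Fin p → ℝ) :
    v ⬝ᵥ (sampleCov x *ᵥ v) = (n : ℝ)⁻¹ * ∑ i, (v ⬝ᵥ (x i).ofLp) ^ 2 := by
  rw [sampleCov, smul_mulVec, dotProduct_smul, sum_mulVec, dotProduct_sum, smul_eq_mul]
  congr 1
  refine Finset.sum_congr rfl fun i _ => ?_
  rw [← trace_vecMulVec_mul, vecMulVec_mul_vecMulVec, vecMulVec_smul, trace_smul, trace_vecMulVec,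
    smul_eq_mul, sq]

/-- The normalized fluctuation `√n |vᵀ(Σ̂ - Σ*)v|` of the sample covariance in a direction `v` with
`vᵀΣ*v = 1`. -/
def fluct {n p : ℕ} (x : Fin n → EuclideanSpace ℝ (Fin p)) (v : Fin p → ℝ) : ℝ :=
  √n * |v ⬝ᵥ (sampleCov x *ᵥ v) - 1|

theorem fluct_nonneg {n p : ℕ} (x : Fin n → EuclideanSpace ℝ (Fin p)) (v : Fin p → ℝ) :
    0 ≤ fluct x v := mul_nonneg (Real.sqrt_nonneg _) (abs_nonneg _)

variable {n p : ℕ} {S₀ : Matrix (Fin p) (Fin p) ℝ} {Ω : Type*} [MeasurableSpace Ω]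
  {P : Measure Ω} {X : Fin n → Ω → EuclideanSpace ℝ (Fin p)}

theorem aemeasurable_dotProduct (hX : ∀ i, HasLaw (X i) (multivariateGaussian 0 S₀) P)
    (v : Fin p → ℝ) (i : Fin n) : AEMeasurable (fun ω => v ⬝ᵥ (X i ω).ofLp) P := by
  have h : Measurable fun x : EuclideanSpace ℝ (Fin p) => v ⬝ᵥ x.ofLp := by
    have : Continuous fun x : EuclideanSpace ℝ (Fin p) => v ⬝ᵥ x.ofLp :=
      continuous_const.dotProduct (PiLp.continuous_ofLp 2 _)
    exact this.measurable
  exact h.comp_aemeasurable (hX i).aemeasurable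

theorem aemeasurable_fluct (hX : ∀ i, HasLaw (X i) (multivariateGaussian 0 S₀) P)
    (v : Fin p → ℝ) : AEMeasurable (fun ω => fluct (fun i => X i ω) v) P := by
  have h := fun i => aemeasurable_dotProduct hX v i
  simp only [fluct, quadForm_sampleCov]
  have h2 : AEMeasurable (fun ω => ∑ i, (v ⬝ᵥ (X i ω).ofLp) ^ 2) P :=
    Finset.aemeasurable_fun_sum _ fun i _ => (h i).pow_const 2
  have h3 := ((h2.const_mul (n : ℝ)⁻¹).sub_const 1)
  exact (measurable_norm.comp_aemeasurable h3).const_mul _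

theorem integral_exp_sum_le (hS₀ : S₀.PosSemidef)
    (hX : ∀ i, HasLaw (X i) (multivariateGaussian 0 S₀) P) (hind : iIndepFun X P)
    {v : Fin p → ℝ} (hv : v ⬝ᵥ (S₀ *ᵥ v) = 1) {t : ℝ} (ht : |t| ≤ 1 / 4) :
    Integrable (fun ω => Real.exp (t * ∑ i, ((v ⬝ᵥ (X i ω).ofLp) ^ 2 - 1))) P ∧
    ∫ ω, Real.exp (t * ∑ i, ((v ⬝ᵥ (X i ω).ofLp) ^ 2 - 1)) ∂P ≤ Real.exp (4 * n * t ^ 2) := by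
  have hdm : Measurable fun x : EuclideanSpace ℝ (Fin p) => v ⬝ᵥ x.ofLp := by
    have : Continuous fun x : EuclideanSpace ℝ (Fin p) => v ⬝ᵥ x.ofLp :=
      continuous_const.dotProduct (PiLp.continuous_ofLp 2 _)
    exact this.measurable
  set U : Fin n → Ω → ℝ := fun i ω => (v ⬝ᵥ (X i ω).ofLp) ^ 2 - 1 with hU
  have hUind : iIndepFun U P :=
    hind.comp (fun _ x => (v ⬝ᵥ x.ofLp) ^ 2 - 1) fun _ => (hdm.pow_const 2).sub_const 1
  have hUm : ∀ i, AEMeasurable (U i) P := fun i =>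
    ((aemeasurable_dotProduct hX v i).pow_const 2).sub_const 1
  have hlt : t < 1 / 2 := by linarith [(abs_le.1 ht).2]
  have hmgf : ∀ i, mgf (U i) P t = Real.exp (-t) * √(1 / (1 - 2 * t)) := by
    intro i
    have hmap : P.map (fun ω => v ⬝ᵥ (X i ω).ofLp) = gaussianReal 0 1 := by
      have h := map_dotProduct_multivariateGaussian hS₀ v
      rw [hv, Real.toNNReal_one, ← (hX i).map_eq,
        AEMeasurable.map_map_of_aemeasurable hdm.aemeasurable (hX i).aemeasurable] at h
      exact h
    rw [← integral_exp_sq_sub_one hlt, ← hmap,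
      integral_map (aemeasurable_dotProduct hX v i) (by fun_prop)]
    rfl
  have hsum := hUind.mgf_sum₀ (t := t) hUm Finset.univ
  simp only [hmgf, Finset.prod_const, Finset.card_univ, Fintype.card_fin] at hsum
  have e : ∫ ω, Real.exp (t * ∑ i, ((v ⬝ᵥ (X i ω).ofLp) ^ 2 - 1)) ∂P =
      (Real.exp (-t) * √(1 / (1 - 2 * t))) ^ n := by
    rw [← hsum, mgf]
    simp only [Finset.sum_apply, hU]
  have hpos : 0 < 1 / (1 - 2 * t) := by
    have : 0 < 1 - 2 * t := by linarith
    positivity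
  refine ⟨?_, ?_⟩
  -- A non-integrable function would have integral zero, whereas the product of the moment
  -- generating functions is positive.
  · by_contra hni
    rw [integral_undef hni] at e
    have : 0 < (Real.exp (-t) * √(1 / (1 - 2 * t))) ^ n := by positivity
    linarith
  · rw [e]
    refine (pow_le_pow_left₀ (by positivity) (exp_mul_sqrt_le ht) n).trans (le_of_eq ?_)
    rw [← Real.exp_nat_mul]; congr 1; ring

theorem lintegral_exp_fluct_le (hn : 0 < n) (hS₀ : S₀.PosSemidef)
    (hX : ∀ i, HasLaw (X i) (multivariateGaussian 0 S₀) P) (hind : iIndepFun X P)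
    {v : Fin p → ℝ} (hv : v ⬝ᵥ (S₀ *ᵥ v) = 1) :
    ∫⁻ ω, ENNReal.ofReal (Real.exp (fluct (fun i => X i ω) v / 4)) ∂P ≤ ENNReal.ofReal 4 := by
  have hn1 : (1 : ℝ) ≤ n := by exact_mod_cast hn
  have hs : 0 < √(n : ℝ) := Real.sqrt_pos.2 (by linarith)
  have hss : √(n : ℝ) * √(n : ℝ) = n := Real.mul_self_sqrt (by linarith)
  have hs1 : 1 ≤ √(n : ℝ) := Real.one_le_sqrt.2 hn1
  -- With this `t`, a quarter of the fluctuation is `|t ∑ (zᵢ² - 1)|` and `4nt² = 1/4`. The moments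
  -- at `t` and `-t` are each at most `exp(1/4) ≤ 2`, which gives the total `4`.
  set t : ℝ := 1 / (4 * √n) with ht
  have ht0 : 0 < t := by positivity
  have ht4 : |t| ≤ 1 / 4 := by
    rw [abs_of_pos ht0, ht]
    exact one_div_le_one_div_of_le (by norm_num) (by linarith)
  have ht4' : |-t| ≤ 1 / 4 := by rwa [abs_neg]
  obtain ⟨i1, l1⟩ := integral_exp_sum_le hS₀ hX hind hv ht4
  obtain ⟨i2, l2⟩ := integral_exp_sum_le hS₀ hX hind hv ht4'
  have hb : Real.exp (4 * n * t ^ 2) ≤ 2 := by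
    have : 4 * n * t ^ 2 = 1 / 4 := by
      rw [ht, div_pow, mul_pow, sq √(n : ℝ), hss]; field_simp
    rw [this, ← Real.le_log_iff_exp_le (by norm_num)]
    linarith [Real.log_two_gt_d9]
  have hfl : ∀ ω, fluct (fun i => X i ω) v / 4 =
      |t * ∑ i, ((v ⬝ᵥ (X i ω).ofLp) ^ 2 - 1)| := by
    intro ω
    have h1 : v ⬝ᵥ (sampleCov (fun i => X i ω) *ᵥ v) - 1 =
        (n : ℝ)⁻¹ * ∑ i, ((v ⬝ᵥ (X i ω).ofLp) ^ 2 - 1) := by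
      rw [quadForm_sampleCov, Finset.sum_sub_distrib, mul_sub]
      simp; field_simp
    have h2 : √(n : ℝ) * (n : ℝ)⁻¹ = 4 * t := by
      have h3 : (n : ℝ)⁻¹ = (√(n : ℝ) * √(n : ℝ))⁻¹ := by rw [hss]
      rw [h3, ht]; field_simp
    rw [fluct, h1, abs_mul, abs_mul, abs_of_pos ht0, abs_of_pos (by positivity : 0 < (n : ℝ)⁻¹),
      ← mul_assoc, h2]
    ring
  calc ∫⁻ ω, ENNReal.ofReal (Real.exp (fluct (fun i => X i ω) v / 4)) ∂P
      ≤ ∫⁻ ω, ENNReal.ofReal (Real.exp (t * ∑ i, ((v ⬝ᵥ (X i ω).ofLp) ^ 2 - 1)) +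
          Real.exp (-t * ∑ i, ((v ⬝ᵥ (X i ω).ofLp) ^ 2 - 1))) ∂P := by
        refine lintegral_mono fun ω => ENNReal.ofReal_le_ofReal ?_
        rw [hfl, neg_mul]
        set a := t * ∑ i, ((v ⬝ᵥ (X i ω).ofLp) ^ 2 - 1)
        rcases abs_cases a with ⟨h, _⟩ | ⟨h, _⟩ <;> rw [h]
        · linarith [Real.exp_pos (-a)]
        · linarith [Real.exp_pos a]
    _ = ENNReal.ofReal (∫ ω, (Real.exp (t * ∑ i, ((v ⬝ᵥ (X i ω).ofLp) ^ 2 - 1)) +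
          Real.exp (-t * ∑ i, ((v ⬝ᵥ (X i ω).ofLp) ^ 2 - 1))) ∂P) := by
        refine (ofReal_integral_eq_lintegral_ofReal (i1.add i2)
          (Filter.Eventually.of_forall fun ω => ?_)).symm
        exact add_nonneg (Real.exp_pos _).le (Real.exp_pos _).le
    _ ≤ ENNReal.ofReal 4 := by
        refine ENNReal.ofReal_le_ofReal ?_
        rw [integral_add i1 i2]
        rw [neg_sq] at l2
        linarith

theorem pow_four_le_exp {z : ℝ} (hz : 0 ≤ z) : z ^ 4 ≤ 6144 * Real.exp (z / 4) := by
  have h := Real.pow_div_factorial_le_exp (z / 4) (by positivity) 4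
  rw [div_le_iff₀ (by positivity), div_pow] at h
  have : ((Nat.factorial 4 : ℕ) : ℝ) = 24 := by norm_num [Nat.factorial]
  rw [this] at h
  linarith

/-- Markov's inequality for the weighted sum of exponentials. Only its mean is used, so neither
independence nor the number of terms enters. -/
theorem measure_lt_le_of_exp_le {T : Ω → ℝ} {ι : Type*} [Fintype ι] {w : ι → ℝ}
    (hw : ∀ i, 0 ≤ w i) (hw1 : ∑ i, w i ≤ 1) {Z : ι → Ω → ℝ} (hZm : ∀ i, AEMeasurable (Z i) P)
    (hZ : ∀ i, ∫⁻ ω, ENNReal.ofReal (Real.exp (Z i ω / 4)) ∂P ≤ ENNReal.ofReal 4) {s c : ℝ}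
    (hc : 0 < c) (h : ∀ ω, s < T ω → c ≤ ∑ i, w i * Real.exp (Z i ω / 4)) :
    P {ω | s < T ω} ≤ ENNReal.ofReal (4 / c) := by
  have hm : ∀ i, AEMeasurable (fun ω => ENNReal.ofReal (w i * Real.exp (Z i ω / 4))) P := fun i =>
    ((Real.measurable_exp.comp_aemeasurable ((hZm i).div_const 4)).const_mul _).ennreal_ofReal
  have hsub : {ω | s < T ω} ⊆ {ω | ENNReal.ofReal c ≤
      ∑ i, ENNReal.ofReal (w i * Real.exp (Z i ω / 4))} := fun ω hω => by
    have h1 := h ω hω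
    simp only [Set.mem_ofPred_eq]
    rw [← ENNReal.ofReal_sum_of_nonneg fun i _ => mul_nonneg (hw i) (Real.exp_pos _).le]
    exact ENNReal.ofReal_le_ofReal h1
  refine (measure_mono hsub).trans ?_
  have hM := meas_ge_le_lintegral_div (μ := P)
    (f := fun ω => ∑ i, ENNReal.ofReal (w i * Real.exp (Z i ω / 4)))
    (Finset.aemeasurable_fun_sum _ fun i _ => hm i) (ε := ENNReal.ofReal c)
    (by simpa using hc) ENNReal.ofReal_ne_top
  refine hM.trans ?_
  rw [ENNReal.ofReal_div_of_pos hc]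
  refine ENNReal.div_le_div_right ?_ _
  rw [lintegral_finsetSum' _ fun i _ => hm i]
  calc ∑ i, ∫⁻ ω, ENNReal.ofReal (w i * Real.exp (Z i ω / 4)) ∂P
      ≤ ∑ i, ENNReal.ofReal (w i) * ENNReal.ofReal 4 := by
        refine Finset.sum_le_sum fun i _ => ?_
        simp only [ENNReal.ofReal_mul (hw i)]
        rw [lintegral_const_mul' _ _ ENNReal.ofReal_ne_top]
        exact mul_le_mul_right (hZ i) _
    _ = ENNReal.ofReal (∑ i, w i) * ENNReal.ofReal 4 := by
        rw [← Finset.sum_mul, ENNReal.ofReal_sum_of_nonneg fun i _ => hw i]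
    _ ≤ ENNReal.ofReal 1 * ENNReal.ofReal 4 :=
        mul_le_mul_left (ENNReal.ofReal_le_ofReal hw1) _
    _ = ENNReal.ofReal 4 := by simp

theorem exp_sum_le_sum_exp {ι : Type*} [Fintype ι] {w z : ι → ℝ} (hw : ∀ i, 0 ≤ w i)
    (hw1 : ∑ i, w i = 1) : Real.exp ((∑ i, w i * z i) / 4) ≤ ∑ i, w i * Real.exp (z i / 4) := by
  have h := convexOn_exp.map_sum_le (t := Finset.univ) (w := w) (p := fun i => z i / 4)
    (fun i _ => hw i) hw1 (fun _ _ => Set.mem_univ _)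
  simp only [smul_eq_mul] at h
  rw [Finset.sum_div]
  simpa only [mul_div_assoc] using h

theorem sq_sum_le_sum_sq {ι : Type*} [Fintype ι] {w z : ι → ℝ} (hw : ∀ i, 0 ≤ w i)
    (hw1 : ∑ i, w i = 1) : (∑ i, w i * z i) ^ 2 ≤ ∑ i, w i * z i ^ 2 := by
  have h := (even_two.convexOn_pow (𝕜 := ℝ)).map_sum_le (t := Finset.univ) (w := w) (p := z)
    (fun i _ => hw i) hw1 (fun _ _ => Set.mem_univ _)
  simpa only [smul_eq_mul] using h

/-- Weighted averages of the fluctuations over a finite family of directions, however large, are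
controlled with probability `1 - O(1 / n)`. -/
theorem measure_fluct_family_le (hn : 0 < n) (hS₀ : S₀.PosSemidef)
    (hX : ∀ i, HasLaw (X i) (multivariateGaussian 0 S₀) P) (hind : iIndepFun X P)
    {ι : Type*} [Fintype ι] {w : ι → ℝ} (hw : ∀ i, 0 ≤ w i) (hw1 : ∑ i, w i = 1)
    {v : ι → Fin p → ℝ} (hv : ∀ i, v i ⬝ᵥ (S₀ *ᵥ v i) = 1) {K : ℝ} (hK : 4 ≤ K) :
    P {ω | K * (1 + Real.log n) < ∑ i, w i * fluct (fun k => X k ω) (v i) ∨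
        K * √n < ∑ i, w i * fluct (fun k => X k ω) (v i) ^ 2} ≤
      ENNReal.ofReal (25000 / (K * n)) := by
  have hn1 : (1 : ℝ) ≤ n := by exact_mod_cast hn
  have hn0 : (0 : ℝ) < n := by linarith
  have hL : 0 ≤ Real.log n := Real.log_nonneg hn1
  have hK0 : 0 < K := by linarith
  have hZm := fun i => aemeasurable_fluct hX (v i)
  have hZ := fun i => lintegral_exp_fluct_le hn hS₀ hX hind (hv i)
  have hf : ∀ ω i, 0 ≤ fluct (fun k => X k ω) (v i) := fun ω i => fluct_nonneg _ _
  -- By Jensen's inequality an average above `K(1 + log n)` forces the weighted exponential above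
  -- `exp(K/4) n ≥ Kn/4`; `K ≥ 4` turns `(K/4) log n` into at least `log n`.
  have h1 := measure_lt_le_of_exp_le (P := P) (c := K * n / 4)
    (T := fun ω => ∑ i, w i * fluct (fun k => X k ω) (v i)) (s := K * (1 + Real.log n)) hw hw1.le
    hZm hZ (by positivity) fun ω hω => by
      refine le_trans ?_ (exp_sum_le_sum_exp hw hw1)
      have e1 : K / 4 + Real.log n ≤ (∑ i, w i * fluct (fun k => X k ω) (v i)) / 4 := by
        nlinarith
      refine le_trans ?_ (Real.exp_le_exp.2 e1)
      rw [Real.exp_add, Real.exp_log hn0]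
      have e2 := Real.add_one_le_exp (K / 4)
      nlinarith
  -- A mean square above `K√n` forces the fourth moment above `K²n`, and `z⁴ ≤ 6144 exp(z/4)`, where
  -- `6144 = 4! · 4⁴`.
  have h2 := measure_lt_le_of_exp_le (P := P) (c := K ^ 2 * n / 6144)
    (T := fun ω => ∑ i, w i * fluct (fun k => X k ω) (v i) ^ 2) (s := K * √n) hw hw1.le
    hZm hZ (by positivity) fun ω hω => by
      have e1 : (K * √n) ^ 2 ≤ (∑ i, w i * fluct (fun k => X k ω) (v i) ^ 2) ^ 2 :=
        pow_le_pow_left₀ (by positivity) (le_of_lt hω) 2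
      have e2 := e1.trans (sq_sum_le_sum_sq (z := fun i => fluct (fun k => X k ω) (v i) ^ 2) hw hw1)
      rw [mul_pow, Real.sq_sqrt hn0.le] at e2
      have e3 : ∑ i, w i * (fluct (fun k => X k ω) (v i) ^ 2) ^ 2 ≤
          6144 * ∑ i, w i * Real.exp (fluct (fun k => X k ω) (v i) / 4) := by
        rw [Finset.mul_sum]
        refine Finset.sum_le_sum fun i _ => ?_
        rw [← pow_mul, mul_left_comm]
        exact mul_le_mul_of_nonneg_left (pow_four_le_exp (hf ω i)) (hw i)
      linarith
  have h3 : {ω | K * (1 + Real.log n) < ∑ i, w i * fluct (fun k => X k ω) (v i) ∨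
        K * √n < ∑ i, w i * fluct (fun k => X k ω) (v i) ^ 2} =
      {ω | K * (1 + Real.log n) < ∑ i, w i * fluct (fun k => X k ω) (v i)} ∪
        {ω | K * √n < ∑ i, w i * fluct (fun k => X k ω) (v i) ^ 2} := rfl
  rw [h3]
  refine (measure_union_le _ _).trans ((add_le_add h1 h2).trans ?_)
  rw [← ENNReal.ofReal_add (by positivity) (by positivity)]
  refine ENNReal.ofReal_le_ofReal ?_
  have e1 : 4 / (K * n / 4) = 16 / (K * n) := by field_simp; norm_num
  have e2 : 4 / (K ^ 2 * n / 6144) = 24576 / K * (1 / (K * n)) := by field_simp; norm_num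
  have e3 : 24576 / K ≤ 6144 := by rw [div_le_iff₀ hK0]; linarith
  have e4 : (0 : ℝ) < 1 / (K * n) := by positivity
  rw [e1, e2, ← mul_one_div 16, ← mul_one_div 25000]
  nlinarith

end InvWishartBvM
end

noncomputable section

namespace InvWishartBvM

/-! ### Posterior moments in a fixed direction -/

/-- The fraction is the posterior mean of `vᵀSv`: `q` stands for `vᵀΣ̂v - 1`, `γ` for `vᵀGv`, `m`
for `n + b - 2` and `X` for `√n`. -/
theorem abs_mean_sub_one_le {n X m b g q f γ : ℝ} (hX : 0 < X) (hXn : X ^ 2 = n)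
    (hm : n / 2 ≤ m) (hnm : |n - m| ≤ b + 2) (hf : X * |q| = f) (hγ : 0 ≤ γ) (hγg : γ ≤ g) :
    |(n * (1 + q) + γ) / m - 1| ≤ 2 * (f / X) + 2 * (b + 2 + g) / n := by
  have hn : 0 < n := by rw [← hXn]; positivity
  have hm0 : 0 < m := by linarith
  have e : (n * (1 + q) + γ) / m - 1 = (n * q + (n - m) + γ) / m := by field_simp; ring
  have hq : f / X = |q| := by rw [← hf]; field_simp
  rw [e, abs_div, abs_of_pos hm0, hq, div_le_iff₀ hm0]
  have h1 : |n * q + (n - m) + γ| ≤ n * |q| + (b + 2) + g := by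
    refine (abs_add_le _ _).trans (add_le_add ((abs_add_le _ _).trans (add_le_add ?_ hnm)) ?_)
    · rw [abs_mul, abs_of_pos hn]
    · rwa [abs_of_nonneg hγ]
  have hB : 0 ≤ b + 2 + g := by linarith [(abs_nonneg _).trans hnm]
  have h2 : (2 * |q| + 2 * (b + 2 + g) / n) * (n / 2) ≤ (2 * |q| + 2 * (b + 2 + g) / n) * m :=
    mul_le_mul_of_nonneg_left hm (by positivity)
  have h3 : (2 * |q| + 2 * (b + 2 + g) / n) * (n / 2) = n * |q| + (b + 2 + g) := by
    field_simp
  linarith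

/-- Posterior variance plus squared bias of `vᵀSv`, where `μ` is the posterior mean and `β` the part
of the bias due to the prior. -/
theorem second_moment_le {n X m f β μ : ℝ} (hX : 6 ≤ X) (hXn : X ^ 2 = n) (hm : n / 2 ≤ m - 2)
    (hμ : |μ - 1| ≤ 2 * (f / X) + β) :
    2 * μ ^ 2 / (m - 2) + (μ - 1) ^ 2 ≤ 8 / n + 72 * (f ^ 2 / n) + 18 * β ^ 2 := by
  have hn : 36 ≤ n := by nlinarith
  have h1 : (μ - 1) ^ 2 ≤ 8 * (f ^ 2 / n) + 2 * β ^ 2 := by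
    have h2 : (f / X) ^ 2 = f ^ 2 / n := by rw [div_pow, hXn]
    rw [← sq_abs, ← h2]
    nlinarith [abs_nonneg (μ - 1), sq_nonneg (2 * (f / X) - β)]
  have h2 : μ ^ 2 ≤ 2 + 2 * (μ - 1) ^ 2 := by nlinarith [sq_nonneg (μ - 2)]
  have h3 : 2 * μ ^ 2 / (m - 2) ≤ 4 / n * μ ^ 2 := by
    rw [div_mul_eq_mul_div, div_le_div_iff₀ (by linarith) (by linarith)]
    nlinarith [sq_nonneg μ]
  have h4 : 4 / n * μ ^ 2 ≤ 4 / n * (2 + 2 * (μ - 1) ^ 2) :=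
    mul_le_mul_of_nonneg_left h2 (by positivity)
  have h5 : 4 / n ≤ 1 := by rw [div_le_one (by linarith)]; linarith
  have h6 : 4 / n * (2 * (μ - 1) ^ 2) ≤ 2 * (μ - 1) ^ 2 :=
    mul_le_of_le_one_left (by positivity) h5
  have h7 : 4 / n * 2 = 8 / n := by ring
  have h8 : 0 ≤ f ^ 2 / n := by positivity
  nlinarith [sq_nonneg β]

theorem first_moment_le {n X m f β μ : ℝ} (hX : 6 ≤ X) (hXn : X ^ 2 = n) (hm : n / 2 ≤ m - 2)
    (hβ : 0 ≤ β) (hβ1 : β ≤ 1) (hμ : |μ - 1| ≤ 2 * (f / X) + β) :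
    X * μ ^ 2 / (m - 2) + 1 / (2 * X) + |μ - 1| ≤
      5 / X + 6 * (f ^ 2 / n) + 2 * (f / X) + 3 * β := by
  have hn : 36 ≤ n := by nlinarith
  have hX0 : 0 < X := by linarith
  have h1 : (μ - 1) ^ 2 ≤ 8 * (f ^ 2 / n) + 2 * β ^ 2 := by
    have h2 : (f / X) ^ 2 = f ^ 2 / n := by rw [div_pow, hXn]
    rw [← sq_abs, ← h2]
    nlinarith [abs_nonneg (μ - 1), sq_nonneg (2 * (f / X) - β)]
  have h2 : μ ^ 2 ≤ 2 + 2 * (μ - 1) ^ 2 := by nlinarith [sq_nonneg (μ - 2)]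
  have h3 : X * μ ^ 2 / (m - 2) ≤ 2 / X * μ ^ 2 := by
    rw [div_mul_eq_mul_div, div_le_div_iff₀ (by linarith) hX0]
    nlinarith [mul_nonneg (sq_nonneg μ) (by linarith : 0 ≤ m - 2 - n / 2)]
  have h4 : 2 / X * μ ^ 2 ≤ 2 / X * (2 + 2 * (μ - 1) ^ 2) :=
    mul_le_mul_of_nonneg_left h2 (by positivity)
  have h5 : 2 / X ≤ 1 / 3 := by rw [div_le_div_iff₀ hX0 (by norm_num)]; linarith
  have h6 : 2 / X * (2 * (μ - 1) ^ 2) ≤ 1 / 3 * (2 * (μ - 1) ^ 2) :=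
    mul_le_mul_of_nonneg_right h5 (by positivity)
  have h7 : 2 / X * 2 = 4 * (1 / X) := by ring
  have h7' : 1 / (2 * X) = 1 / 2 * (1 / X) := by field_simp
  have h7'' : 5 / X = 5 * (1 / X) := by ring
  have h8 : 0 ≤ f ^ 2 / n := by positivity
  have h9 : 0 < 1 / X := by positivity
  have h10 : β ^ 2 ≤ β := by nlinarith
  rw [h7', h7'']
  nlinarith

variable {n p : ℕ} {b g : ℝ} {G : Matrix (Fin p) (Fin p) ℝ}
  {x : Fin n → EuclideanSpace ℝ (Fin p)} {v : Fin p → ℝ}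

theorem quadForm_posterior_scale (v : Fin p → ℝ) :
    v ⬝ᵥ (((n : ℝ) • sampleCov x + G) *ᵥ v) =
      n * (1 + (v ⬝ᵥ (sampleCov x *ᵥ v) - 1)) + v ⬝ᵥ (G *ᵥ v) := by
  rw [add_mulVec, dotProduct_add, smul_mulVec, dotProduct_smul, smul_eq_mul]; ring

theorem integral_quadForm_sub_one_sq_le (hG : G.PosDef) (hb : 0 < b) (hn : 6 ≤ √(n : ℝ))
    (hvg : v ⬝ᵥ (G *ᵥ v) ≤ g) :
    ∫ S, (v ⬝ᵥ (S *ᵥ v) - 1) ^ 2 ∂invWishart ((n : ℝ) • sampleCov x + G) (n + p + b - 1) ≤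
      8 / n + 72 * (fluct x v ^ 2 / n) + 18 * (2 * (b + 2 + g) / n) ^ 2 := by
  have hXn : √(n : ℝ) ^ 2 = n := Real.sq_sqrt (Nat.cast_nonneg _)
  have hn36 : (36 : ℝ) ≤ n := by nlinarith
  have hA := posDef_smul_sampleCov_add x hG
  have e1 : (n : ℝ) + p + b - 1 - p - 1 = n + b - 2 := by ring
  have e2 : (n : ℝ) + p + b - 1 - p - 3 = n + b - 2 - 2 := by ring
  rw [integral_quadForm_sub_sq hA (by linarith), e1, e2]
  refine second_moment_le hn hXn (by linarith) ?_
  rw [quadForm_posterior_scale]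
  have h0 := (posSemidef_iff_real.1 hG.posSemidef).2 v
  refine abs_mean_sub_one_le (by linarith) hXn (by linarith) ?_ rfl h0 hvg
  rw [abs_le]; constructor <;> linarith

/-- Uses `z² - 1 = (z - 1)² + 2(z - 1)`. Unlike the second-moment bound, this one is of first order
in the fluctuation. -/
theorem integral_abs_quadForm_sq_sub_one_le (hG : G.PosDef) (hb : 0 < b) (hn : 6 ≤ √(n : ℝ))
    (hvg : v ⬝ᵥ (G *ᵥ v) ≤ g) (hβ : 2 * (b + 2 + g) / n ≤ 1) :
    ∫ S, |(v ⬝ᵥ (S *ᵥ v)) ^ 2 - 1| ∂invWishart ((n : ℝ) • sampleCov x + G) (n + p + b - 1) ≤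
      84 * (1 / √n + fluct x v ^ 2 / n + fluct x v / √n + 2 * (b + 2 + g) / n) := by
  have hXn : √(n : ℝ) ^ 2 = n := Real.sq_sqrt (Nat.cast_nonneg _)
  have hn36 : (36 : ℝ) ≤ n := by nlinarith
  have hA := posDef_smul_sampleCov_add x hG
  have hν : (p : ℝ) + 5 < n + p + b - 1 := by linarith
  have := isProbabilityMeasure_invWishart hA (ν := n + p + b - 1) (by linarith)
  have e1 : (n : ℝ) + p + b - 1 - p - 1 = n + b - 2 := by ring
  have e2 : (n : ℝ) + p + b - 1 - p - 3 = n + b - 2 - 2 := by ring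
  have h0 := (posSemidef_iff_real.1 hG.posSemidef).2 v
  have hβ0 : 0 ≤ 2 * (b + 2 + g) / n := by
    have : 0 ≤ g := h0.trans hvg
    positivity
  have hsq := integral_quadForm_sub_one_sq_le (x := x) hG hb hn hvg
  have habs := integral_abs_quadForm_sub_le hA hν v 1 (s := √n) (by linarith)
  rw [e1, e2] at habs
  have hmean : |v ⬝ᵥ (((n : ℝ) • sampleCov x + G) *ᵥ v) / (n + b - 2) - 1| ≤
      2 * (fluct x v / √n) + 2 * (b + 2 + g) / n := by
    rw [quadForm_posterior_scale]
    refine abs_mean_sub_one_le (by linarith) hXn (by linarith) ?_ rfl h0 hvg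
    rw [abs_le]; constructor <;> linarith
  have h1 := habs.trans (first_moment_le hn hXn (by linarith) hβ0 hβ hmean)
  have i1 := integrable_quadForm_sub_sq hA hν v 1
  have i2 : Integrable (fun S => |v ⬝ᵥ (S *ᵥ v) - 1|)
      (invWishart ((n : ℝ) • sampleCov x + G) (n + p + b - 1)) :=
    ((integrable_quadForm hA hν.le v).sub (integrable_const 1)).abs
  have h2 : ∫ S, |(v ⬝ᵥ (S *ᵥ v)) ^ 2 - 1|
        ∂invWishart ((n : ℝ) • sampleCov x + G) (n + p + b - 1) ≤
      ∫ S, ((v ⬝ᵥ (S *ᵥ v) - 1) ^ 2 + 2 * |v ⬝ᵥ (S *ᵥ v) - 1|)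
        ∂invWishart ((n : ℝ) • sampleCov x + G) (n + p + b - 1) := by
    refine integral_mono ((integrable_quadForm_sq hA hν.le v).sub (integrable_const 1)).abs
      (i1.add (i2.const_mul 2)) fun S => ?_
    simp only
    have e : (v ⬝ᵥ (S *ᵥ v)) ^ 2 - 1 =
        (v ⬝ᵥ (S *ᵥ v) - 1) ^ 2 + 2 * (v ⬝ᵥ (S *ᵥ v) - 1) := by ring
    rw [e]
    refine (abs_add_le _ _).trans (le_of_eq ?_)
    rw [abs_mul, abs_two, abs_of_nonneg (sq_nonneg _)]
  rw [integral_add i1 (i2.const_mul 2), integral_const_mul] at h2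
  have h3 : (8 : ℝ) / n ≤ 2 * (1 / √n) := by
    rw [mul_one_div, div_le_div_iff₀ (by linarith) (by linarith)]
    nlinarith
  have h4 : 0 ≤ fluct x v ^ 2 / n := by positivity
  have h5 : 0 ≤ fluct x v / √n := div_nonneg (fluct_nonneg _ _) (Real.sqrt_nonneg _)
  have h6 : 0 ≤ 1 / √(n : ℝ) := by positivity
  have h7 : 5 / √(n : ℝ) = 5 * (1 / √n) := by ring
  have h8 : (2 * (b + 2 + g) / n) ^ 2 ≤ 2 * (b + 2 + g) / n := by nlinarith
  rw [h7] at h1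
  linarith

/-! ### The functional in the reduced coordinates -/

variable {r : ℕ} {W : Matrix (Fin p) (Fin r) ℝ} {d : Fin r → ℝ}

theorem quadForm_mulVec (M : Matrix (Fin p) (Fin p) ℝ) (W : Matrix (Fin p) (Fin r) ℝ)
    (a c : Fin r → ℝ) : (W *ᵥ a) ⬝ᵥ (M *ᵥ (W *ᵥ c)) = a ⬝ᵥ ((Wᵀ * M * W) *ᵥ c) := by
  rw [← mulVec_mulVec, ← mulVec_mulVec, dotProduct_mulVec a, vecMul_transpose]

theorem trace_reduced (M : Matrix (Fin p) (Fin p) ℝ) :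
    (W * diagonal d * Wᵀ * M).trace = ∑ i, d i * (Wᵀ * M * W) i i := by
  rw [Matrix.mul_assoc (W * diagonal d), Matrix.mul_assoc W, Matrix.trace_mul_comm,
    Matrix.mul_assoc]
  simp [trace, diagonal_mul]

theorem trace_reduced_sq {S : Matrix (Fin p) (Fin p) ℝ} (hS : S.IsSymm) :
    (W * diagonal d * Wᵀ * S * (W * diagonal d * Wᵀ * S)).trace =
      ∑ i, ∑ j, d i * d j * (Wᵀ * S * W) i j ^ 2 := by
  have h1 : W * diagonal d * Wᵀ * S * (W * diagonal d * Wᵀ * S) =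
      W * (diagonal d * (Wᵀ * S * W) * diagonal d * (Wᵀ * S)) := by
    simp only [Matrix.mul_assoc]
  have hsym : (Wᵀ * S * W).IsSymm := by
    simp [IsSymm, transpose_mul, hS.eq, Matrix.mul_assoc]
  rw [h1, Matrix.trace_mul_comm, Matrix.mul_assoc _ (Wᵀ * S)]
  simp only [trace, diag_apply]
  refine Finset.sum_congr rfl fun i _ => ?_
  rw [mul_apply]
  refine Finset.sum_congr rfl fun j _ => ?_
  rw [mul_diagonal, diagonal_mul, hsym.apply i j]
  ring

/-- The unit vector `(eᵢ + s eⱼ) / √2`, or `eᵢ` on the diagonal. -/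
def pairDir (s : ℝ) (i j : Fin r) : Fin r → ℝ :=
  if i = j then Pi.single i 1 else (√2)⁻¹ • (Pi.single i 1 + s • Pi.single j 1)

theorem pairDir_dotProduct_self {s : ℝ} (hs : s ^ 2 = 1) (i j : Fin r) :
    pairDir s i j ⬝ᵥ pairDir s i j = 1 := by
  rw [pairDir]
  split_ifs with h
  · simp
  · have h2 : (√2)⁻¹ * (√2)⁻¹ = (1 : ℝ) / 2 := by
      rw [← mul_inv, Real.mul_self_sqrt (by norm_num)]; norm_num
    simp only [dotProduct_smul, dotProduct_add, smul_eq_mul, dotProduct_single, mul_one]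
    simp [Ne.symm h, h]
    linear_combination (1 + s * s) * h2 + hs / 2

/-- The forms in the directions `(eᵢ ± eⱼ)/√2` are `(M i i + M j j)/2 ± M i j`, so the average of
the two squares exceeds `M i j ^ 2` by a square. Only unit directions occur, where moments and
fluctuations are controlled. -/
theorem entry_sq_le {M : Matrix (Fin r) (Fin r) ℝ} (hM : M.IsSymm) {i j : Fin r} (hij : i ≠ j) :
    M i j ^ 2 ≤ ((pairDir 1 i j ⬝ᵥ (M *ᵥ pairDir 1 i j) - 1) ^ 2 +
      (pairDir (-1) i j ⬝ᵥ (M *ᵥ pairDir (-1) i j) - 1) ^ 2) / 2 := by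
  have h2 : (√2)⁻¹ * (√2)⁻¹ = (1 : ℝ) / 2 := by
    rw [← mul_inv, Real.mul_self_sqrt (by norm_num)]; norm_num
  have key : ∀ s : ℝ, s ^ 2 = 1 → pairDir s i j ⬝ᵥ (M *ᵥ pairDir s i j) =
      (M i i + M j j) / 2 + s * M i j := by
    intro s hs
    have hsym : M j i = M i j := hM.apply i j
    rw [pairDir, if_neg hij]
    simp only [mulVec_smul, mulVec_add, smul_dotProduct, dotProduct_smul, add_dotProduct,
      dotProduct_add, smul_eq_mul, single_dotProduct, mulVec_single_one, col_apply, one_mul, hsym]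
    linear_combination (M i i + s * M i j + s * (M i j + s * M j j)) * h2 + M j j * hs / 2
  rw [key 1 (by norm_num), key (-1) (by norm_num)]
  nlinarith [sq_nonneg ((M i i + M j j) / 2 - 1)]

theorem abs_quadForm_le_specNorm (M : Matrix (Fin r) (Fin r) ℝ) {a : Fin r → ℝ}
    (ha : a ⬝ᵥ a = 1) : |a ⬝ᵥ (M *ᵥ a)| ≤ specNorm M := by
  have h1 : ‖WithLp.toLp 2 a‖ = 1 := by
    rw [EuclideanSpace.norm_eq, Real.sqrt_eq_one]
    simpa [dotProduct, sq] using ha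
  have h2 : a ⬝ᵥ (M *ᵥ a) = inner ℝ (WithLp.toLp 2 a)
      (Matrix.toEuclideanCLM (n := Fin r) (𝕜 := ℝ) M (WithLp.toLp 2 a)) := by
    rw [inner_toEuclideanCLM]
  rw [h2]
  refine (abs_real_inner_le_norm _ _).trans ?_
  rw [h1, one_mul]
  refine ((Matrix.toEuclideanCLM (n := Fin r) (𝕜 := ℝ) M).le_opNorm _).trans ?_
  rw [h1, mul_one, specNorm]

end InvWishartBvM
end

noncomputable section

namespace InvWishartBvM

variable {n p r : ℕ} {b g K : ℝ} {G S₀ : Matrix (Fin p) (Fin p) ℝ}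
  {x : Fin n → EuclideanSpace ℝ (Fin p)} {W : Matrix (Fin p) (Fin r) ℝ} {d : Fin r → ℝ}

/-! ### The variance proxy -/

/-- The two sums are kept apart since they have different orders: diagonal entries deviate to first
order but carry the small weights `dᵢ²`, while off-diagonal entries have target zero and enter
squared, with weights `|dᵢ dⱼ|` of total at most `(∑ |dᵢ|)²`. -/
theorem abs_sum_mul_sq_sub_le {M : Matrix (Fin r) (Fin r) ℝ} (hM : M.IsSymm) (d : Fin r → ℝ) :
    |∑ i, ∑ j, d i * d j * M i j ^ 2 - ∑ i, d i ^ 2| ≤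
      ∑ i, d i ^ 2 * |(Pi.single i 1 ⬝ᵥ (M *ᵥ Pi.single i 1)) ^ 2 - 1| +
      ∑ i, ∑ j, |d i| * |d j| * (((pairDir 1 i j ⬝ᵥ (M *ᵥ pairDir 1 i j) - 1) ^ 2 +
        (pairDir (-1) i j ⬝ᵥ (M *ᵥ pairDir (-1) i j) - 1) ^ 2) / 2) := by
  rw [← Finset.sum_sub_distrib, ← Finset.sum_add_distrib]
  refine (Finset.abs_sum_le_sum_abs _ _).trans (Finset.sum_le_sum fun i _ => ?_)
  have e : ∑ j, d i * d j * M i j ^ 2 - d i ^ 2 =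
      d i ^ 2 * (M i i ^ 2 - 1) + ∑ j ∈ Finset.univ.erase i, d i * d j * M i j ^ 2 := by
    rw [← Finset.add_sum_erase _ _ (Finset.mem_univ i)]; ring
  have hii : Pi.single i 1 ⬝ᵥ (M *ᵥ Pi.single i 1) = M i i := by simp
  rw [e, hii]
  refine (abs_add_le _ _).trans (add_le_add ?_ ?_)
  · rw [abs_mul, abs_of_nonneg (sq_nonneg (d i))]
  · refine (Finset.abs_sum_le_sum_abs _ _).trans ?_
    refine (Finset.sum_le_sum fun j hj => ?_).trans
      (Finset.sum_le_sum_of_subset_of_nonneg (Finset.subset_univ (Finset.univ.erase i))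
        fun j _ _ => by positivity)
    rw [abs_mul, abs_mul, abs_of_nonneg (sq_nonneg (M i j))]
    exact mul_le_mul_of_nonneg_left (entry_sq_le hM (Finset.ne_of_mem_erase hj).symm)
      (by positivity)

/-- The bounds on the weighted fluctuations of the sample covariance which hold with high
probability. -/
structure FluctBounds (x : Fin n → EuclideanSpace ℝ (Fin p)) (W : Matrix (Fin p) (Fin r) ℝ)
    (d : Fin r → ℝ) (K : ℝ) : Prop where
  sq_fst : ∑ i, d i ^ 2 * fluct x (W *ᵥ Pi.single i 1) ≤
    (∑ i, d i ^ 2) * (K * (1 + Real.log n))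
  sq_snd : ∑ i, d i ^ 2 * fluct x (W *ᵥ Pi.single i 1) ^ 2 ≤ (∑ i, d i ^ 2) * (K * √n)
  abs_fst : ∑ i, |d i| * fluct x (W *ᵥ Pi.single i 1) ≤ (∑ i, |d i|) * (K * (1 + Real.log n))
  pair_snd : ∀ s : ℝ, s ^ 2 = 1 → ∑ i, ∑ j, |d i| * |d j| * fluct x (W *ᵥ pairDir s i j) ^ 2 ≤
    (∑ i, |d i|) ^ 2 * (K * √n)

theorem integral_abs_trace_sq_sub_le (hG : G.PosDef) (hb : 0 < b) (hn : 6 ≤ √(n : ℝ))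
    (hg : ∀ a, a ⬝ᵥ a = 1 → (W *ᵥ a) ⬝ᵥ (G *ᵥ (W *ᵥ a)) ≤ g) (hβ : 2 * (b + 2 + g) / n ≤ 1)
    (hx : FluctBounds x W d K) :
    ∫ S, |(W * diagonal d * Wᵀ * S * (W * diagonal d * Wᵀ * S)).trace - ∑ i, d i ^ 2|
        ∂invWishart ((n : ℝ) • sampleCov x + G) (n + p + b - 1) ≤
      (∑ i, d i ^ 2) * (84 * (1 / √n + K / √n + K * (1 + Real.log n) / √n + 2 * (b + 2 + g) / n)) +
      (∑ i, |d i|) ^ 2 * (8 / n + 72 * (K / √n) + 18 * (2 * (b + 2 + g) / n) ^ 2) := by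
  have hXn : √(n : ℝ) ^ 2 = n := Real.sq_sqrt (Nat.cast_nonneg _)
  have hn36 : (36 : ℝ) ≤ n := by nlinarith
  have hX0 : 0 < √(n : ℝ) := by linarith
  have hA := posDef_smul_sampleCov_add x hG
  have hν : (p : ℝ) + 5 < n + p + b - 1 := by linarith
  have := isProbabilityMeasure_invWishart hA (ν := n + p + b - 1) (by linarith)
  set β := 2 * (b + 2 + g) / n with hβd
  set P := invWishart ((n : ℝ) • sampleCov x + G) (n + p + b - 1) with hP
  set f : Fin r → Matrix (Fin p) (Fin p) ℝ → ℝ := fun i S =>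
    |((W *ᵥ Pi.single i 1) ⬝ᵥ (S *ᵥ (W *ᵥ Pi.single i 1))) ^ 2 - 1| with hf
  set h : ℝ → Fin r → Fin r → Matrix (Fin p) (Fin p) ℝ → ℝ := fun s i j S =>
    ((W *ᵥ pairDir s i j) ⬝ᵥ (S *ᵥ (W *ᵥ pairDir s i j)) - 1) ^ 2 with hh
  have fi : ∀ i, Integrable (f i) P := fun i =>
    ((integrable_quadForm_sq hA hν.le _).sub (integrable_const 1)).abs
  have hi : ∀ s i j, Integrable (h s i j) P := fun s i j => integrable_quadForm_sub_sq hA hν _ 1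
  have fle : ∀ i, ∫ S, f i S ∂P ≤ 84 * (1 / √n + fluct x (W *ᵥ Pi.single i 1) ^ 2 / n +
      fluct x (W *ᵥ Pi.single i 1) / √n + β) := fun i =>
    integral_abs_quadForm_sq_sub_one_le hG hb hn (hg _ (by simp)) hβ
  have hle : ∀ s, s ^ 2 = 1 → ∀ i j, ∫ S, h s i j S ∂P ≤
      8 / n + 72 * (fluct x (W *ᵥ pairDir s i j) ^ 2 / n) + 18 * β ^ 2 := fun s hs i j =>
    integral_quadForm_sub_one_sq_le hG hb hn (hg _ (pairDir_dotProduct_self hs i j))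
  have fi' : Integrable (fun S => ∑ i, d i ^ 2 * f i S) P :=
    integrable_finsetSum _ fun i _ => (fi i).const_mul _
  have hpi : ∀ i j, Integrable (fun S => |d i| * |d j| * ((h 1 i j S + h (-1) i j S) / 2)) P :=
    fun i j => (((hi 1 i j).add (hi (-1) i j)).div_const 2).const_mul _
  have hi' : Integrable (fun S => ∑ i, ∑ j, |d i| * |d j| * ((h 1 i j S + h (-1) i j S) / 2)) P :=
    integrable_finsetSum _ fun i _ => integrable_finsetSum _ fun j _ => hpi i j
  have h1 : ∫ S, |(W * diagonal d * Wᵀ * S * (W * diagonal d * Wᵀ * S)).trace - ∑ i, d i ^ 2| ∂P ≤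
      ∫ S, (∑ i, d i ^ 2 * f i S +
        ∑ i, ∑ j, |d i| * |d j| * ((h 1 i j S + h (-1) i j S) / 2)) ∂P := by
    refine integral_mono_ae (((integrable_trace_mul_mul hA hν.le _).sub
      (integrable_const _)).abs) (fi'.add hi') ?_
    filter_upwards [ae_posDef_invWishart ((n : ℝ) • sampleCov x + G) (n + p + b - 1)] with S hS
    have hsym := isSymm_of_posDef hS
    have hM : (Wᵀ * S * W).IsSymm := by
      simp [IsSymm, transpose_mul, hsym.eq, Matrix.mul_assoc]
    simp only [hf, hh, quadForm_mulVec]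
    have := abs_sum_mul_sq_sub_le hM d
    rwa [← trace_reduced_sq hsym] at this
  rw [integral_add fi' hi', integral_finsetSum _ fun i _ => (fi i).const_mul _,
    integral_finsetSum _ fun i _ => integrable_finsetSum _ fun j _ => hpi i j] at h1
  refine h1.trans (add_le_add ?_ ?_)
  · calc ∑ i, ∫ S, d i ^ 2 * f i S ∂P
        ≤ ∑ i, d i ^ 2 * (84 * (1 / √n + fluct x (W *ᵥ Pi.single i 1) ^ 2 / n +
            fluct x (W *ᵥ Pi.single i 1) / √n + β)) := by
          refine Finset.sum_le_sum fun i _ => ?_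
          rw [integral_const_mul]
          exact mul_le_mul_of_nonneg_left (fle i) (sq_nonneg _)
      _ = 84 * ((∑ i, d i ^ 2) * (1 / √n + β) +
            (∑ i, d i ^ 2 * fluct x (W *ᵥ Pi.single i 1) ^ 2) / n +
            (∑ i, d i ^ 2 * fluct x (W *ᵥ Pi.single i 1)) / √n) := by
          rw [Finset.sum_mul, Finset.sum_div, Finset.sum_div, ← Finset.sum_add_distrib,
            ← Finset.sum_add_distrib, Finset.mul_sum]
          refine Finset.sum_congr rfl fun i _ => ?_
          ring
      _ ≤ 84 * ((∑ i, d i ^ 2) * (1 / √n + β) + (∑ i, d i ^ 2) * (K * √n) / n +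
            (∑ i, d i ^ 2) * (K * (1 + Real.log n)) / √n) := by
          have := hx.sq_fst
          have := hx.sq_snd
          gcongr
      _ = _ := by
          have : K * √n / n = K / √n := by
            rw [div_eq_div_iff (by linarith) hX0.ne', mul_assoc, ← sq, hXn]
          rw [← this]; ring
  · have hs : ∀ s : ℝ, s ^ 2 = 1 → ∑ i, ∑ j, |d i| * |d j| * ∫ S, h s i j S ∂P ≤
        (∑ i, |d i|) ^ 2 * (8 / n + 72 * (K / √n) + 18 * β ^ 2) := by
      intro s hs
      calc ∑ i, ∑ j, |d i| * |d j| * ∫ S, h s i j S ∂P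
          ≤ ∑ i, ∑ j, |d i| * |d j| *
              (8 / n + 72 * (fluct x (W *ᵥ pairDir s i j) ^ 2 / n) + 18 * β ^ 2) :=
            Finset.sum_le_sum fun i _ => Finset.sum_le_sum fun j _ =>
              mul_le_mul_of_nonneg_left (hle s hs i j) (by positivity)
        _ = (∑ i, |d i|) ^ 2 * (8 / n + 18 * β ^ 2) +
              72 * (∑ i, ∑ j, |d i| * |d j| * fluct x (W *ᵥ pairDir s i j) ^ 2) / n := by
            rw [sq (∑ i, |d i|), Finset.sum_mul_sum]
            simp only [Finset.sum_mul, Finset.mul_sum, Finset.sum_div]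
            rw [← Finset.sum_add_distrib]
            refine Finset.sum_congr rfl fun i _ => ?_
            rw [← Finset.sum_add_distrib]
            refine Finset.sum_congr rfl fun j _ => ?_
            ring
        _ ≤ (∑ i, |d i|) ^ 2 * (8 / n + 18 * β ^ 2) +
              72 * ((∑ i, |d i|) ^ 2 * (K * √n)) / n := by
            have := hx.pair_snd s hs
            gcongr
        _ = _ := by
            have : K * √n / n = K / √n := by
              rw [div_eq_div_iff (by linarith) hX0.ne', mul_assoc, ← sq, hXn]
            rw [← this]; ring
    have h2 : ∑ i, ∫ S, ∑ j, |d i| * |d j| * ((h 1 i j S + h (-1) i j S) / 2) ∂P =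
        (∑ i, ∑ j, |d i| * |d j| * ∫ S, h 1 i j S ∂P +
          ∑ i, ∑ j, |d i| * |d j| * ∫ S, h (-1) i j S ∂P) / 2 := by
      rw [← Finset.sum_add_distrib, Finset.sum_div]
      refine Finset.sum_congr rfl fun i _ => ?_
      rw [integral_finsetSum _ fun j _ => hpi i j, ← Finset.sum_add_distrib, Finset.sum_div]
      refine Finset.sum_congr rfl fun j _ => ?_
      rw [integral_const_mul, integral_div, integral_add (hi 1 i j) (hi (-1) i j)]
      ring
    rw [h2]
    linarith [hs 1 (by norm_num), hs (-1) (by norm_num)]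

/-! ### The centering -/

/-- The Stein centering is the posterior mean of `Tr(ΦS)`, whereas the theorem centers at the sample
covariance; the prior separates the two. -/
theorem abs_centering_le (hb : 0 < b) (hn : 6 ≤ √(n : ℝ)) (hG : G.PosDef)
    (hg : ∀ a, a ⬝ᵥ a = 1 → (W *ᵥ a) ⬝ᵥ (G *ᵥ (W *ᵥ a)) ≤ g)
    (hx : FluctBounds x W d K) :
    √n * |(((n : ℝ) • sampleCov x + G) * (W * diagonal d * Wᵀ)).trace / (n + b - 2) -
      (W * diagonal d * Wᵀ * sampleCov x).trace| ≤
      2 / √n * ((∑ i, |d i|) * (g + (b + 2) * (1 + K * (1 + Real.log n) / √n))) := by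
  have hXn : √(n : ℝ) ^ 2 = n := Real.sq_sqrt (Nat.cast_nonneg _)
  have hn36 : (36 : ℝ) ≤ n := by nlinarith
  have hX0 : 0 < √(n : ℝ) := by linarith
  set D := ∑ i, |d i| with hD
  have hm : 0 < (n : ℝ) + b - 2 := by linarith
  set t := (W * diagonal d * Wᵀ * sampleCov x).trace with ht
  set u := (W * diagonal d * Wᵀ * G).trace with hu
  have diag : ∀ (M : Matrix (Fin p) (Fin p) ℝ) i,
      (Wᵀ * M * W) i i = (W *ᵥ Pi.single i 1) ⬝ᵥ (M *ᵥ (W *ᵥ Pi.single i 1)) := by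
    intro M i
    rw [quadForm_mulVec]; simp
  have hu1 : |u| ≤ D * g := by
    rw [hu, trace_reduced, hD, Finset.sum_mul]
    refine (Finset.abs_sum_le_sum_abs _ _).trans (Finset.sum_le_sum fun i _ => ?_)
    rw [abs_mul, diag, abs_of_nonneg ((posSemidef_iff_real.1 hG.posSemidef).2 _)]
    exact mul_le_mul_of_nonneg_left (hg _ (by simp)) (abs_nonneg _)
  have ht1 : |t| ≤ D * (1 + K * (1 + Real.log n) / √n) := by
    rw [ht, trace_reduced]
    calc |∑ i, d i * (Wᵀ * sampleCov x * W) i i|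
        ≤ ∑ i, |d i| * (1 + fluct x (W *ᵥ Pi.single i 1) / √n) := by
          refine (Finset.abs_sum_le_sum_abs _ _).trans (Finset.sum_le_sum fun i _ => ?_)
          rw [abs_mul, diag]
          refine mul_le_mul_of_nonneg_left ?_ (abs_nonneg _)
          rw [fluct, mul_div_cancel_left₀ _ hX0.ne']
          have := abs_add_le (1 : ℝ)
            ((W *ᵥ Pi.single i 1) ⬝ᵥ (sampleCov x *ᵥ (W *ᵥ Pi.single i 1)) - 1)
          rwa [add_sub_cancel, abs_one] at this
      _ = D + (∑ i, |d i| * fluct x (W *ᵥ Pi.single i 1)) / √n := by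
          rw [hD, Finset.sum_div, ← Finset.sum_add_distrib]
          exact Finset.sum_congr rfl fun i _ => by ring
      _ ≤ D + D * (K * (1 + Real.log n)) / √n := by
          have := hx.abs_fst
          gcongr
      _ = _ := by ring
  -- The main terms cancel up to `n - m = 2 - b`, which leaves quantities bounded by `D` over a
  -- denominator of order `n`.
  have e : (((n : ℝ) • sampleCov x + G) * (W * diagonal d * Wᵀ)).trace / (n + b - 2) - t =
      ((2 - b) * t + u) / (n + b - 2) := by
    rw [Matrix.trace_mul_comm, mul_add, trace_add, mul_smul_comm, trace_smul, smul_eq_mul,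
      ← ht, ← hu]
    field_simp
    ring
  rw [e, abs_div, abs_of_pos hm, mul_div_assoc', div_le_iff₀ hm]
  have h1 : |(2 - b) * t + u| ≤ (b + 2) * (D * (1 + K * (1 + Real.log n) / √n)) + D * g := by
    refine (abs_add_le _ _).trans (add_le_add ?_ hu1)
    rw [abs_mul]
    refine mul_le_mul ?_ ht1 (abs_nonneg _) (by linarith)
    rw [abs_le]; constructor <;> linarith
  have hB := (abs_nonneg _).trans h1
  have h2 : 2 / √(n : ℝ) * (n / 2) = √n := by
    rw [← hXn]; field_simp
    rw [Real.sqrt_sq hX0.le]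
  calc √(n : ℝ) * |(2 - b) * t + u|
      ≤ √n * ((b + 2) * (D * (1 + K * (1 + Real.log n) / √n)) + D * g) := by gcongr
    _ = 2 / √n * (D * (g + (b + 2) * (1 + K * (1 + Real.log n) / √n))) * (n / 2) := by
        nth_rewrite 1 [← h2]; ring
    _ ≤ _ := by
        refine mul_le_mul_of_nonneg_left (by linarith) (mul_nonneg (by positivity) ?_)
        linarith

end InvWishartBvM
end

noncomputable section

namespace InvWishartBvM

/-! ### Numerical bounds -/

/-- Write `ρ = D/F`. The diagonal part loses nothing, and the off-diagonal part carries `ρ²`. One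
factor `ρ` stays in the result; the other is absorbed through `ρ ≤ ρ² ≤ r ≤ HX`, which is where the
rank enters the rate. -/
theorem proxy_error_le {X n r L b g K F D H : ℝ} (hX : 6 ≤ X) (hXn : X ^ 2 = n) (hr : 1 ≤ r)
    (hL : 0 ≤ L) (hb : 0 < b) (hg : 0 ≤ g) (hK : 0 ≤ K) (hH : (g + r + b + L) / X = H)
    (hH1 : H ≤ 1) (hF : 0 < F) (hFD : F ≤ D) (hDr : D ^ 2 ≤ r * F ^ 2) :
    2 * (b + 2 + g) / n ≤ H ∧
    F ^ 2 * (84 * (1 / X + K / X + K * (1 + L) / X + 2 * (b + 2 + g) / n)) +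
      D ^ 2 * (8 / n + 72 * (K / X) + 18 * (2 * (b + 2 + g) / n) ^ 2) ≤
    F ^ 2 * (D / F * H * (300 + 240 * K)) := by
  have hX0 : 0 < X := by linarith
  have hsum : g + r + b + L = H * X := by rw [← hH]; field_simp
  have hH0 : 0 < H := by rw [← hH]; positivity
  obtain ⟨ρ, hρ⟩ : ∃ ρ, ρ = D / F := ⟨_, rfl⟩
  have hD : D = ρ * F := by rw [hρ]; field_simp
  have hρ1 : 1 ≤ ρ := by rw [hρ, le_div_iff₀ hF]; linarith
  have hρr : ρ ^ 2 ≤ r := by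
    rw [hD] at hDr
    have : 0 < F ^ 2 := by positivity
    nlinarith
  have hρr' : ρ ≤ r := by nlinarith
  obtain ⟨β, hβ⟩ : ∃ β, β = 2 * (b + 2 + g) / n := ⟨_, rfl⟩
  have hn : 0 < n := by rw [← hXn]; positivity
  have hβX : β * X ≤ 6 * H := by
    rw [hβ, ← hXn, div_mul_eq_mul_div, div_le_iff₀ (by positivity)]
    nlinarith
  have hβ0 : 0 ≤ β := by rw [hβ]; positivity
  have hβH : β ≤ H := by nlinarith
  have a1 : 1 / X ≤ H := by rw [div_le_iff₀ hX0]; linarith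
  have a2 : K / X ≤ K * H := by
    have := mul_le_mul_of_nonneg_left a1 hK
    rwa [mul_one_div] at this
  have a3 : K * (1 + L) / X ≤ K * H := by
    rw [mul_div_assoc]
    refine mul_le_mul_of_nonneg_left ?_ hK
    rw [div_le_iff₀ hX0]; linarith
  have a4 : ρ * (1 / X) ≤ H := by
    rw [mul_one_div, div_le_iff₀ hX0]; linarith
  have a5 : ρ * β ≤ 6 * H := by
    refine le_trans ?_ hβX
    rw [mul_comm]
    refine mul_le_mul_of_nonneg_left ?_ hβ0
    nlinarith
  have a6 : ρ * (8 / n) ≤ 8 * H := by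
    have : 1 / n ≤ 1 / X := by
      rw [← hXn]; refine one_div_le_one_div_of_le hX0 ?_; nlinarith
    have h2 : ρ * (8 / n) = 8 * (ρ * (1 / n)) := by ring
    have h3 : ρ * (1 / n) ≤ ρ * (1 / X) := mul_le_mul_of_nonneg_left this (by linarith)
    linarith
  have a7 : ρ * (K / X) ≤ K * H := by
    have := mul_le_mul_of_nonneg_left a4 hK
    have e : K * (ρ * (1 / X)) = ρ * (K / X) := by ring
    linarith
  have a8 : ρ * β ^ 2 ≤ 6 * H := by nlinarith
  rw [← hβ, ← hρ]
  refine ⟨hβH, ?_⟩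
  have h1 : 8 / n * ρ + 72 * (K / X) * ρ + 18 * β ^ 2 * ρ ≤ (116 + 72 * K) * H := by linarith
  have h2 := mul_le_mul_of_nonneg_left h1 (by linarith : 0 ≤ ρ)
  have h3 : 84 * (1 / X + K / X + K * (1 + L) / X + β) ≤ 84 * (2 + 2 * K) * H := by linarith
  have h4 : 84 * (2 + 2 * K) * H ≤ ρ * (84 * (2 + 2 * K) * H) :=
    le_mul_of_one_le_left (by positivity) hρ1
  have h5 : 0 ≤ K * (ρ * H) := by positivity
  have h6 : 0 ≤ ρ * H := by positivity
  have h7 : 84 * (1 / X + K / X + K * (1 + L) / X + β) +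
      ρ * (8 / n * ρ + 72 * (K / X) * ρ + 18 * β ^ 2 * ρ) ≤ ρ * H * (300 + 240 * K) := by
    nlinarith
  have h8 := mul_le_mul_of_nonneg_left h7 (sq_nonneg F)
  rw [hD]
  refine le_trans (le_of_eq ?_) h8
  ring

theorem centering_error_le {X r L b g K D H : ℝ} (hX : 6 ≤ X) (hr : 1 ≤ r)
    (hL : 0 ≤ L) (hb : 0 < b) (hg : 0 ≤ g) (hK : 0 ≤ K) (hH : (g + r + b + L) / X = H)
    (hH1 : H ≤ 1) (hD : 0 ≤ D) :
    2 / X * (D * (g + (b + 2) * (1 + K * (1 + L) / X))) ≤ D * H * (4 + 4 * K) := by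
  have hX0 : 0 < X := by linarith
  have hsum : g + r + b + L = H * X := by rw [← hH]; field_simp
  have hH0 : 0 < H := by rw [← hH]; positivity
  have h1 : K * (1 + L) / X ≤ K := by
    rw [div_le_iff₀ hX0]
    refine mul_le_mul_of_nonneg_left ?_ hK
    nlinarith
  have h2 : g + (b + 2) * (1 + K * (1 + L) / X) ≤ (2 * H * X) * (1 + K) := by
    have : (b + 2) * (1 + K * (1 + L) / X) ≤ (b + 2) * (1 + K) :=
      mul_le_mul_of_nonneg_left (by linarith) (by linarith)
    have h3 : g + b + 2 ≤ 2 * H * X := by linarith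
    have := mul_le_mul_of_nonneg_right h3 (by linarith : 0 ≤ 1 + K)
    nlinarith
  have h3 := mul_le_mul_of_nonneg_left (mul_le_mul_of_nonneg_left h2 hD)
    (by positivity : 0 ≤ 2 / X)
  refine h3.trans (le_of_eq ?_)
  field_simp
  ring

/-- The two cases of the comparison with the target: either the target is trivial, or it dominates
the rate `H`. -/
theorem one_le_or_rate_le {n r b g L C F D : ℝ} (hn : 1 ≤ n) (hr : 1 ≤ r)
    (hL : 0 ≤ L) (hb : 0 < b) (hg : 0 ≤ g) (hC : 6 ≤ C) (hF : 0 < F) (hFD : F ≤ D)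
    {T : ℝ} (hT : T = C * (D * (g / √(n + r + b - 1) + (r + b) / √(n + r + b - 1))) +
      C * (D * √(r + L) * (√((r + L) / n) + √((r + L) / (n + r + b - 1)) +
        g / (n + r + b - 1)))) :
    1 ≤ T / F + C / √n ∨ 6 ≤ √n ∧ (g + r + b + L) / √n ≤ 1 ∧
      D / F * ((g + r + b + L) / √n) * (C / 2) ≤ T / F := by
  by_cases h1 : 1 ≤ T / F + C / √n
  · exact Or.inl h1
  right
  push Not at h1
  set N := n + r + b - 1 with hN
  have hX0 : 0 < √n := Real.sqrt_pos.2 (by linarith)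
  have hN0 : 0 < √N := Real.sqrt_pos.2 (by linarith)
  have hNp : 0 < N := by linarith
  have hNN : √N ^ 2 = N := Real.sq_sqrt hNp.le
  have hXX : √n ^ 2 = n := Real.sq_sqrt (by linarith)
  have hD0 : 0 < D := by linarith
  -- Because `D/F ≥ 1`, a failure of the trivial case makes both rates `(r + L)/√n` and `(g + r +
  -- b)/√N` small, and also `√n > C`.
  have hρ1 : 1 ≤ D / F := by rw [le_div_iff₀ hF]; linarith
  have hC0 : 0 < C := by linarith
  have e4 : √(r + L) * √((r + L) / n) = (r + L) / √n := by
    rw [Real.sqrt_div (by linarith), mul_div_assoc', Real.mul_self_sqrt (by linarith)]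
  have h4 : C * (D / F) * ((r + L) / √n) + C * (D / F) * ((g + (r + b)) / √N) ≤ T / F := by
    rw [le_div_iff₀ hF, hT]
    have : 0 ≤ C * (D * √(r + L) * (√((r + L) / N) + g / N)) := by positivity
    have e : (C * (D / F) * ((r + L) / √n) + C * (D / F) * ((g + (r + b)) / √N)) * F =
        C * (D * (g / √N + (r + b) / √N)) + C * (D * (√(r + L) * √((r + L) / n))) := by
      rw [e4]; field_simp; ring
    rw [e]
    nlinarith
  have p1 : 0 ≤ (r + L) / √n := by positivity
  have p2 : 0 ≤ (g + (r + b)) / √N := by positivity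
  have p3 : 0 ≤ C / √n := by positivity
  have q1 : C * ((r + L) / √n) ≤ C * (D / F) * ((r + L) / √n) := by
    rw [mul_assoc]
    exact mul_le_mul_of_nonneg_left (le_mul_of_one_le_left p1 hρ1) hC0.le
  have q2 : C * ((g + (r + b)) / √N) ≤ C * (D / F) * ((g + (r + b)) / √N) := by
    rw [mul_assoc]
    exact mul_le_mul_of_nonneg_left (le_mul_of_one_le_left p2 hρ1) hC0.le
  have p4 : 0 ≤ C * ((r + L) / √n) := by positivity
  have p5 : 0 ≤ C * ((g + (r + b)) / √N) := by positivity
  have s1 : C / √n < 1 := by linarith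
  have s2 : 6 * ((r + L) / √n) < 1 := by nlinarith
  have s3 : 6 * ((g + (r + b)) / √N) < 1 := by nlinarith
  rw [div_lt_one hX0] at s1
  rw [mul_div_assoc', div_lt_one hN0] at s3
  -- As `r + b` is below `√N / 6`, the effective size `N` exceeds `n` only by a small fraction of
  -- itself. The factor `2` lost here is the reason for `C / 2` in the conclusion.
  have hNX : √N ≤ 2 * √n := by
    refine Real.sqrt_le_iff.2 ⟨by positivity, ?_⟩
    have hN1 : 1 ≤ √N := Real.one_le_sqrt.2 (by linarith)
    rw [mul_pow, hXX]
    nlinarith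
  have hcmp : (g + r + b + L) / √n ≤ (r + L) / √n + 2 * ((g + (r + b)) / √N) := by
    have : (g + (r + b)) / √n ≤ 2 * ((g + (r + b)) / √N) := by
      rw [mul_div_assoc', div_le_div_iff₀ hX0 hN0]
      nlinarith [show 0 ≤ g + (r + b) by positivity]
    have h2 : (g + r + b + L) / √n ≤ (r + L) / √n + (g + (r + b)) / √n := by
      rw [← add_div]
      exact div_le_div_of_nonneg_right (by linarith) hX0.le
    linarith
  refine ⟨by linarith, ?_, ?_⟩
  · have s3' : 6 * ((g + (r + b)) / √N) < 1 := by
      rw [mul_div_assoc', div_lt_one hN0]; exact s3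
    linarith
  · have := mul_le_mul_of_nonneg_left hcmp (by positivity : 0 ≤ D / F * (C / 2))
    have p6 : 0 ≤ C * (D / F) * ((r + L) / √n) := by positivity
    have e : D / F * (C / 2) * ((r + L) / √n + 2 * ((g + (r + b)) / √N)) =
        C * (D / F) * ((r + L) / √n) / 2 + C * (D / F) * ((g + (r + b)) / √N) := by ring
    rw [mul_right_comm]
    linarith

end InvWishartBvM
end

noncomputable section

namespace InvWishartBvM

variable {n p r : ℕ} {b g K : ℝ} {G S₀ : Matrix (Fin p) (Fin p) ℝ}
  {x : Fin n → EuclideanSpace ℝ (Fin p)} {W : Matrix (Fin p) (Fin r) ℝ} {d : Fin r → ℝ}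

/-! ### The deterministic form of the theorem -/

theorem isSymm_reduced (W : Matrix (Fin p) (Fin r) ℝ) (d : Fin r → ℝ) :
    (W * diagonal d * Wᵀ).IsSymm := by
  simp [IsSymm, transpose_mul, Matrix.mul_assoc]

/-- This is the Stein error for `s = √n/(√2 F)`, since then `2s²/m = n/(F²m)`. The constant is twice
that of `proxy_error_le`, from `n/m ≤ 2`, plus one for replacing `n/m` by `1`. -/
theorem integral_abs_one_sub_proxy_le {F D H : ℝ} (hG : G.PosDef) (hb : 0 < b)
    (hn : 6 ≤ √(n : ℝ)) (hr : 1 ≤ r) (hg0 : 0 ≤ g) (hK : 0 ≤ K)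
    (hg : ∀ a, a ⬝ᵥ a = 1 → (W *ᵥ a) ⬝ᵥ (G *ᵥ (W *ᵥ a)) ≤ g) (hx : FluctBounds x W d K)
    (hF : 0 < F) (hF2 : ∑ i, d i ^ 2 = F ^ 2) (hD : ∑ i, |d i| = D) (hFD : F ≤ D)
    (hDr : D ^ 2 ≤ r * F ^ 2) (hH : (g + r + b + Real.log n) / √n = H) (hH1 : H ≤ 1) :
    ∫ S, |1 - n / (F ^ 2 * (n + b - 2)) *
        (W * diagonal d * Wᵀ * S * (W * diagonal d * Wᵀ * S)).trace|
        ∂invWishart ((n : ℝ) • sampleCov x + G) (n + p + b - 1) ≤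
      D / F * H * (601 + 480 * K) := by
  have hXn : √(n : ℝ) ^ 2 = n := Real.sq_sqrt (Nat.cast_nonneg _)
  have hn36 : (36 : ℝ) ≤ n := by nlinarith
  have hA := posDef_smul_sampleCov_add x hG
  have hν : (p : ℝ) + 5 < n + p + b - 1 := by linarith
  have := isProbabilityMeasure_invWishart hA (ν := n + p + b - 1) (by linarith)
  obtain ⟨hβ, hE⟩ := proxy_error_le hn hXn (by exact_mod_cast hr)
    (Real.log_nonneg (by linarith : (1 : ℝ) ≤ n)) hb hg0 hK hH hH1 hF hFD hDr
  have hV := integral_abs_trace_sq_sub_le hG hb hn hg (hβ.trans hH1) hx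
  rw [hF2, hD] at hV
  replace hV := hV.trans hE
  have hF20 : 0 < F ^ 2 := by positivity
  have hm : 0 < (n : ℝ) + b - 2 := by linarith
  have hT := integrable_trace_mul_mul hA hν.le (W * diagonal d * Wᵀ)
  have hT' : Integrable (fun S => 2 / F ^ 2 *
      |(W * diagonal d * Wᵀ * S * (W * diagonal d * Wᵀ * S)).trace - F ^ 2|)
      (invWishart ((n : ℝ) • sampleCov x + G) (n + p + b - 1)) :=
    (hT.sub (integrable_const _)).abs.const_mul _
  have hnm : n / ((n : ℝ) + b - 2) ≤ 2 := by rw [div_le_iff₀ hm]; linarith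
  have hnm1 : |1 - n / ((n : ℝ) + b - 2)| ≤ H := by
    refine le_trans ?_ hβ
    have e : 1 - n / ((n : ℝ) + b - 2) = (b - 2) / (n + b - 2) := by field_simp; ring
    rw [e, abs_div, abs_of_pos hm]
    have : |b - 2| ≤ b + 2 + g := by rw [abs_le]; constructor <;> linarith
    rw [div_le_div_iff₀ hm (by linarith)]
    have h1 : |b - 2| * n ≤ (b + 2 + g) * n := by gcongr
    have h2 : (b + 2 + g) * n ≤ (b + 2 + g) * (2 * (n + b - 2)) :=
      mul_le_mul_of_nonneg_left (by linarith) (by linarith)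
    linarith
  have h1 : ∫ S, |1 - n / (F ^ 2 * (n + b - 2)) *
        (W * diagonal d * Wᵀ * S * (W * diagonal d * Wᵀ * S)).trace|
        ∂invWishart ((n : ℝ) • sampleCov x + G) (n + p + b - 1) ≤
      ∫ S, (H + 2 / F ^ 2 *
        |(W * diagonal d * Wᵀ * S * (W * diagonal d * Wᵀ * S)).trace - F ^ 2|)
        ∂invWishart ((n : ℝ) • sampleCov x + G) (n + p + b - 1) := by
    refine integral_mono ((integrable_const _).sub (hT.const_mul _)).abs
      ((integrable_const _).add hT') fun S => ?_
    simp only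
    set T := (W * diagonal d * Wᵀ * S * (W * diagonal d * Wᵀ * S)).trace
    have e : 1 - n / (F ^ 2 * (n + b - 2)) * T =
        (1 - n / (n + b - 2)) - n / (n + b - 2) * ((T - F ^ 2) / F ^ 2) := by
      field_simp; ring
    rw [e]
    refine (abs_sub _ _).trans (add_le_add hnm1 ?_)
    rw [abs_mul, abs_div (T - F ^ 2), abs_of_pos hF20, abs_of_nonneg (by positivity)]
    refine (mul_le_mul_of_nonneg_right hnm (by positivity)).trans (le_of_eq ?_)
    ring
  rw [integral_add (integrable_const _) hT', integral_const_mul] at h1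
  simp only [integral_const, probReal_univ, one_smul] at h1
  have h2 := mul_le_mul_of_nonneg_left hV (by positivity : 0 ≤ 2 / F ^ 2)
  have e2 : 2 / F ^ 2 * (F ^ 2 * (D / F * H * (300 + 240 * K))) =
      D / F * H * (600 + 480 * K) := by field_simp; ring
  have hH0 : 0 ≤ H := (abs_nonneg _).trans hnm1
  have h3 : H ≤ D / F * H :=
    le_mul_of_one_le_left hH0 (by rw [le_div_iff₀ hF]; linarith)
  linarith

theorem kolmogorovDist_posterior_le {F D H Cφ δW δhat : ℝ} (hG : G.PosDef) (hb : 0 < b)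
    (hn : 6 ≤ √(n : ℝ)) (hr : 1 ≤ r) (hg0 : 0 ≤ g) (hK : 0 ≤ K)
    (hg : ∀ a, a ⬝ᵥ a = 1 → (W *ᵥ a) ⬝ᵥ (G *ᵥ (W *ᵥ a)) ≤ g) (hx : FluctBounds x W d K)
    (hF : 0 < F) (hF2 : ∑ i, d i ^ 2 = F ^ 2) (hD : ∑ i, |d i| = D) (hFD : F ≤ D)
    (hDr : D ^ 2 ≤ r * F ^ 2) (hH : (g + r + b + Real.log n) / √n = H) (hH1 : H ≤ 1)
    (_ : 0 ≤ δW) (_ : 0 ≤ δhat)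
    (hpost : invWishart ((n : ℝ) • sampleCov x + G) (n + p + b - 1)
      {S | δW * specNorm S₀ < specNorm (S - S₀)} ≤ ENNReal.ofReal (1 / n))
    (hhat : specNorm (sampleCov x - S₀) ≤ δhat * specNorm S₀)
    {φ : Matrix (Fin p) (Fin p) ℝ → ℝ} (hφ : Measurable φ) (hCφ : 0 ≤ Cφ)
    (hexp : ∀ S : Matrix (Fin p) (Fin p) ℝ, S.PosSemidef →
      specNorm (S - S₀) ≤ max δW δhat * specNorm S₀ →
      |φ S - φ S₀ - (W * diagonal d * Wᵀ * (S - S₀)).trace| ≤ Cφ * specNorm (S - S₀) ^ 2) :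
    kolmogorovDist ((invWishart ((n : ℝ) • sampleCov x + G) (n + p + b - 1)).map
        fun S => √n * (φ S - φ (sampleCov x))) (gaussianReal 0 (2 * F ^ 2).toNNReal) ≤
      (deltaRemainder n δW Cφ (specNorm S₀) + deltaRemainder n δhat Cφ (specNorm S₀)) / F +
        D / F * H * (1207 + 964 * K) := by
  have hXn : √(n : ℝ) ^ 2 = n := Real.sq_sqrt (Nat.cast_nonneg _)
  have hn36 : (36 : ℝ) ≤ n := by nlinarith
  have hX0 : 0 < √(n : ℝ) := by linarith
  have hA := posDef_smul_sampleCov_add x hG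
  have hν : (p : ℝ) + 5 < n + p + b - 1 := by linarith
  have := isProbabilityMeasure_invWishart hA (ν := n + p + b - 1) (by linarith)
  have hL : 0 ≤ Real.log n := Real.log_nonneg (by linarith)
  have hr1 : (1 : ℝ) ≤ r := by exact_mod_cast hr
  have hD0 : 0 ≤ D := hF.le.trans hFD
  have hs0 : 0 ≤ specNorm S₀ := norm_nonneg _
  have hproxy := integral_abs_one_sub_proxy_le hG hb hn hr hg0 hK hg hx hF hF2 hD hFD hDr hH hH1
  have hcent := abs_centering_le (d := d) hb hn hG hg hx
  rw [hD] at hcent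
  replace hcent := hcent.trans (centering_error_le hn hr1 hL hb hg0 hK hH hH1 hD0)
  set A := (n : ℝ) • sampleCov x + G with hAd
  set P := invWishart A (n + p + b - 1) with hP
  set Φ := W * diagonal d * Wᵀ with hΦ
  set σ := √2 * F with hσd
  have h2 : √(2 : ℝ) ^ 2 = 2 := Real.sq_sqrt (by norm_num)
  have hσ : 0 < σ := by positivity
  have hσ2 : σ ^ 2 = 2 * F ^ 2 := by rw [hσd, mul_pow, h2]
  have hFσ : F ≤ σ := by
    rw [hσd]
    exact le_mul_of_one_le_left hF.le (Real.one_le_sqrt.2 (by norm_num))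
  have e1 : (n : ℝ) + p + b - 1 - p - 1 = n + b - 2 := by ring
  set m := (n : ℝ) + b - 2 with hm
  set R₁ := deltaRemainder n δW Cφ (specNorm S₀) with hR₁
  set R₂ := deltaRemainder n δhat Cφ (specNorm S₀) with hR₂
  have hR₁0 : 0 ≤ R₁ := by rw [hR₁, deltaRemainder]; positivity
  have hR₂0 : 0 ≤ R₂ := by rw [hR₂, deltaRemainder]; positivity
  have hH0 : 0 ≤ H := by rw [← hH]; positivity
  -- The final constants add up as `2(601 + 480K)` from Stein's method, `1` from the posterior mass
  -- `1/n ≤ H`, and `4 + 4K` from the centering.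
  have key := kolmogorovDist_le_of_approx (P := P)
    (F := fun S => √n / σ * ((Φ * S).trace - (A * Φ).trace / m))
    (R := fun S => √n * (φ S - φ (sampleCov x)))
    (η := 2 * (D / F * H * (601 + 480 * K))) (δ := 1 / n)
    (Δ := R₁ + R₂ + D * H * (4 + 4 * K))
    (N := {S | δW * specNorm S₀ < specNorm (S - S₀)} ∪ {S | ¬ S.PosDef})
    ((hφ.sub_const _).const_mul _) hσ (by positivity) ?_ ?_ ?_
  · rw [hσ2] at key
    refine key.trans ?_
    have h3 : (R₁ + R₂ + D * H * (4 + 4 * K)) / σ ≤ (R₁ + R₂ + D * H * (4 + 4 * K)) / F :=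
      div_le_div_of_nonneg_left (by positivity) hF hFσ
    have h4 : (R₁ + R₂ + D * H * (4 + 4 * K)) / F = (R₁ + R₂) / F + D / F * H * (4 + 4 * K) := by
      ring
    have h5 : 1 / (n : ℝ) ≤ H := by
      rw [← hH, div_le_div_iff₀ (by linarith) hX0]
      nlinarith
    have h6 : H ≤ D / F * H :=
      le_mul_of_one_le_left hH0 (by rw [le_div_iff₀ hF]; linarith)
    linarith
  · refine ENNReal.toReal_le_of_le_ofReal (by positivity) ?_
    refine (measure_union_le _ _).trans ?_
    have : P {S | ¬ S.PosDef} = 0 := ae_posDef_invWishart A (n + p + b - 1)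
    rwa [this, add_zero]
  · intro t
    have := abs_measureReal_linear_sub_gaussian_le hA (isSymm_reduced W d) hν
      (s := √n / σ) (by positivity) t
    rw [e1] at this
    refine this.trans (mul_le_mul_of_nonneg_left (le_trans (le_of_eq ?_) hproxy) (by norm_num))
    have e : 2 * (√(n : ℝ) / σ) ^ 2 / m = n / (F ^ 2 * m) := by
      rw [div_pow, hXn, hσ2]; field_simp
    rw [e]
  · intro S hS
    simp only [Set.mem_union, Set.mem_ofPred_eq, not_or, not_lt, not_not] at hS
    obtain ⟨hS1, hS2⟩ := hS
    have b1 : |φ S - φ S₀ - (Φ * (S - S₀)).trace| ≤ Cφ * (δW * specNorm S₀) ^ 2 := by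
      refine (hexp S hS2.posSemidef (hS1.trans ?_)).trans ?_
      · gcongr; exact le_max_left _ _
      · have : 0 ≤ specNorm (S - S₀) := norm_nonneg _
        gcongr
    have b2 : |φ (sampleCov x) - φ S₀ - (Φ * (sampleCov x - S₀)).trace| ≤
        Cφ * (δhat * specNorm S₀) ^ 2 := by
      refine (hexp _ (posSemidef_sampleCov x) (hhat.trans ?_)).trans ?_
      · gcongr; exact le_max_right _ _
      · have : 0 ≤ specNorm (sampleCov x - S₀) := norm_nonneg _
        gcongr
    -- The linear terms at `S₀` cancel: what remains is the expansion error at `S`, the expansion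
    -- error at the sample covariance, and the shift of centering.
    have e : √n * (φ S - φ (sampleCov x)) - σ * (√n / σ * ((Φ * S).trace - (A * Φ).trace / m)) =
        √n * (φ S - φ S₀ - (Φ * (S - S₀)).trace) -
        √n * (φ (sampleCov x) - φ S₀ - (Φ * (sampleCov x - S₀)).trace) +
        √n * ((A * Φ).trace / m - (Φ * sampleCov x).trace) := by
      rw [Matrix.mul_sub, Matrix.mul_sub, trace_sub, trace_sub]
      field_simp
      ring
    rw [e]
    refine (abs_add_le _ _).trans (add_le_add ((abs_sub _ _).trans (add_le_add ?_ ?_)) ?_)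
    · rw [abs_mul, abs_of_pos hX0]
      refine (mul_le_mul_of_nonneg_left b1 hX0.le).trans (le_of_eq ?_)
      rw [hR₁, deltaRemainder]; ring
    · rw [abs_mul, abs_of_pos hX0]
      refine (mul_le_mul_of_nonneg_left b2 hX0.le).trans (le_of_eq ?_)
      rw [hR₂, deltaRemainder]; ring
    · rw [abs_mul, abs_of_pos hX0]
      exact hcent

/-! ### The event of bounded fluctuations -/

variable {Ω : Type*} [MeasurableSpace Ω] {P : Measure Ω}
  {X : Fin n → Ω → EuclideanSpace ℝ (Fin p)}

theorem measure_weighted_fluct_le (hn : 0 < n) (hS₀ : S₀.PosSemidef)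
    (hX : ∀ i, HasLaw (X i) (multivariateGaussian 0 S₀) P) (hind : iIndepFun X P)
    {ι : Type*} [Fintype ι] {u : ι → ℝ} (hu : ∀ i, 0 ≤ u i) (hU : 0 < ∑ i, u i)
    {v : ι → Fin p → ℝ} (hv : ∀ i, v i ⬝ᵥ (S₀ *ᵥ v i) = 1) (hK : 4 ≤ K) :
    P {ω | ¬ (∑ i, u i * fluct (fun k => X k ω) (v i) ≤ (∑ i, u i) * (K * (1 + Real.log n)) ∧
        ∑ i, u i * fluct (fun k => X k ω) (v i) ^ 2 ≤ (∑ i, u i) * (K * √n))} ≤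
      ENNReal.ofReal (25000 / (K * n)) := by
  refine (measure_mono fun ω hω => ?_).trans
    (measure_fluct_family_le hn hS₀ hX hind (w := fun i => u i / ∑ i, u i)
      (fun i => div_nonneg (hu i) hU.le) (by rw [← Finset.sum_div, div_self hU.ne']) hv hK)
  simp only [Set.mem_ofPred_eq, not_and_or, not_le] at hω ⊢
  simp only [div_mul_eq_mul_div, ← Finset.sum_div]
  rwa [lt_div_iff₀' hU, lt_div_iff₀' hU]

theorem measure_not_fluctBounds_le (hn : 0 < n) (hS₀ : S₀.PosSemidef)
    (hX : ∀ i, HasLaw (X i) (multivariateGaussian 0 S₀) P) (hind : iIndepFun X P)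
    (hW : Wᵀ * S₀ * W = 1) (hd : d ≠ 0) (hK : 4 ≤ K) :
    P {ω | ¬ FluctBounds (fun k => X k ω) W d K} ≤ ENNReal.ofReal (100000 / (K * n)) := by
  obtain ⟨i₀, hi₀⟩ := Function.ne_iff.1 hd
  have hunit : ∀ a, a ⬝ᵥ a = 1 → (W *ᵥ a) ⬝ᵥ (S₀ *ᵥ (W *ᵥ a)) = 1 := fun a ha => by
    rw [quadForm_mulVec, hW, one_mulVec, ha]
  have hF2 : 0 < ∑ i, d i ^ 2 :=
    Finset.sum_pos' (fun i _ => sq_nonneg _) ⟨i₀, Finset.mem_univ _, sq_pos_of_ne_zero hi₀⟩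
  have hD : 0 < ∑ i, |d i| :=
    Finset.sum_pos' (fun i _ => abs_nonneg _) ⟨i₀, Finset.mem_univ _, abs_pos.2 hi₀⟩
  have hD2 : ∑ ij : Fin r × Fin r, |d ij.1| * |d ij.2| = (∑ i, |d i|) ^ 2 := by
    rw [Fintype.sum_prod_type, sq, Finset.sum_mul_sum]
  -- Four families suffice: coordinate directions with weights `dᵢ²` and `|dᵢ|`, and pair directions
  -- for each sign with weights `|dᵢ dⱼ|`.
  have h1 := measure_weighted_fluct_le hn hS₀ hX hind (fun i => sq_nonneg (d i)) hF2
    (v := fun i => W *ᵥ Pi.single i 1) (fun i => hunit _ (by simp)) hK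
  have h2 := measure_weighted_fluct_le hn hS₀ hX hind (fun i => abs_nonneg (d i)) hD
    (v := fun i => W *ᵥ Pi.single i 1) (fun i => hunit _ (by simp)) hK
  have h3 := fun (s : ℝ) (hs : s ^ 2 = 1) => measure_weighted_fluct_le hn hS₀ hX hind
    (u := fun ij : Fin r × Fin r => |d ij.1| * |d ij.2|) (fun ij => by positivity)
    (by rw [hD2]; positivity)
    (v := fun ij => W *ᵥ pairDir s ij.1 ij.2)
    (fun ij => hunit _ (pairDir_dotProduct_self hs _ _)) hK
  have h4 := h3 1 (by norm_num)
  have h5 := h3 (-1) (by norm_num)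
  have hsum : ENNReal.ofReal (100000 / (K * n)) =
      ENNReal.ofReal (25000 / (K * n)) + ENNReal.ofReal (25000 / (K * n)) +
        ENNReal.ofReal (25000 / (K * n)) + ENNReal.ofReal (25000 / (K * n)) := by
    rw [← ENNReal.ofReal_add (by positivity) (by positivity),
      ← ENNReal.ofReal_add (by positivity) (by positivity),
      ← ENNReal.ofReal_add (by positivity) (by positivity)]
    congr 1; ring
  rw [hsum]
  refine le_trans (measure_mono fun ω hω => ?_) ((measure_union_le _ _).trans
    (add_le_add ((measure_union_le _ _).trans
      (add_le_add ((measure_union_le _ _).trans (add_le_add h1 h2)) h4)) h5))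
  contrapose hω
  simp only [Set.mem_union, Set.mem_ofPred_eq, not_or, not_not] at hω ⊢
  obtain ⟨⟨⟨a1, a2⟩, a3⟩, a4⟩ := hω
  rw [hD2] at a3 a4
  refine ⟨a1.1, a1.2, a2.1, fun s hs => ?_⟩
  rcases sq_eq_one_iff.1 hs with rfl | rfl
  · have := a3.2
    rwa [Fintype.sum_prod_type] at this
  · have := a4.2
    rwa [Fintype.sum_prod_type] at this

end InvWishartBvM
end

noncomputable section

namespace InvWishartBvM

/-! ### Reduction of the functional -/

theorem frobNorm_sq {p : ℕ} (A : Matrix (Fin p) (Fin p) ℝ) :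
    frobNorm A ^ 2 = (Aᵀ * A).trace := by
  rw [frobNorm, Real.sq_sqrt (by positivity), trace, Finset.sum_comm]
  simp only [diag_apply, mul_apply, transpose_apply, sq]

theorem frobNorm_sq_reduced {p r : ℕ} {V : Matrix (Fin p) (Fin r) ℝ} (hV : Vᵀ * V = 1)
    (d : Fin r → ℝ) : frobNorm (V * diagonal d * Vᵀ) ^ 2 = ∑ i, d i ^ 2 := by
  rw [frobNorm_sq, (isSymm_reduced V d).eq]
  have : V * diagonal d * Vᵀ * (V * diagonal d * Vᵀ) = V * (diagonal d * diagonal d * Vᵀ) := by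
    rw [Matrix.mul_assoc (V * diagonal d), ← Matrix.mul_assoc Vᵀ, ← Matrix.mul_assoc Vᵀ, hV,
      Matrix.one_mul]
    simp only [Matrix.mul_assoc]
  rw [this, Matrix.trace_mul_comm, Matrix.mul_assoc, hV, Matrix.mul_one, diagonal_mul_diagonal,
    trace_diagonal]
  simp only [sq]

theorem frobNorm_diagonal {r : ℕ} (d : Fin r → ℝ) :
    frobNorm (diagonal d) = √(∑ i, d i ^ 2) := by
  rw [frobNorm]
  congr 1
  refine Finset.sum_congr rfl fun i _ => ?_
  rw [Finset.sum_eq_single i (fun j _ hj => by simp [diagonal_apply_ne _ hj.symm]) (by simp),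
    diagonal_apply_eq]

/-- In the columns of `Σ*^{-1/2} V` the true covariance becomes the identity, `Φ` becomes diagonal
and `G` becomes `G̃`, so only the rank `r` matters from here on. -/
theorem whitening_identities {p r : ℕ} {S₀ Φ : Matrix (Fin p) (Fin p) ℝ} (hS₀ : S₀.PosDef)
    {V : Matrix (Fin p) (Fin r) ℝ} {d : Fin r → ℝ} (hV : Vᵀ * V = 1)
    (hΦ : matSqrt S₀ * Φ * matSqrt S₀ = V * diagonal d * Vᵀ) :
    ((matSqrt S₀)⁻¹ * V)ᵀ = Vᵀ * (matSqrt S₀)⁻¹ ∧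
    ((matSqrt S₀)⁻¹ * V)ᵀ * S₀ * ((matSqrt S₀)⁻¹ * V) = 1 ∧
    Φ = ((matSqrt S₀)⁻¹ * V) * diagonal d * ((matSqrt S₀)⁻¹ * V)ᵀ := by
  obtain ⟨hQ, hQS⟩ := exists_sqrt_posDef hS₀
  have hu : IsUnit (matSqrt S₀).det := hQ.det_pos.ne'.isUnit
  have hQi : ((matSqrt S₀)⁻¹)ᵀ = (matSqrt S₀)⁻¹ := by
    rw [transpose_nonsing_inv, (isSymm_of_posDef hQ).eq]
  have hT : ((matSqrt S₀)⁻¹ * V)ᵀ = Vᵀ * (matSqrt S₀)⁻¹ := by rw [transpose_mul, hQi]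
  refine ⟨hT, ?_, ?_⟩
  · rw [hT]
    calc Vᵀ * (matSqrt S₀)⁻¹ * S₀ * ((matSqrt S₀)⁻¹ * V)
        = Vᵀ * ((matSqrt S₀)⁻¹ * (matSqrt S₀ * matSqrt S₀) * (matSqrt S₀)⁻¹) * V := by
          rw [hQS]; simp only [Matrix.mul_assoc]
      _ = 1 := by
          rw [← Matrix.mul_assoc (matSqrt S₀)⁻¹, nonsing_inv_mul _ hu, Matrix.one_mul, mul_nonsing_inv _ hu,
            Matrix.mul_one, hV]
  · rw [hT]
    calc Φ = (matSqrt S₀)⁻¹ * (matSqrt S₀ * Φ * matSqrt S₀) * (matSqrt S₀)⁻¹ := by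
          rw [Matrix.mul_assoc, Matrix.mul_assoc (matSqrt S₀ * Φ), mul_nonsing_inv _ hu,
            Matrix.mul_one, ← Matrix.mul_assoc, nonsing_inv_mul _ hu, Matrix.one_mul]
      _ = _ := by rw [hΦ]; simp only [Matrix.mul_assoc]

end InvWishartBvM
end

/-! ### The main theorem -/

open InvWishartBvM in
theorem mainTheorem1 :
    -- conjugacy of the Inverse Wishart prior
    (∀ (p n : ℕ) (b : ℝ) (G : Matrix (Fin p) (Fin p) ℝ)
        (x : Fin n → EuclideanSpace ℝ (Fin p)), 0 < n → 0 < b → G.PosDef →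
      posterior (invWishart G (p + b - 1)) x
        = invWishart ((n : ℝ) • sampleCov x + G) (n + p + b - 1)) ∧
    -- Bernstein–von Mises theorem; the constant `C` depends only on `κ`
    (∀ κ : ℝ, 0 < κ → ∃ C : ℝ, 0 < C ∧
      ∀ (p n r : ℕ) (_ : 0 < n)
        -- the prior parameters
        (b : ℝ) (_ : 0 < b) (G : Matrix (Fin p) (Fin p) ℝ) (_ : G.PosDef)
        -- the data: `n` independent observations with law `N(0, S₀)`
        (S₀ : Matrix (Fin p) (Fin p) ℝ) (_ : S₀.PosDef)
        (Ω : Type*) [MeasurableSpace Ω] (P : Measure Ω) [IsProbabilityMeasure P]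
        (X : Fin n → Ω → EuclideanSpace ℝ (Fin p))
        (_ : ∀ i, HasLaw (X i) (multivariateGaussian 0 S₀) P) (_ : iIndepFun X P)
        -- the contraction rates of the posterior and of the sample covariance
        (δW δhat : ℝ) (_ : 0 ≤ δW) (_ : 0 ≤ δhat)
        (_ : P {ω | ENNReal.ofReal (1 / n) <
            posterior (invWishart G (p + b - 1)) (fun i => X i ω)
              {S | δW * specNorm S₀ < specNorm (S - S₀)}} ≤ ENNReal.ofReal (κ / (4 * n)))
        (_ : P {ω | δhat * specNorm S₀ < specNorm (sampleCov (fun i => X i ω) - S₀)}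
            ≤ ENNReal.ofReal (κ / (4 * n)))
        -- the functional and its linear expansion at `S₀`
        (φ : Matrix (Fin p) (Fin p) ℝ → ℝ) (_ : Measurable φ)
        (Φ : Matrix (Fin p) (Fin p) ℝ) (_ : Φ.IsSymm) (_ : Φ ≠ 0)
        (Cφ : ℝ) (_ : 0 ≤ Cφ)
        (_ : ∀ S : Matrix (Fin p) (Fin p) ℝ, S.PosSemidef →
          specNorm (S - S₀) ≤ max δW δhat * specNorm S₀ →
          |φ S - φ S₀ - (Φ * (S - S₀)).trace| ≤ Cφ * specNorm (S - S₀) ^ 2)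
        -- the reduced spectral decomposition `S₀^{1/2} Φ S₀^{1/2} = V D Vᵀ`
        (V : Matrix (Fin p) (Fin r) ℝ) (d : Fin r → ℝ)
        (_ : r = (matSqrt S₀ * Φ * matSqrt S₀).rank) (_ : Vᵀ * V = 1)
        (_ : matSqrt S₀ * Φ * matSqrt S₀ = V * Matrix.diagonal d * Vᵀ),
      P {ω | ¬ (kolmogorovDist
            ((posterior (invWishart G (p + b - 1)) (fun i => X i ω)).map
              fun S => Real.sqrt n * (φ S - φ (sampleCov fun i => X i ω)))
            (gaussianReal 0 (2 * frobNorm (matSqrt S₀ * Φ * matSqrt S₀) ^ 2).toNNReal)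
          ≤ (deltaRemainder n δW Cφ (specNorm S₀) + deltaRemainder n δhat Cφ (specNorm S₀)
              + C * deltaThree n r b d
                  (specNorm (Vᵀ * (matSqrt S₀)⁻¹ * G * (matSqrt S₀)⁻¹ * V))
              + C * deltaFour n r b d
                  (specNorm (Vᵀ * (matSqrt S₀)⁻¹ * G * (matSqrt S₀)⁻¹ * V)))
              / frobNorm (Matrix.diagonal d)
            + C / Real.sqrt n)}
        ≤ ENNReal.ofReal (κ / n)) := by
  refine ⟨fun p n b G x hn hb hG => posterior_invWishart hn hb hG x, fun κ hκ => ?_⟩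
  -- Chosen so that the fluctuation event fails with probability at most `100000/(Kn) ≤ κ/(2n)`.
  set K : ℝ := max 4 (200000 / κ) with hKd
  have hK4 : 4 ≤ K := le_max_left _ _
  have hKκ : 200000 / κ ≤ K := le_max_right _ _
  -- Twice the deterministic constant, to match the `C / 2` of `one_le_or_rate_le`.
  set C : ℝ := 2 * (1207 + 964 * K) with hC
  refine ⟨C, by positivity, ?_⟩
  intro p n r hn b hb G hG S₀ hS₀ Ω _ P _ X hX hind δW δhat hδW hδhat hpost hhat φ hφ Φ hΦs hΦ0 Cφ
    hCφ hexp V d hr hV hdec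
  obtain ⟨hWT, hWS, hΦW⟩ := whitening_identities hS₀ hV hdec
  have hgW : Vᵀ * (matSqrt S₀)⁻¹ * G * (matSqrt S₀)⁻¹ * V =
      ((matSqrt S₀)⁻¹ * V)ᵀ * G * ((matSqrt S₀)⁻¹ * V) := by
    rw [hWT]; simp only [Matrix.mul_assoc]
  have hFsq := frobNorm_sq_reduced hV d
  rw [hgW, hdec, hFsq, frobNorm_diagonal]
  set W := (matSqrt S₀)⁻¹ * V with hW
  set g := specNorm (Wᵀ * G * W) with hgd
  have hg0 : 0 ≤ g := norm_nonneg _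
  have hg : ∀ a, a ⬝ᵥ a = 1 → (W *ᵥ a) ⬝ᵥ (G *ᵥ (W *ᵥ a)) ≤ g := fun a ha => by
    rw [quadForm_mulVec]
    exact (le_abs_self _).trans (abs_quadForm_le_specNorm _ ha)
  have hd0 : d ≠ 0 := by
    rintro rfl
    refine hΦ0 ?_
    rw [hΦW, diagonal_zero', Matrix.mul_zero, Matrix.zero_mul]
  obtain ⟨i₀, hi₀⟩ := Function.ne_iff.1 hd0
  have hr1 : 1 ≤ r := i₀.pos
  have hF2 : 0 < ∑ i, d i ^ 2 :=
    Finset.sum_pos' (fun i _ => sq_nonneg _) ⟨i₀, Finset.mem_univ _, sq_pos_of_ne_zero hi₀⟩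
  set F := √(∑ i, d i ^ 2) with hFd
  have hF : 0 < F := Real.sqrt_pos.2 hF2
  have hFF : ∑ i, d i ^ 2 = F ^ 2 := (Real.sq_sqrt hF2.le).symm
  obtain ⟨D, hD⟩ : ∃ D, ∑ i, |d i| = D := ⟨_, rfl⟩
  have hFD : F ≤ D := by
    refine Real.sqrt_le_iff.2 ⟨by rw [← hD]; positivity, ?_⟩
    rw [← hD]
    simp only [← sq_abs (d _)]
    exact Finset.sum_sq_le_sq_sum_of_nonneg fun i _ => abs_nonneg _
  have hDr : D ^ 2 ≤ r * F ^ 2 := by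
    have := sq_sum_le_card_mul_sum_sq (s := Finset.univ) (f := fun i => |d i|)
    simp only [sq_abs, Finset.card_univ, Fintype.card_fin] at this
    rwa [hD, hFF] at this
  have hn1 : (1 : ℝ) ≤ n := by exact_mod_cast hn
  have hX0 : 0 < √(n : ℝ) := Real.sqrt_pos.2 (by linarith)
  have hfl := measure_not_fluctBounds_le hn hS₀.posSemidef hX hind hWS hd0 hK4
  -- The failure budget: half for the fluctuations, a quarter for each of the two contraction
  -- hypotheses.
  have hsum : ENNReal.ofReal (κ / n) = ENNReal.ofReal (κ / (2 * n)) +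
      ENNReal.ofReal (κ / (4 * n)) + ENNReal.ofReal (κ / (4 * n)) := by
    rw [← ENNReal.ofReal_add (by positivity) (by positivity),
      ← ENNReal.ofReal_add (by positivity) (by positivity)]
    congr 1; field_simp; ring
  have hfl' : ENNReal.ofReal (100000 / (K * n)) ≤ ENNReal.ofReal (κ / (2 * n)) := by
    refine ENNReal.ofReal_le_ofReal ?_
    rw [div_le_iff₀ hκ] at hKκ
    rw [div_le_div_iff₀ (by positivity) (by positivity)]
    nlinarith
  rw [hsum]
  refine le_trans (measure_mono fun ω hω => ?_) ((measure_union_le _ _).trans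
    (add_le_add ((measure_union_le _ _).trans (add_le_add (hfl.trans hfl') hpost)) hhat))
  contrapose hω
  simp only [Set.mem_union, Set.mem_ofPred_eq, not_or, not_not, not_lt] at hω ⊢
  obtain ⟨⟨hω1, hω2⟩, hω3⟩ := hω
  rw [posterior_invWishart hn hb hG] at hω2 ⊢
  have hA := posDef_smul_sampleCov_add (fun i => X i ω) hG
  have := isProbabilityMeasure_invWishart hA (ν := n + p + b - 1) (by linarith)
  have hR₁ : 0 ≤ deltaRemainder n δW Cφ (specNorm S₀) := by rw [deltaRemainder]; positivity
  have hR₂ : 0 ≤ deltaRemainder n δhat Cφ (specNorm S₀) := by rw [deltaRemainder]; positivity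
  set R := deltaRemainder n δW Cφ (specNorm S₀) + deltaRemainder n δhat Cφ (specNorm S₀) with hR
  have hR0 : 0 ≤ R / F := div_nonneg (add_nonneg hR₁ hR₂) hF.le
  set T := C * deltaThree n r b d g + C * deltaFour n r b d g with hT
  have hTe : (R + C * deltaThree n r b d g + C * deltaFour n r b d g) / F = R / F + T / F := by
    rw [hT]; ring
  rw [hTe]
  -- The summand `C / √n` serves only the trivial case, where it covers small `n`.
  rcases one_le_or_rate_le hn1 (by exact_mod_cast hr1 : (1 : ℝ) ≤ r) (Real.log_nonneg hn1) hb hg0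
    (by linarith : 6 ≤ C) hF hFD (T := T) (by rw [hT, deltaThree, deltaFour, effSize, hD]) with
    h1 | ⟨h6, hH1, hrate⟩
  · have hm : IsProbabilityMeasure ((invWishart ((n : ℝ) • sampleCov (fun i => X i ω) + G)
        (n + p + b - 1)).map fun S => √n * (φ S - φ (sampleCov fun i => X i ω))) :=
      Measure.isProbabilityMeasure_map ((hφ.sub_const _).const_mul _).aemeasurable
    exact (kolmogorovDist_le_one _ _).trans (by linarith)
  · have hkey := kolmogorovDist_posterior_le hG hb h6 hr1 hg0 (by linarith : 0 ≤ K) hg hω1 hF hFF hD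
      hFD hDr rfl hH1 hδW hδhat hω2 hω3 hφ hCφ (by rwa [← hΦW])
    rw [hFF]
    have hC0 : 0 ≤ C / √n := by positivity
    have e : 1207 + 964 * K = C / 2 := by rw [hC]; ring
    rw [e] at hkey
    linarith
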